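/- Manifolds are smooth, without boundary, Hausdorff, second countable and finite-dimensional. For a smooth action of a Lie group $G$ on a manifold $X$, let $G\ltimes X$ be the action groupoid: the Lie groupoid with objects $X$, arrows $G\times X$, source $s(g,x)=x$, target $t(g,x)=gx$, and composition $(g_1,g_2x)(g_2,x)=(g_1g_2,x)$. A smooth functor $\varphi\colon\mathcal G\to\mathcal H$ of Lie groupoids is a *weak equivalence* if $\mathcal G_0\times_{\varphi_0,t}\mathcal H_1\to\mathcal H_0$, $(x,h)\mapsto s(h)$, is a surjective submersion and $\mathcal G_1\to\mathcal G_0^2\times_{\varphi_0^2,(s,t)}\mathcal H_1$, $g\mapsto(s(g),t(g),\varphi(g))$, is a diffeomorphism; it is a *surjective submersive weak equivalence* if moreover $\varphi_0$ is a surjective submersion. A functor $\varphi\colon G\ltimes X\to H\ltimes Y$ is *equivariant* if it has the form $(g,x)\mapsto(\widetilde\varphi(g),\varphi_0(x))$ for a Lie group homomorphism $\widetilde\varphi\colon G\to H$ and a smooth map $\varphi_0\colon X\to Y$. Consider the following properties of an action groupoid $G\ltimes X$: *free* (all stabilisers are trivial); *locally free* (there is a neighbourhood $U$ of $1_G$ such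 that no $g\in U\smallsetminus\{1_G\}$ fixes a point of $X$); *transitive*; *compact* or *discrete* ($G$ is so); *proper* (the map $(s,t)\colon G\times X\to X\times X$ is proper); *orbifold groupoid* ($G\ltimes X$ is Morita equivalent to a proper étale Lie groupoid, i.e. there are weak equivalences from one Lie groupoid to both). Let $\mathcal P$ be any (possibly empty) set of these properties. **Theorem.** Let $G\ltimes X$ and $H\ltimes Y$ be action groupoids that satisfy all properties in $\mathcal P$, and let $\varphi\colon G\ltimes X\to H\ltimes Y$ be an equivariant weak equivalence such that $\widetilde\varphi\colon G\to H$ is a proper map. Then there are a closed subgroup $K\le H$ and a smooth action of $K$ on a manifold $X'$, with induced manifold $H\times_K X'=(H\times X')/K$ (the quotient by $k\cdot(h,x)=(hk^{-1},kx)$, with the $H$-action $h[h',x]=[hh',x]$), and equivariant functors $$G\ltimes X\xrightarrow{\ \pi\ }K\ltimes X'\xrightarrow{\ i\ }H\ltimes(H\times_K X')\xrightarrow[\ \cong\ ]{\ \chi\ }H\ltimes Y,\qquad i(k,x)=(k,[1_H,x]),$$ where $\chi$ is an isomorphism of Lie groupoids given by the identity of $H$ and an $H$-equivariant diffeomorphism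 $H\times_K X'\cong Y$, such that: 1. $\varphi=\chi\circ i\circ\pi$ (so $\varphi=i\circ\pi$ when $H\times_K X'$ is identified with $Y$ by $\chi$), on groups as well as on spaces; 2. $\pi$ is a surjective submersive weak equivalence, and it is a quotient by a normal subgroup: there are a closed normal subgroup $N\trianglelefteq G$ acting freely and properly on $X$ and an equivariant isomorphism of Lie groupoids $\psi\colon (G/N)\ltimes(X/N)\to K\ltimes X'$ such that $\pi$ is the composition of $\psi$ with the quotient functor $G\ltimes X\to(G/N)\ltimes(X/N)$; 3. $i$ is a weak equivalence; 4. $K\ltimes X'$ and $H\ltimes(H\times_K X')$ satisfy all properties in $\mathcal P$. -/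

import Mathlib

universe u

open scoped Manifold ContDiff

noncomputable section

/-! ### Smooth manifolds -/

/-- A smooth manifold without boundary: finite-dimensional, Hausdorff and second countable. -/
structure Mfd : Type (u + 1) where
  carrier : Type u
  E : Type
  H : Type
  [normedAddCommGroup : NormedAddCommGroup E]
  [normedSpace : NormedSpace ℝ E]
  [finiteDimensional : FiniteDimensional ℝ E]
  [topModel : TopologicalSpace H]
  I : ModelWithCorners ℝ E H
  [boundaryless : I.Boundaryless]
  [top : TopologicalSpace carrier]
  [charted : ChartedSpace H carrier]
  [isManifold : IsManifold I ∞ carrier]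
  [t2 : T2Space carrier]
  [secondCountable : SecondCountableTopology carrier]

attribute [instance] Mfd.normedAddCommGroup Mfd.normedSpace Mfd.finiteDimensional Mfd.topModel
  Mfd.boundaryless Mfd.top Mfd.charted Mfd.isManifold Mfd.t2 Mfd.secondCountable

instance : CoeSort Mfd.{u} (Type u) := ⟨Mfd.carrier⟩

namespace Mfd

/-- The product of two manifolds. -/
abbrev prod (M N : Mfd.{u}) : Mfd.{u} where
  carrier := M × N
  E := M.E × N.E
  H := ModelProd M.H N.H
  I := M.I.prod N.I

/-- A smooth map. -/
def Smooth {M N : Mfd.{u}} (f : M → N) : Prop := ContMDiff M.I N.I ∞ f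

/-- A smooth submersion. -/
def Submersion {M N : Mfd.{u}} (f : M → N) : Prop := Manifold.IsSubmersion M.I N.I ∞ f

/-- A surjective submersion. -/
def SurjSubmersion {M N : Mfd.{u}} (f : M → N) : Prop := Submersion f ∧ Function.Surjective f

/-- A structure of embedded submanifold on a subset `S` of a manifold. The topology is the
subspace topology; such a structure is unique when it exists. -/
structure SubmfdStr (M : Mfd.{u}) (S : Set M) where
  dim : ℕ
  [charted : ChartedSpace (EuclideanSpace ℝ (Fin dim)) S]
  [isManifold : IsManifold (𝓡 dim) ∞ S]
  isEmbedding : Manifold.IsSmoothEmbedding (𝓡 dim) M.I ∞ (Subtype.val : S → M)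

attribute [instance] SubmfdStr.charted SubmfdStr.isManifold

/-- An embedded submanifold as a manifold in its own right. -/
def SubmfdStr.toMfd {M : Mfd.{u}} {S : Set M} (P : SubmfdStr M S) : Mfd.{u} where
  carrier := S
  E := EuclideanSpace ℝ (Fin P.dim)
  H := EuclideanSpace ℝ (Fin P.dim)
  I := 𝓡 P.dim

/-- A structure of quotient manifold on the quotient of a manifold by an equivalence relation:
with respect to the quotient topology the quotient is a manifold, and the quotient map is a
submersion. Such a structure is unique when it exists. -/
structure QuotientStr (M : Mfd.{u}) (r : Setoid M) where
  dim : ℕ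
  [charted : ChartedSpace (EuclideanSpace ℝ (Fin dim)) (Quotient r)]
  [isManifold : IsManifold (𝓡 dim) ∞ (Quotient r)]
  [t2 : T2Space (Quotient r)]
  [secondCountable : SecondCountableTopology (Quotient r)]
  isSubmersion_mk : Manifold.IsSubmersion M.I (𝓡 dim) ∞ (Quotient.mk r)

attribute [instance] QuotientStr.charted QuotientStr.isManifold

/-- A quotient manifold as a manifold. -/
def QuotientStr.toMfd {M : Mfd.{u}} {r : Setoid M} (Q : QuotientStr M r) : Mfd.{u} where
  carrier := Quotient r
  E := EuclideanSpace ℝ (Fin Q.dim)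
  H := EuclideanSpace ℝ (Fin Q.dim)
  I := 𝓡 Q.dim
  t2 := Q.t2
  secondCountable := Q.secondCountable

/-- The quotient map onto a quotient manifold. -/
def QuotientStr.proj {M : Mfd.{u}} {r : Setoid M} (Q : QuotientStr M r) : M → Q.toMfd :=
  Quotient.mk r

theorem QuotientStr.proj_smooth {M : Mfd.{u}} {r : Setoid M} (Q : QuotientStr M r) :
    Smooth Q.proj :=
  Manifold.IsSubmersion.contMDiff Q.isSubmersion_mk

/-- The fibred product of two maps, as a subset of the product. -/
def fibreProd {M N P : Mfd.{u}} (f : M → P) (g : N → P) : Set (M.prod N) :=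
  {p | f p.1 = g p.2}

end Mfd

open Mfd

/-! ### Lie groupoids and weak equivalences -/

/-- A Lie groupoid. The composition `comp g h` (first `h`, then `g`) is meaningful only when
`src g = tgt h`: its values elsewhere are irrelevant, since all the conditions, including the
smoothness, only concern its restriction to the set of composable pairs. -/
structure LieGroupoid : Type (u + 1) where
  Obj : Mfd.{u}
  Arr : Mfd.{u}
  src : Arr → Obj
  tgt : Arr → Obj
  unit : Obj → Arr
  inv : Arr → Arr
  comp : Arr → Arr → Arr
  src_submersion : Submersion src
  tgt_submersion : Submersion tgt
  unit_smooth : Smooth unit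
  inv_smooth : Smooth inv
  comp_smooth : ContMDiffOn (Arr.prod Arr).I Arr.I ∞ (fun p : Arr.prod Arr => comp p.1 p.2)
    (fibreProd src tgt)
  src_unit : ∀ x, src (unit x) = x
  tgt_unit : ∀ x, tgt (unit x) = x
  src_inv : ∀ g, src (inv g) = tgt g
  tgt_inv : ∀ g, tgt (inv g) = src g
  src_comp : ∀ g h, src g = tgt h → src (comp g h) = src h
  tgt_comp : ∀ g h, src g = tgt h → tgt (comp g h) = tgt g
  assoc : ∀ g h k, src g = tgt h → src h = tgt k → comp (comp g h) k = comp g (comp h k)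
  comp_unit : ∀ g, comp g (unit (src g)) = g
  unit_comp : ∀ g, comp (unit (tgt g)) g = g
  inv_comp : ∀ g, comp (inv g) g = unit (src g)
  comp_inv : ∀ g, comp g (inv g) = unit (tgt g)

/-- A smooth functor between Lie groupoids. -/
structure LieFunctor (𝒢 ℋ : LieGroupoid.{u}) where
  obj : 𝒢.Obj → ℋ.Obj
  arr : 𝒢.Arr → ℋ.Arr
  obj_smooth : Smooth obj
  arr_smooth : Smooth arr
  src_arr : ∀ g, ℋ.src (arr g) = obj (𝒢.src g)
  tgt_arr : ∀ g, ℋ.tgt (arr g) = obj (𝒢.tgt g)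
  arr_unit : ∀ x, arr (𝒢.unit x) = ℋ.unit (obj x)
  arr_comp : ∀ g h, 𝒢.src g = 𝒢.tgt h → arr (𝒢.comp g h) = ℋ.comp (arr g) (arr h)

namespace LieFunctor

variable {𝒢 ℋ : LieGroupoid.{u}} (φ : LieFunctor 𝒢 ℋ)

/-- The map `(x, h) ↦ s(h)` on the set of pairs `(x, h)` with `φ x = t(h)`. -/
def essMap : fibreProd φ.obj ℋ.tgt → ℋ.Obj := fun p => ℋ.src p.1.2

/-- Smooth essential surjectivity. -/
def SmoothEssSurj : Prop :=
  ∃ P : SubmfdStr (𝒢.Obj.prod ℋ.Arr) (fibreProd φ.obj ℋ.tgt),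
    SurjSubmersion (M := P.toMfd) (N := ℋ.Obj) φ.essMap

/-- The set of `((x, x'), h)` with `(φ x, φ x') = (s(h), t(h))`, as a fibred product. -/
def fullSet : Set ((𝒢.Obj.prod 𝒢.Obj).prod ℋ.Arr) :=
  fibreProd (M := 𝒢.Obj.prod 𝒢.Obj) (N := ℋ.Arr) (P := ℋ.Obj.prod ℋ.Obj)
    (fun p => (φ.obj p.1, φ.obj p.2)) (fun h => (ℋ.src h, ℋ.tgt h))

/-- The map `g ↦ ((s(g), t(g)), φ(g))`. -/
def fullMap (g : 𝒢.Arr) : φ.fullSet :=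
  ⟨((𝒢.src g, 𝒢.tgt g), φ.arr g), Prod.ext (φ.src_arr g).symm (φ.tgt_arr g).symm⟩

/-- Smooth full faithfulness. -/
def SmoothFullyFaithful : Prop :=
  ∃ P : SubmfdStr ((𝒢.Obj.prod 𝒢.Obj).prod ℋ.Arr) φ.fullSet,
    ∃ e : Diffeomorph 𝒢.Arr.I P.toMfd.I 𝒢.Arr P.toMfd ∞, ∀ g, e g = φ.fullMap g

/-- Weak equivalences of Lie groupoids. -/
structure IsWeakEquivalence : Prop where
  essSurj : φ.SmoothEssSurj
  fullyFaithful : φ.SmoothFullyFaithful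

/-- Surjective submersive weak equivalences. -/
structure IsSurjSubmersiveWeakEquivalence : Prop where
  isWeakEquivalence : φ.IsWeakEquivalence
  surjSubmersion : SurjSubmersion φ.obj

end LieFunctor

namespace LieGroupoid

variable (𝒢 : LieGroupoid.{u})

/-- Proper Lie groupoids. -/
def IsProper : Prop := IsProperMap (fun g : 𝒢.Arr => (𝒢.src g, 𝒢.tgt g))

/-- Étale Lie groupoids. -/
def IsEtale : Prop := IsLocalDiffeomorph 𝒢.Arr.I 𝒢.Obj.I ∞ 𝒢.src

/-- Morita equivalence of Lie groupoids. -/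
def MoritaEquivalent (ℋ : LieGroupoid.{u}) : Prop :=
  ∃ (𝒦 : LieGroupoid.{u}) (φ : LieFunctor 𝒦 𝒢) (ψ : LieFunctor 𝒦 ℋ),
    φ.IsWeakEquivalence ∧ ψ.IsWeakEquivalence

/-- Orbifold groupoids: Lie groupoids Morita equivalent to a proper étale Lie groupoid. -/
def IsOrbifold : Prop :=
  ∃ ℋ : LieGroupoid.{u}, ℋ.IsProper ∧ ℋ.IsEtale ∧ 𝒢.MoritaEquivalent ℋ

end LieGroupoid

/-! ### Lie groups and their actions -/

/-- A Lie group. -/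
structure LieGrp : Type (u + 1) extends Mfd.{u} where
  [group : Group carrier]
  [lieGroup : LieGroup I ∞ carrier]

attribute [instance] LieGrp.group LieGrp.lieGroup

instance : CoeSort LieGrp.{u} (Type u) := ⟨fun G => G.carrier⟩

/-- A smooth left action of a Lie group `G` on a manifold `X`. -/
structure LieAction (G : LieGrp.{u}) (X : Mfd.{u}) where
  [mulAction : MulAction G X]
  [smooth : ContMDiffSMul G.I X.I ∞ G X]

namespace LieAction

variable {G : LieGrp.{u}} {X : Mfd.{u}} (a : LieAction G X)

/-- The action map. -/
def act (g : G) (x : X) : X := letI := a.mulAction; g • x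

theorem one_act (x : X) : a.act 1 x = x := letI := a.mulAction; one_smul G x

theorem mul_act (g h : G) (x : X) : a.act (g * h) x = a.act g (a.act h x) :=
  letI := a.mulAction; mul_smul g h x

theorem act_smooth : ContMDiff (G.I.prod X.I) X.I ∞ (fun p : G × X => a.act p.1 p.2) :=
  letI := a.mulAction; letI := a.smooth; contMDiff_smul

end LieAction

/-! ### Action groupoids -/

section Submersions

variable {E₁ E₂ H₁ H₂ : Type} [NormedAddCommGroup E₁] [NormedSpace ℝ E₁]
  [NormedAddCommGroup E₂] [NormedSpace ℝ E₂] [TopologicalSpace H₁] [TopologicalSpace H₂]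
  {I₁ : ModelWithCorners ℝ E₁ H₁} {I₂ : ModelWithCorners ℝ E₂ H₂}
  {M N : Type u} [TopologicalSpace M] [TopologicalSpace N] [ChartedSpace H₁ M]
  [ChartedSpace H₂ N]

/-- The second projection of a product of manifolds is a submersion. -/
theorem isSubmersion_snd [IsManifold I₁ ∞ M] [IsManifold I₂ ∞ N] :
    Manifold.IsSubmersion (I₁.prod I₂) I₂ ∞ (Prod.snd : M × N → N) := by
  refine Manifold.IsSubmersionOfComplement.isSubmersion (F := E₁) fun p => ?_
  refine Manifold.IsSubmersionAtOfComplement.mk_of_charts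
    (ContinuousLinearEquiv.prodComm ℝ E₁ E₂)
    ((chartAt H₁ p.1).prod (chartAt H₂ p.2)) (chartAt H₂ p.2) (by simp) (by simp)
    (IsManifold.mem_maximalAtlas_prod (IsManifold.chart_mem_maximalAtlas _)
      (IsManifold.chart_mem_maximalAtlas _))
    (IsManifold.chart_mem_maximalAtlas _) (fun q hq => hq.2) ?_
  rintro ⟨v, w⟩ hvw
  rw [OpenPartialHomeomorph.extend_prod] at hvw ⊢
  exact ((chartAt H₂ p.2).extend I₂).right_inv hvw.2

/-- A submersion precomposed with a diffeomorphism is a submersion. -/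
theorem isSubmersion_comp_diffeomorph {M' : Type u} [TopologicalSpace M'] [ChartedSpace H₁ M']
    [IsManifold I₁ ∞ M'] {f : M → N} (hf : Manifold.IsSubmersion I₁ I₂ ∞ f)
    (e : Diffeomorph I₁ I₁ M' M ∞) : Manifold.IsSubmersion I₁ I₂ ∞ (f ∘ e) := by
  obtain ⟨F, i₁, i₂, hF⟩ := hf
  refine ⟨F, i₁, i₂, fun x => ?_⟩
  have h := hF (e x)
  have hmax := h.domChart_mem_maximalAtlas
  refine Manifold.IsSubmersionAtOfComplement.mk_of_charts h.equiv
    (e.toHomeomorph.toOpenPartialHomeomorph.trans h.domChart) h.codChart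
    (by simpa using h.mem_domChart_source) h.mem_codChart_source
    ?_ h.codChart_mem_maximalAtlas ?_ ?_
  · refine OpenPartialHomeomorph.mem_maximalAtlas_of_contMDiffOn _ ?_ ?_
    · exact (contMDiffOn_of_mem_maximalAtlas hmax).comp e.contMDiff.contMDiffOn
        (fun y hy => by simpa using hy)
    · exact e.symm.contMDiff.comp_contMDiffOn
        ((contMDiffOn_symm_of_mem_maximalAtlas hmax).mono (fun y hy => by simpa using hy))
  · intro y hy
    exact h.source_subset_preimage_source (by simpa using hy)
  · intro v hv
    have hv' : v ∈ (h.domChart.extend I₁).target := by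
      simpa [OpenPartialHomeomorph.extend] using hv
    have := h.writtenInCharts hv'
    simpa [OpenPartialHomeomorph.extend] using this

end Submersions

namespace LieAction

variable {G : LieGrp.{u}} {X : Mfd.{u}} (a : LieAction G X)

/-- The diffeomorphism `(g, x) ↦ (g, g x)` of `G × X`. -/
def shear : Diffeomorph (G.I.prod X.I) (G.I.prod X.I) (G × X) (G × X) ∞ where
  toFun p := (p.1, a.act p.1 p.2)
  invFun p := (p.1, a.act p.1⁻¹ p.2)
  left_inv p := by simp [← a.mul_act, a.one_act]
  right_inv p := by simp [← a.mul_act, a.one_act]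
  contMDiff_toFun := contMDiff_fst.prodMk a.act_smooth
  contMDiff_invFun := contMDiff_fst.prodMk
    (a.act_smooth.comp ((contMDiff_inv G.I ∞).comp contMDiff_fst |>.prodMk contMDiff_snd))

/-- The action groupoid `G ⋉ X`. -/
def groupoid : LieGroupoid.{u} where
  Obj := X
  Arr := G.toMfd.prod X
  src p := p.2
  tgt p := a.act p.1 p.2
  unit x := ((1 : G), x)
  inv p := ((p.1 : G)⁻¹, a.act p.1 p.2)
  comp p q := ((p.1 : G) * (q.1 : G), q.2)
  src_submersion := isSubmersion_snd
  tgt_submersion := isSubmersion_comp_diffeomorph isSubmersion_snd a.shear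
  unit_smooth := contMDiff_const.prodMk contMDiff_id
  inv_smooth := ((contMDiff_inv G.I ∞).comp contMDiff_fst).prodMk a.act_smooth
  comp_smooth := by
    refine ContMDiff.contMDiffOn (ContMDiff.prodMk (I' := G.I) (J' := X.I) ?_ ?_)
    · exact (contMDiff_mul G.I ∞).comp ((contMDiff_fst.comp contMDiff_fst).prodMk
        (contMDiff_fst.comp contMDiff_snd))
    · exact contMDiff_snd.comp contMDiff_snd
  src_unit _ := rfl
  tgt_unit := a.one_act
  src_inv _ := rfl
  tgt_inv p := by rw [← a.mul_act, inv_mul_cancel, a.one_act]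
  src_comp _ _ _ := rfl
  tgt_comp p q h := by rw [a.mul_act]; exact congrArg (a.act p.1) h.symm
  assoc p q r _ _ := Prod.ext (mul_assoc (p.1 : G) q.1 r.1) rfl
  comp_unit p := Prod.ext (mul_one (p.1 : G)) rfl
  unit_comp p := Prod.ext (one_mul (p.1 : G)) rfl
  inv_comp p := Prod.ext (inv_mul_cancel (p.1 : G)) rfl
  comp_inv p := Prod.ext (mul_inv_cancel (p.1 : G)) rfl

/-- Free actions: all stabilisers are trivial. -/
def IsFree : Prop := ∀ (g : G) (x : X), a.act g x = x → g = 1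

/-- Locally free actions: the restriction of the action to a neighbourhood of `1` is free. -/
def IsLocallyFree : Prop := ∃ U ∈ nhds (1 : G), ∀ g ∈ U, ∀ x : X, a.act g x = x → g = 1

/-- Transitive actions. -/
def IsTransitive : Prop := ∀ x y : X, ∃ g : G, a.act g x = y

/-- Effective actions. -/
def IsEffective : Prop := ∀ g : G, g ≠ 1 → ∃ x : X, a.act g x ≠ x

end LieAction

/-- The list of properties of action groupoids under consideration. -/
inductive ActionProperty
  | free | locallyFree | transitive | effective | compact | discrete | proper | orbifold

namespace LieAction

variable {G : LieGrp.{u}} {X : Mfd.{u}} (a : LieAction G X)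

/-- What it means for an action groupoid to have a given property of the list. -/
def Has : ActionProperty → Prop
  | .free => a.IsFree
  | .locallyFree => a.IsLocallyFree
  | .transitive => a.IsTransitive
  | .effective => a.IsEffective
  | .compact => CompactSpace G
  | .discrete => DiscreteTopology G
  | .proper => a.groupoid.IsProper
  | .orbifold => a.groupoid.IsOrbifold

/-- The action groupoid has all the properties in `P`. -/
def Satisfies (P : Set ActionProperty) : Prop := ∀ p ∈ P, a.Has p

/-- The equivalence relation on `X` whose classes are the orbits of a subgroup `N` of `G`. -/
def orbitSetoid (N : Subgroup G) : Setoid X :=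
  letI := a.mulAction; MulAction.orbitRel N X

end LieAction

/-! ### Equivariant functors -/

/-- An equivariant functor `G ⋉ X → H ⋉ Y`: a homomorphism of Lie groups `G → H` together with
a smooth map `X → Y` that is equivariant along it. -/
@[ext]
structure EquivariantFunctor {G H : LieGrp.{u}} {X Y : Mfd.{u}} (a : LieAction G X)
    (b : LieAction H Y) where
  hom : G →* H
  obj : X → Y
  hom_smooth : Smooth (M := G.toMfd) (N := H.toMfd) hom
  obj_smooth : Smooth obj
  map_act : ∀ g x, obj (a.act g x) = b.act (hom g) (obj x)

namespace EquivariantFunctor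

variable {G H L : LieGrp.{u}} {X Y Z : Mfd.{u}} {a : LieAction G X} {b : LieAction H Y}
  {c : LieAction L Z}

/-- The functor between action groupoids, `(g, x) ↦ (φ g, φ x)` on arrows. -/
def toFunctor (φ : EquivariantFunctor a b) : LieFunctor a.groupoid b.groupoid where
  obj := φ.obj
  arr p := (φ.hom p.1, φ.obj p.2)
  obj_smooth := φ.obj_smooth
  arr_smooth := ContMDiff.prodMk (I' := H.I) (J' := Y.I)
    (ContMDiff.comp (I' := G.I) φ.hom_smooth contMDiff_fst)
    (ContMDiff.comp (I' := X.I) φ.obj_smooth contMDiff_snd)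
  src_arr _ := rfl
  tgt_arr p := (φ.map_act p.1 p.2).symm
  arr_unit _ := Prod.ext (map_one φ.hom) rfl
  arr_comp p q _ := Prod.ext (map_mul φ.hom p.1 q.1) rfl

/-- The identity functor. -/
def id (a : LieAction G X) : EquivariantFunctor a a where
  hom := MonoidHom.id G
  obj x := x
  hom_smooth := contMDiff_id
  obj_smooth := contMDiff_id
  map_act _ _ := rfl

/-- The composition `ψ ∘ φ`. -/
def comp (ψ : EquivariantFunctor b c) (φ : EquivariantFunctor a b) : EquivariantFunctor a c where
  hom := ψ.hom.comp φ.hom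
  obj x := ψ.obj (φ.obj x)
  hom_smooth :=
    ContMDiff.comp (I' := H.I) (g := ψ.hom) (f := φ.hom) ψ.hom_smooth φ.hom_smooth
  obj_smooth := ContMDiff.comp (I' := Y.I) ψ.obj_smooth φ.obj_smooth
  map_act g x := by rw [φ.map_act, ψ.map_act]; rfl

/-- Equivariant isomorphisms of Lie groupoids. -/
def IsIso (φ : EquivariantFunctor a b) : Prop :=
  ∃ ψ : EquivariantFunctor b a, ψ.comp φ = id a ∧ φ.comp ψ = id b

/-- The class of equivariant weak equivalences between action groupoids that satisfy `P`. -/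
def MemW (P : Set ActionProperty) (φ : EquivariantFunctor a b) : Prop :=
  a.Satisfies P ∧ b.Satisfies P ∧ φ.toFunctor.IsWeakEquivalence

/-- The class of equivariant surjective submersive weak equivalences between action groupoids
that satisfy `P`. -/
def MemSW (P : Set ActionProperty) (φ : EquivariantFunctor a b) : Prop :=
  a.Satisfies P ∧ b.Satisfies P ∧ φ.toFunctor.IsSurjSubmersiveWeakEquivalence

end EquivariantFunctor

/-! ### Quotients by normal subgroups -/

/-- A structure of Lie group on `G ⧸ N` whose underlying manifold is the quotient manifold. -/
structure QuotientLieGroup (G : LieGrp.{u}) (N : Subgroup G) [N.Normal] where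
  mfd : QuotientStr G.toMfd (QuotientGroup.leftRel N)
  lieGroup : letI : ChartedSpace (EuclideanSpace ℝ (Fin mfd.dim)) (G ⧸ N) := mfd.charted
    LieGroup (𝓡 mfd.dim) ∞ (G ⧸ N)

/-- The group structure on the quotient manifold `G ⧸ N`. -/
abbrev QuotientLieGroup.quotGroup {G : LieGrp.{u}} {N : Subgroup G} [N.Normal]
    (Q : QuotientLieGroup G N) : Group Q.mfd.toMfd :=
  inferInstanceAs (Group (G ⧸ N))

/-- The Lie group `G ⧸ N`. -/
def QuotientLieGroup.toLieGrp {G : LieGrp.{u}} {N : Subgroup G} [N.Normal]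
    (Q : QuotientLieGroup G N) : LieGrp.{u} :=
  @LieGrp.mk Q.mfd.toMfd Q.quotGroup Q.lieGroup

/-- An equivariant functor `π` is a quotient by a normal subgroup if there is a closed normal
subgroup `N` of `G`, acting freely and properly on `X`, such that `π` is, up to an equivariant
isomorphism, the quotient functor `G ⋉ X → (G ⧸ N) ⋉ (X ⧸ N)`. -/
def EquivariantFunctor.IsNormalQuotient {G H : LieGrp.{u}} {X Y : Mfd.{u}} {a : LieAction G X}
    {b : LieAction H Y} (π : EquivariantFunctor a b) : Prop :=
  ∃ (N : Subgroup G) (_ : N.Normal), IsClosed (N : Set G) ∧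
    (∀ n ∈ N, ∀ x : X, a.act n x = x → n = 1) ∧
    IsProperMap (fun p : N × X => (p.2, a.act p.1 p.2)) ∧
    ∃ (QG : QuotientLieGroup G N) (QX : QuotientStr X (a.orbitSetoid N))
      (c : LieAction QG.toLieGrp QX.toMfd) (q : EquivariantFunctor a c)
      (ψ : EquivariantFunctor c b),
      (∀ g : G, q.hom g = QG.mfd.proj g) ∧ (∀ x : X, q.obj x = QX.proj x) ∧
      ψ.IsIso ∧ π = ψ.comp q

/-! ### Closed subgroups and induced actions -/

/-- A closed subgroup of a Lie group `G`, with its structure of embedded submanifold. -/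
structure ClosedLieSubgroup (G : LieGrp.{u}) where
  toSubgroup : Subgroup G
  isClosed : IsClosed (toSubgroup : Set G)
  submfd : SubmfdStr G.toMfd (toSubgroup : Set G)

/-- The group structure on a closed subgroup. -/
abbrev ClosedLieSubgroup.subGroup {G : LieGrp.{u}} (K : ClosedLieSubgroup G) :
    Group K.submfd.toMfd :=
  inferInstanceAs (Group K.toSubgroup)

theorem ClosedLieSubgroup.isLieGroup {G : LieGrp.{u}} (K : ClosedLieSubgroup G) :
    @LieGroup ℝ _ _ _ _ _ _ K.submfd.toMfd.I ∞ K.submfd.toMfd K.subGroup _ _ := by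
  let _ : Group K.submfd.toMfd := K.subGroup
  have himm : Manifold.IsImmersion K.submfd.toMfd.I G.I ∞ (fun x : K.submfd.toMfd => (x.1 : G)) :=
    K.submfd.isEmbedding.isImmersion
  have hval : ContMDiff K.submfd.toMfd.I G.I ∞ (fun x : K.submfd.toMfd => (x.1 : G)) :=
    himm.contMDiff
  have := topologicalGroup_of_lieGroup G.I ∞ (G := G)
  have hmul : Continuous fun p : K.toSubgroup × K.toSubgroup => p.1 * p.2 := continuous_mul
  have hinv : Continuous fun p : K.toSubgroup => p⁻¹ := continuous_inv
  refine { contMDiff_mul := ?_, contMDiff_inv := ?_ }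
  · refine (ContMDiff.iff_comp_isImmersion himm).2 ⟨hmul, ?_⟩
    exact (contMDiff_mul G.I ∞).comp
      ((hval.comp contMDiff_fst).prodMk (hval.comp contMDiff_snd))
  · refine (ContMDiff.iff_comp_isImmersion himm).2 ⟨hinv, ?_⟩
    exact (contMDiff_inv G.I ∞).comp hval

/-- A closed subgroup as a Lie group. -/
def ClosedLieSubgroup.toLieGrp {G : LieGrp.{u}} (K : ClosedLieSubgroup G) : LieGrp.{u} :=
  @LieGrp.mk K.submfd.toMfd K.subGroup K.isLieGroup

/-- The inclusion homomorphism of a closed subgroup. -/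
def ClosedLieSubgroup.incl {G : LieGrp.{u}} (K : ClosedLieSubgroup G) : K.toLieGrp →* G :=
  K.toSubgroup.subtype

/-- The equivalence relation on `G × X` whose classes are the orbits of the anti-diagonal action
`k (g, x) = (g k⁻¹, k x)` of `K`. -/
def antidiagonal {G : LieGrp.{u}} (K : ClosedLieSubgroup G) {X : Mfd.{u}}
    (c : LieAction K.toLieGrp X) : Setoid (G.toMfd.prod X) where
  r p q := ∃ k : K.toLieGrp, q = ((p.1 : G) * (K.incl k)⁻¹, c.act k p.2)
  iseqv :=
    { refl := fun p => ⟨1, Prod.ext (by simp) (by simp [c.one_act])⟩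
      symm := by
        rintro p _ ⟨k, rfl⟩
        exact ⟨k⁻¹, Prod.ext (by simp) (by simp [← c.mul_act, c.one_act])⟩
      trans := by
        rintro p _ _ ⟨k, rfl⟩ ⟨l, rfl⟩
        exact ⟨l * k, Prod.ext (by simp [mul_assoc]) (by simp [c.mul_act])⟩ }

/-- The induced action groupoid `G ⋉ (G ×_K X)`: the quotient manifold `G ×_K X` of `G × X` by
the anti-diagonal action of `K`, with the smooth action `g [g', x] = [g g', x]` of `G`. -/
structure InducedAction {G : LieGrp.{u}} (K : ClosedLieSubgroup G) {X : Mfd.{u}}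
    (c : LieAction K.toLieGrp X) where
  quot : QuotientStr (G.toMfd.prod X) (antidiagonal K c)
  action : LieAction G quot.toMfd
  act_proj : ∀ (g g' : G) (x : X), action.act g (quot.proj (g', x)) = quot.proj (g * g', x)

/-- The inclusion functor `K ⋉ X → G ⋉ (G ×_K X)`, sending `(k, x)` to `(k, [1, x])`. -/
def InducedAction.inclusion {G : LieGrp.{u}} {K : ClosedLieSubgroup G} {X : Mfd.{u}}
    {c : LieAction K.toLieGrp X} (ind : InducedAction K c) :
    EquivariantFunctor c ind.action where
  hom := K.incl
  obj x := ind.quot.proj ((1 : G), x)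
  hom_smooth := K.submfd.isEmbedding.isImmersion.contMDiff
  obj_smooth := ContMDiff.comp (I' := G.I.prod X.I) (g := ind.quot.proj)
    (f := fun x : X => ((1 : G), x)) ind.quot.proj_smooth
    (contMDiff_const.prodMk contMDiff_id)
  map_act k x := by
    rw [ind.act_proj]
    exact (Quotient.sound ⟨k, Prod.ext (by simp) rfl⟩ : Quotient.mk (antidiagonal K c) (K.incl k * 1, x)
      = Quotient.mk (antidiagonal K c) ((1 : G), c.act k x)).symm

end

/-! The factorization is the image factorization. Put K = φ̃(G) and X' = φ₀(X); then φ = j ∘ π with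
π : G ⋉ X → K ⋉ X' onto and j : K ⋉ X' → H ⋉ Y the inclusion. Everything rests on K and X' being
embedded submanifolds onto which φ̃ and φ₀ are submersions. By the constant rank theorem
(`exists_submfdStr_range`) this needs two facts about each map: its rank is constant, and it is open
onto its image.

For φ̃ the rank is constant by translation. Properness makes K closed and φ̃ a closed map onto K,
hence a quotient homomorphism, hence open. For φ₀ both facts use that φ is a weak equivalence. The
infinitesimal action at x restricts to an isomorphism from the kernel of dφ̃ at 1 to the kernel of
dφ₀ at x, so the two ranks differ by the constant dim X - dim G (`mrank_obj_add`). Essential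
surjectivity writes a point near φ₀(x) as h φ₀(x'') with h near 1 and x'' near x; if the point lies
in the image, fullness gives h ∈ K, and openness of φ̃ lifts h to an element near 1
(`isOpenMap_rangeFactorization_obj`).

The two factors are weak equivalences by cancellation (`isWeakEquivalence_of_comp_left`,
`isWeakEquivalence_of_comp_right`). The map H × X' → Y, (h, z) ↦ hz, is a surjective submersion
whose fibres are the antidiagonal K-orbits, so Y is H ×_K X' (`exists_inducedAction`). Likewise π is
the quotient by N = ker φ̃, which is compact by properness and acts freely because an arrow is
determined by its source, target and image (`isNormalQuotient`). Each property reaches K ⋉ X' either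
by restriction along j or by passage along π (`satisfies_of_factorization`).

The submanifold and quotient structures in the definitions are awkward to compose. They are traded
for smooth local sections (for submersions) and smooth local retractions (for embeddings), which
compose directly. -/

noncomputable section

open Topology Filter Set

set_option linter.unusedSectionVars false

/-! ### Linear algebra, the inverse function theorem and the constant rank theorem in vector spaces
-/

section Linear

variable {E E' : Type*} [NormedAddCommGroup E] [NormedSpace ℝ E] [FiniteDimensional ℝ E]
  [NormedAddCommGroup E'] [NormedSpace ℝ E'] [FiniteDimensional ℝ E']

theorem ContinuousLinearMap.bijective_of_injective_of_finrank_eq (A : E →L[ℝ] E')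
    (hA : Function.Injective A) (h : Module.finrank ℝ E = Module.finrank ℝ E') :
    Function.Bijective A :=
  ⟨hA, (LinearMap.injective_iff_surjective_of_finrank_eq_finrank
    (f := (A : E →ₗ[ℝ] E')) h).1 hA⟩

/-- `P` is a projection onto the kernel of `A`, read in coordinates; it supplies the coordinates
along the fibres of a submersion. -/
theorem exists_prod_bijective_of_surjective (A : E →L[ℝ] E') (hA : Function.Surjective A) {k : ℕ}
    (hk : Module.finrank ℝ E = Module.finrank ℝ E' + k) :
    ∃ P : E →L[ℝ] EuclideanSpace ℝ (Fin k), Function.Bijective (A.prod P) := by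
  have h1 := LinearMap.finrank_range_add_finrank_ker (A : E →ₗ[ℝ] E')
  rw [LinearMap.range_eq_top.2 hA, finrank_top] at h1
  have h2 : Module.finrank ℝ (A : E →ₗ[ℝ] E').ker
      = Module.finrank ℝ (EuclideanSpace ℝ (Fin k)) := by
    rw [finrank_euclideanSpace_fin]; omega
  let e := LinearEquiv.ofFinrankEq _ _ h2
  obtain ⟨p, hp⟩ := LinearMap.exists_leftInverse_of_injective (A : E →ₗ[ℝ] E').ker.subtype
    (by simp)
  refine ⟨(e.toLinearMap ∘ₗ p).toContinuousLinearMap,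
    ContinuousLinearMap.bijective_of_injective_of_finrank_eq _ ?_ (by simp [hk])⟩
  rw [injective_iff_map_eq_zero]
  intro v hv
  have hv1 : A v = 0 := congrArg Prod.fst hv
  have hv2 : e (p v) = 0 := congrArg Prod.snd hv
  have hv3 : p v = ⟨v, hv1⟩ := LinearMap.congr_fun hp ⟨v, hv1⟩
  rw [hv3, map_eq_zero_iff e e.injective] at hv2
  exact congrArg Subtype.val hv2

/-- `Q` parametrizes a complement of the range of `A`; it supplies the directions transverse to an
immersion. -/
theorem exists_coprod_bijective_of_injective (A : E →L[ℝ] E') (hA : Function.Injective A) {k : ℕ}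
    (hk : Module.finrank ℝ E' = Module.finrank ℝ E + k) :
    ∃ Q : EuclideanSpace ℝ (Fin k) →L[ℝ] E', Function.Bijective (A.coprod Q) := by
  obtain ⟨C, hC⟩ := Submodule.exists_isCompl (A : E →ₗ[ℝ] E').range
  have h1 := Submodule.finrank_add_eq_of_isCompl hC
  rw [LinearMap.finrank_range_of_inj hA] at h1
  have h2 : Module.finrank ℝ (EuclideanSpace ℝ (Fin k)) = Module.finrank ℝ C := by
    rw [finrank_euclideanSpace_fin]; omega
  let e := LinearEquiv.ofFinrankEq _ _ h2
  refine ⟨(C.subtype ∘ₗ e.toLinearMap).toContinuousLinearMap,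
    ContinuousLinearMap.bijective_of_injective_of_finrank_eq _ ?_ (by simp [hk])⟩
  rw [injective_iff_map_eq_zero]
  rintro ⟨v, w⟩ hv
  have hv : A v + (e w : E') = 0 := hv
  have hd := Submodule.disjoint_def.1 hC.disjoint (A v) ⟨v, rfl⟩
    (by rw [eq_neg_of_add_eq_zero_left hv]; exact C.neg_mem (e w).2)
  rw [hd, zero_add] at hv
  have hw : w = 0 := by
    rw [← map_eq_zero_iff e e.injective]; exact Subtype.ext hv
  have hv0 : v = 0 := hA (by rw [hd, map_zero])
  rw [hw, hv0, Prod.mk_zero_zero]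

omit [FiniteDimensional ℝ E'] in
/-- The inverse function theorem for smooth maps, with control of both maps on a neighbourhood. -/
theorem exists_openPartialHomeomorph_of_fderiv_bijective {F : E → E'} {a : E}
    (hF : ∀ᶠ x in 𝓝 a, ContDiffAt ℝ ∞ F x) (ha : Function.Bijective (fderiv ℝ F a)) :
    ∃ φ : OpenPartialHomeomorph E E', a ∈ φ.source ∧ ⇑φ = F ∧
      (∀ x ∈ φ.source, ContDiffAt ℝ ∞ F x ∧ Function.Bijective (fderiv ℝ F x)) ∧
      ∀ y ∈ φ.target, ContDiffAt ℝ ∞ φ.symm y := by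
  have hinv : ∀ A : E →L[ℝ] E', Function.Bijective A → ∃ e : E ≃L[ℝ] E', (e : E →L[ℝ] E') = A :=
    fun A hA => ⟨(LinearEquiv.ofBijective (A : E →ₗ[ℝ] E') hA).toContinuousLinearEquiv, rfl⟩
  obtain ⟨e, he⟩ := hinv _ ha
  have hFa := hF.self_of_nhds
  have hd : HasFDerivAt F (e : E →L[ℝ] E') a := he ▸ (hFa.differentiableAt (by simp)).hasFDerivAt
  have hc : ContinuousAt (fderiv ℝ F) a := (hFa.fderiv_right (m := 0) (by simp)).continuousAt
  have hev : ∀ᶠ x in 𝓝 a, ∃ e' : E ≃L[ℝ] E', (e' : E →L[ℝ] E') = fderiv ℝ F x :=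
    hc (he ▸ ContinuousLinearEquiv.nhds e)
  -- Invertibility of the derivative is an open condition. Shrinking the source to `U` makes the
  -- inverse smooth on the whole target, not only at `F a`.
  obtain ⟨U, hU, hUo, haU⟩ := eventually_nhds_iff.1 (hF.and hev)
  let φ := (hFa.toOpenPartialHomeomorph F hd (by simp)).restrOpen U hUo
  have hφ : ⇑φ = F := rfl
  refine ⟨φ, ⟨ContDiffAt.mem_toOpenPartialHomeomorph_source hFa hd (by simp), haU⟩, hφ, ?_, ?_⟩
  · rintro x ⟨-, hx⟩
    obtain ⟨h1, e', he'⟩ := hU x hx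
    exact ⟨h1, he' ▸ e'.bijective⟩
  · intro y hy
    have hx := φ.map_target hy
    obtain ⟨h1, e', he'⟩ := hU _ hx.2
    refine φ.contDiffAt_symm (f₀' := e') hy ?_ h1
    rw [he']
    exact (h1.differentiableAt (by simp)).hasFDerivAt

/-- The constant rank theorem: near a point, a map of constant rank `d` is determined by a linear
function of its values, with values in `ℝᵈ`. -/
theorem exists_slice_of_constant_rank {d : ℕ} {F : E → E'} {a : E}
    (hF : ∀ᶠ x in 𝓝 a, ContDiffAt ℝ ∞ F x)
    (hr : ∀ᶠ x in 𝓝 a, Module.finrank ℝ (fderiv ℝ F x : E →ₗ[ℝ] E').range = d) :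
    ∃ (ρ : E' →L[ℝ] EuclideanSpace ℝ (Fin d)) (s : EuclideanSpace ℝ (Fin d) → E),
      s (ρ (F a)) = a ∧
      (∀ᶠ b in 𝓝 (ρ (F a)), ContDiffAt ℝ ∞ s b ∧ ρ (F (s b)) = b) ∧
      ∀ᶠ x in 𝓝 a, F (s (ρ (F x))) = F x := by
  set R := (fderiv ℝ F a : E →ₗ[ℝ] E').range with hR
  have hRd : Module.finrank ℝ R = Module.finrank ℝ (EuclideanSpace ℝ (Fin d)) := by
    rw [finrank_euclideanSpace_fin]; exact hr.self_of_nhds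
  let e := LinearEquiv.ofFinrankEq _ _ hRd
  obtain ⟨p, hp⟩ := LinearMap.exists_leftInverse_of_injective R.subtype (by simp)
  -- `ρ` projects onto the range of the derivative at `a` and reads it in coordinates, so that `ρ ∘
  -- F` is a submersion at `a`.
  let ρ : E' →L[ℝ] EuclideanSpace ℝ (Fin d) := (e.toLinearMap ∘ₗ p).toContinuousLinearMap
  have hsurj : Function.Surjective (ρ.comp (fderiv ℝ F a)) := by
    intro b
    obtain ⟨v, hv⟩ := (e.symm b).2
    refine ⟨v, ?_⟩
    have h1 : p (e.symm b : E') = e.symm b := LinearMap.congr_fun hp (e.symm b)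
    have hv : fderiv ℝ F a v = (e.symm b : E') := hv
    change e (p (fderiv ℝ F a v)) = b
    rw [hv, h1, e.apply_symm_apply]
  have hle : d ≤ Module.finrank ℝ E := by
    have := LinearMap.finrank_range_le (fderiv ℝ F a : E →ₗ[ℝ] E')
    rwa [hr.self_of_nhds] at this
  obtain ⟨k, hk⟩ := Nat.exists_eq_add_of_le hle
  obtain ⟨P, hP⟩ := exists_prod_bijective_of_surjective (k := k) _ hsurj
    (by rw [hk, finrank_euclideanSpace_fin])
  -- `Φ` completes `ρ ∘ F` to local coordinates. The slice `s` will fix the second coordinate at its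
  -- value `P a`.
  let Φ : E → EuclideanSpace ℝ (Fin d) × EuclideanSpace ℝ (Fin k) := fun x => (ρ (F x), P x)
  have hΦ : ∀ x, ContDiffAt ℝ ∞ F x → ContDiffAt ℝ ∞ Φ x := fun x hx =>
    (ρ.contDiff.contDiffAt.comp x hx).prodMk P.contDiff.contDiffAt
  have hdΦ : ∀ x, ContDiffAt ℝ ∞ F x → HasFDerivAt Φ ((ρ.comp (fderiv ℝ F x)).prod P) x :=
    fun x hx => (ρ.hasFDerivAt.comp x (hx.differentiableAt (by simp)).hasFDerivAt).prodMk
      P.hasFDerivAt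
  obtain ⟨φ, haφ, hφ, hs, ht⟩ := exists_openPartialHomeomorph_of_fderiv_bijective (F := Φ) (a := a)
    (hF.mono hΦ) (by rw [(hdΦ a hF.self_of_nhds).fderiv]; exact hP)
  obtain ⟨U, hU, hUo, haU⟩ := eventually_nhds_iff.1 (hF.and hr)
  have hTn : φ.target ∩ φ.symm ⁻¹' U ∈ 𝓝 (Φ a) := by
    rw [← hφ]
    refine (φ.isOpen_inter_preimage_symm hUo).mem_nhds ⟨φ.map_source haφ, ?_⟩
    change φ.symm (φ a) ∈ U
    rwa [φ.left_inv haφ]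
  -- A ball for the sup norm is a product of balls, so the fibres of the first coordinate in it are
  -- convex.
  obtain ⟨r, hr0, hball⟩ := Metric.mem_nhds_iff.1 hTn
  have hc : Tendsto (fun b : EuclideanSpace ℝ (Fin d) => (b, P a)) (𝓝 (ρ (F a))) (𝓝 (Φ a)) :=
    (Continuous.prodMk_left (P a)).tendsto _
  have hφr : ∀ y ∈ φ.target, Φ (φ.symm y) = y := fun y hy => by rw [← hφ]; exact φ.right_inv hy
  refine ⟨ρ, fun b => φ.symm (b, P a), ?_, ?_, ?_⟩
  · change φ.symm (Φ a) = a
    rw [← hφ]; exact φ.left_inv haφ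
  · filter_upwards [hc hTn] with b hb
    refine ⟨(ht _ hb.1).comp b (contDiff_id.prodMk contDiff_const).contDiffAt, ?_⟩
    exact congrArg Prod.fst (hφr _ hb.1)
  · have hcont : ContinuousAt Φ a := (hΦ a hF.self_of_nhds).continuousAt
    filter_upwards [hcont (Metric.ball_mem_nhds _ hr0), φ.open_source.mem_nhds haφ] with x hx hxs
    have hx : Φ x ∈ Metric.ball (Φ a) r := hx
    rw [← ball_prod_same] at hx
    -- `g` is `F` along the fibre of `ρ ∘ F` through `x`. Its derivative vanishes, so it takes the
    -- same value at `P x` and at `P a`.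
    let g : EuclideanSpace ℝ (Fin k) → E' := fun κ => F (φ.symm (ρ (F x), κ))
    have hmem : ∀ κ ∈ Metric.ball (P a) r, (ρ (F x), κ) ∈ φ.target ∩ φ.symm ⁻¹' U := fun κ hκ =>
      hball (by rw [← ball_prod_same]; exact ⟨hx.1, hκ⟩)
    have hg : ∀ κ ∈ Metric.ball (P a) r,
        HasFDerivAt g (0 : EuclideanSpace ℝ (Fin k) →L[ℝ] E') κ := by
      intro κ hκ
      obtain ⟨hy, hyU⟩ := hmem κ hκ
      set y : EuclideanSpace ℝ (Fin d) × EuclideanSpace ℝ (Fin k) := (ρ (F x), κ) with hy_def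
      obtain ⟨hFw, hrw⟩ := hU _ hyU
      have hD := ((ht y hy).differentiableAt (by simp)).hasFDerivAt
      have hFd := (hFw.differentiableAt (by simp)).hasFDerivAt
      have hι : HasFDerivAt (fun κ' : EuclideanSpace ℝ (Fin k) => (ρ (F x), κ'))
        (ContinuousLinearMap.inr ℝ _ _) κ := hasFDerivAt_prodMk_right _ _
      have hcomp : HasFDerivAt g ((fderiv ℝ F (φ.symm y)).comp
          ((fderiv ℝ φ.symm y).comp (ContinuousLinearMap.inr ℝ _ _))) κ :=
        hFd.comp κ (hD.comp κ hι)
      convert hcomp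
      symm
      ext1 η
      set v := fderiv ℝ φ.symm y (0, η) with hv
      have hid : HasFDerivAt (fun y' => Φ (φ.symm y'))
          (ContinuousLinearMap.id ℝ _) y :=
        (hasFDerivAt_id y).congr_of_eventuallyEq
          (eventually_of_mem (φ.open_target.mem_nhds hy) hφr)
      have hcompΦ := (hdΦ _ hFw).comp y hD
      have h2 : (ρ (fderiv ℝ F (φ.symm y) v), P v) = (0, η) :=
        DFunLike.congr_fun (hcompΦ.unique hid) (0, η)
      have h3 : ρ (fderiv ℝ F (φ.symm y) v) = 0 := congrArg Prod.fst h2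
      have hsurj' : Function.Surjective (ρ.comp (fderiv ℝ F (φ.symm y))) := by
        have hb := (hs _ (φ.map_target hy)).2
        rw [(hdΦ _ hFw).fderiv] at hb
        intro b
        obtain ⟨w, hw⟩ := hb.2 (b, 0)
        exact ⟨w, congrArg Prod.fst hw⟩
      -- Here constancy of the rank around `a` enters: `ρ` maps the `d`-dimensional range of the
      -- derivative onto ℝᵈ, hence injectively. A vector tangent to the fibre has image killed by
      -- `ρ`, so its image is zero.
      have hinj : Function.Injective ((ρ : E' →ₗ[ℝ] EuclideanSpace ℝ (Fin d)).domRestrict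
          (fderiv ℝ F (φ.symm y) : E →ₗ[ℝ] E').range) := by
        refine (LinearMap.injective_iff_surjective_of_finrank_eq_finrank
          (by rw [hrw, finrank_euclideanSpace_fin])).2 fun b => ?_
        obtain ⟨w, hw⟩ := hsurj' b
        exact ⟨⟨_, w, rfl⟩, hw⟩
      have h4 := @hinj ⟨fderiv ℝ F (φ.symm y) v, v, rfl⟩ 0 (by rw [map_zero]; exact h3)
      exact congrArg Subtype.val h4
    have hconst := (convex_ball (P a) r).is_const_of_fderivWithin_eq_zero (𝕜 := ℝ) (f := g)
      (fun κ hκ => (hg κ hκ).differentiableAt.differentiableWithinAt)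
      (fun κ hκ => ((hg κ hκ).hasFDerivWithinAt.fderivWithin
        (Metric.isOpen_ball.uniqueDiffWithinAt hκ)))
      (Metric.mem_ball_self hr0) hx.2
    have hgx : g (P x) = F x := by
      change F (φ.symm (Φ x)) = F x
      rw [← hφ, φ.left_inv hxs]
    exact hconst.trans hgx

end Linear

/-! ### Charts and the normal forms of submersions and immersions -/

section LocalNormalForms

variable {E E' : Type*} [NormedAddCommGroup E] [NormedSpace ℝ E] [FiniteDimensional ℝ E]
  [NormedAddCommGroup E'] [NormedSpace ℝ E'] [FiniteDimensional ℝ E']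
  {H H' : Type*} [TopologicalSpace H] [TopologicalSpace H']
  {I : ModelWithCorners ℝ E H} [I.Boundaryless] {J : ModelWithCorners ℝ E' H'} [J.Boundaryless]
  {M N : Type*} [TopologicalSpace M] [ChartedSpace H M] [IsManifold I ∞ M]
  [TopologicalSpace N] [ChartedSpace H' N] [IsManifold J ∞ N]

/-- Local coordinates with values in any normed space of the right dimension come from a chart. -/
theorem exists_chart_of_openPartialHomeomorph {V : Type*} [NormedAddCommGroup V]
    [NormedSpace ℝ V] (φ : OpenPartialHomeomorph M V) (L : E ≃L[ℝ] V)
    (h₁ : ∀ x ∈ φ.source, ContMDiffAt I 𝓘(ℝ, V) ∞ φ x)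
    (h₂ : ∀ y ∈ φ.target, ContMDiffAt 𝓘(ℝ, V) I ∞ φ.symm y) :
    ∃ e ∈ IsManifold.maximalAtlas I ∞ M, e.source = φ.source ∧
      (∀ x, e.extend I x = L.symm (φ x)) ∧
      ∀ v ∈ (e.extend I).target, (e.extend I).symm v ∈ φ.source ∧
        φ ((e.extend I).symm v) = L v := by
  let h : V ≃ₜ H := L.symm.toHomeomorph.trans I.toHomeomorph.symm
  let e : OpenPartialHomeomorph M H := φ.transHomeomorph h
  have hfwd : ∀ x, e.extend I x = L.symm (φ x) := fun x =>
    I.toHomeomorph.apply_symm_apply (L.symm (φ x))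
  refine ⟨e, OpenPartialHomeomorph.mem_maximalAtlas_of_contMDiffOn _ ?_ ?_, rfl, hfwd, ?_⟩
  · intro x hx
    have hI : ContMDiffAt 𝓘(ℝ, E) I ∞ I.symm (L.symm (φ x)) :=
      I.contMDiffOn_symm.contMDiffAt (by rw [I.range_eq_univ]; exact univ_mem)
    exact (hI.comp x (L.symm.contDiff.contMDiff.contMDiffAt.comp x (h₁ x hx))).contMDiffWithinAt
  · intro y hy
    have hy' : L (I y) ∈ φ.target := hy
    exact ((h₂ _ hy').comp y (L.contDiff.contMDiff.contMDiffAt.comp y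
      I.contMDiff.contMDiffAt)).contMDiffWithinAt
  · intro v hv
    have h3 := (e.extend I).map_target hv
    rw [OpenPartialHomeomorph.extend_source] at h3
    refine ⟨h3, ?_⟩
    rw [← L.symm_apply_eq, ← hfwd]
    exact (e.extend I).right_inv hv

/-- The preferred chart at a point, as a local homeomorphism to the model vector space. -/
def extendedChart (I : ModelWithCorners ℝ E H) [I.Boundaryless] (p : M) :
    OpenPartialHomeomorph M E :=
  (chartAt H p).transHomeomorph I.toHomeomorph

theorem mem_extendedChart_source (p : M) : p ∈ (extendedChart I p).source :=
  mem_chart_source H p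

theorem contMDiffAt_extendedChart {p x : M} (hx : x ∈ (extendedChart I p).source) :
    ContMDiffAt I 𝓘(ℝ, E) ∞ (extendedChart I p) x :=
  contMDiffAt_extChartAt' hx

theorem contMDiffAt_extendedChart_symm {p : M} {y : E} (hy : y ∈ (extendedChart I p).target) :
    ContMDiffAt 𝓘(ℝ, E) I ∞ (extendedChart I p).symm y := by
  have hy' : y ∈ (extChartAt I p).target := by
    rw [extChartAt_target, I.range_eq_univ, inter_univ]; exact hy
  exact (contMDiffOn_extChartAt_symm p).contMDiffAt
    ((isOpen_extChartAt_target p).mem_nhds hy')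

/-- A differentiable map with a differentiable one-sided inverse. -/
theorem mfderiv_leftInverse {f : M → N} {g : N → M} {p : M} (hf : MDifferentiableAt I J f p)
    (hg : MDifferentiableAt J I g (f p)) (h : ∀ᶠ x in 𝓝 p, g (f x) = x) (v : TangentSpace I p) :
    mfderiv J I g (f p) (mfderiv I J f p v) = v := by
  have h1 := hg.hasMFDerivAt.comp p hf.hasMFDerivAt
  have h2 : HasMFDerivAt I I (g ∘ f) p (ContinuousLinearMap.id ℝ (TangentSpace I p)) :=
    (hasMFDerivAt_id p).congr_of_eventuallyEq h
  exact DFunLike.congr_fun (hasMFDerivAt_unique h1 h2) v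

theorem mfderiv_injective_of_leftInverse {f : M → N} {g : N → M} {p : M}
    (hf : MDifferentiableAt I J f p)
    (hg : MDifferentiableAt J I g (f p)) (h : ∀ᶠ x in 𝓝 p, g (f x) = x) :
    Function.Injective (mfderiv I J f p) :=
  Function.LeftInverse.injective (g := mfderiv J I g (f p)) (mfderiv_leftInverse hf hg h)

theorem mfderiv_surjective_of_rightInverse {f : M → N} {g : N → M} {p : M}
    (hf : MDifferentiableAt I J f p) (hg : MDifferentiableAt J I g (f p)) (hp : g (f p) = p)
    (h : ∀ᶠ y in 𝓝 (f p), f (g y) = y) :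
    Function.Surjective (mfderiv I J f p) := by
  intro v
  refine ⟨mfderiv J I g (f p) v, ?_⟩
  have h1 := mfderiv_leftInverse (I := J) (J := I) (f := g) (g := f) (p := f p) hg
    (by rw [hp]; exact hf) h v
  rwa [hp] at h1

theorem mfderiv_extendedChart_bijective {p x : M} (hx : x ∈ (extendedChart I p).source) :
    Function.Bijective (mfderiv I 𝓘(ℝ, E) (extendedChart I p) x) := by
  have hs := contMDiffAt_extendedChart_symm ((extendedChart I p).map_source hx)
  refine ⟨mfderiv_injective_of_leftInverse ((contMDiffAt_extendedChart hx).mdifferentiableAt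
    (by simp)) (hs.mdifferentiableAt (by simp))
    (eventually_of_mem ((extendedChart I p).open_source.mem_nhds hx)
      fun y hy => (extendedChart I p).left_inv hy),
    mfderiv_surjective_of_rightInverse ((contMDiffAt_extendedChart hx).mdifferentiableAt
    (by simp)) (hs.mdifferentiableAt (by simp)) ((extendedChart I p).left_inv hx)
    (eventually_of_mem ((extendedChart I p).open_target.mem_nhds
      ((extendedChart I p).map_source hx)) fun y hy => (extendedChart I p).right_inv hy)⟩

theorem mfderiv_extendedChart_symm_bijective {p : M} {y : E}
    (hy : y ∈ (extendedChart I p).target) :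
    Function.Bijective (mfderiv 𝓘(ℝ, E) I (extendedChart I p).symm y) := by
  have hs := contMDiffAt_extendedChart ((extendedChart I p).map_target hy)
  refine ⟨mfderiv_injective_of_leftInverse ((contMDiffAt_extendedChart_symm hy).mdifferentiableAt
    (by simp)) (hs.mdifferentiableAt (by simp))
    (eventually_of_mem ((extendedChart I p).open_target.mem_nhds hy)
      fun y hy => (extendedChart I p).right_inv hy),
    mfderiv_surjective_of_rightInverse ((contMDiffAt_extendedChart_symm hy).mdifferentiableAt
    (by simp)) (hs.mdifferentiableAt (by simp)) ((extendedChart I p).right_inv hy)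
    (eventually_of_mem ((extendedChart I p).open_source.mem_nhds
      ((extendedChart I p).map_target hy)) fun y hy => (extendedChart I p).left_inv hy)⟩

/-- The inverse function theorem for maps from a manifold to a vector space. -/
theorem exists_openPartialHomeomorph_of_mfderiv_bijective {V : Type*} [NormedAddCommGroup V]
    [NormedSpace ℝ V] {Φ : M → V} {p : M}
    (hΦ : ∀ᶠ x in 𝓝 p, ContMDiffAt I 𝓘(ℝ, V) ∞ Φ x)
    (hp : Function.Bijective (mfderiv I 𝓘(ℝ, V) Φ p)) :
    ∃ φ : OpenPartialHomeomorph M V, p ∈ φ.source ∧ (∀ x ∈ φ.source, φ x = Φ x) ∧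
      (∀ x ∈ φ.source, ContMDiffAt I 𝓘(ℝ, V) ∞ φ x) ∧
      ∀ y ∈ φ.target, ContMDiffAt 𝓘(ℝ, V) I ∞ φ.symm y := by
  set χ := extendedChart I p
  have hpχ : p ∈ χ.source := mem_extendedChart_source p
  have hχp : χ.symm (χ p) = p := χ.left_inv hpχ
  have hct : ContinuousAt χ.symm (χ p) := χ.continuousAt_symm (χ.map_source hpχ)
  have hF : ∀ᶠ y in 𝓝 (χ p), ContDiffAt ℝ ∞ (Φ ∘ χ.symm) y := by
    have h1 : ∀ᶠ y in 𝓝 (χ p), ContMDiffAt I 𝓘(ℝ, V) ∞ Φ (χ.symm y) :=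
      hct.eventually (by rwa [hχp])
    filter_upwards [h1, χ.open_target.mem_nhds (χ.map_source hpχ)] with y hy hyt
    exact (hy.comp y (contMDiffAt_extendedChart_symm hyt)).contDiffAt
  have hd : Function.Bijective (fderiv ℝ (Φ ∘ χ.symm) (χ p)) := by
    have h0 := contMDiffAt_extendedChart_symm (χ.map_source hpχ)
    have h1 := mfderiv_comp_of_eq (I'' := 𝓘(ℝ, V))
      (hΦ.self_of_nhds.mdifferentiableAt (by simp)) (h0.mdifferentiableAt (by simp)) hχp
    rw [← mfderiv_eq_fderiv, h1]
    have h2 := mfderiv_extendedChart_symm_bijective (χ.map_source hpχ)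
    have h3 : Function.Bijective (mfderiv I 𝓘(ℝ, V) Φ (χ.symm (χ p))) := by rw [hχp]; exact hp
    exact h3.comp h2
  obtain ⟨φ, hpφ, hφ, hs, ht⟩ := exists_openPartialHomeomorph_of_fderiv_bijective hF hd
  refine ⟨χ.trans φ, ⟨hpχ, hpφ⟩, ?_, ?_, ?_⟩
  · rintro x ⟨hx, -⟩
    change φ (χ x) = Φ x
    rw [hφ]
    exact congrArg Φ (χ.left_inv hx)
  · rintro x ⟨hx, hx'⟩
    have h1 := (hs _ hx').1.contMDiffAt
    rw [← hφ] at h1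
    exact h1.comp x (contMDiffAt_extendedChart hx)
  · rintro y ⟨hy, hy'⟩
    exact (contMDiffAt_extendedChart_symm hy').comp y (ht y hy).contMDiffAt

/-- The rank of a map at a point. -/
def mrank (I : ModelWithCorners ℝ E H) (J : ModelWithCorners ℝ E' H') (f : M → N) (p : M) : ℕ :=
  Module.finrank ℝ (mfderiv I J f p : TangentSpace I p →ₗ[ℝ] TangentSpace J (f p)).range

omit [I.Boundaryless] [J.Boundaryless] [IsManifold I ∞ M] [IsManifold J ∞ N]
  [FiniteDimensional ℝ E'] in
theorem mrank_add_finrank_ker (f : M → N) (p : M) :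
    mrank I J f p + Module.finrank ℝ
      (mfderiv I J f p : TangentSpace I p →ₗ[ℝ] TangentSpace J (f p)).ker
      = Module.finrank ℝ E :=
  have : FiniteDimensional ℝ (TangentSpace I p) := inferInstanceAs (FiniteDimensional ℝ E)
  LinearMap.finrank_range_add_finrank_ker
    (mfderiv I J f p : TangentSpace I p →ₗ[ℝ] TangentSpace J (f p))

/-- A map with surjective differential at a point is a submersion there. -/
theorem isSubmersionAtOfComplement_of_surjective {f : M → N} {p : M}
    (hf : ∀ᶠ x in 𝓝 p, ContMDiffAt I J ∞ f x) (hp : Function.Surjective (mfderiv I J f p)) {k : ℕ}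
    (hk : Module.finrank ℝ E = Module.finrank ℝ E' + k) :
    Manifold.IsSubmersionAtOfComplement (EuclideanSpace ℝ (Fin k)) I J ∞ f p := by
  set χ := extendedChart I p
  set ψ := extendedChart J (f p)
  have hpχ : p ∈ χ.source := mem_extendedChart_source p
  have hpψ : f p ∈ ψ.source := mem_extendedChart_source (f p)
  have hfp := hf.self_of_nhds
  have hψf : ContMDiffAt I 𝓘(ℝ, E') ∞ (ψ ∘ f) p := (contMDiffAt_extendedChart hpψ).comp p hfp
  let B : E →L[ℝ] E' := mfderiv I 𝓘(ℝ, E') (ψ ∘ f) p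
  have hB : Function.Surjective B := by
    have h1 := mfderiv_comp p ((contMDiffAt_extendedChart hpψ).mdifferentiableAt (by simp))
      (hfp.mdifferentiableAt (by simp))
    have h2 : B = (mfderiv J 𝓘(ℝ, E') ψ (f p)).comp (mfderiv I J f p) := h1
    rw [h2]
    exact (mfderiv_extendedChart_bijective hpψ).2.comp hp
  obtain ⟨P, hP⟩ := exists_prod_bijective_of_surjective B hB hk
  let C : E →L[ℝ] E := mfderiv I 𝓘(ℝ, E) χ p
  have hC : Function.Bijective C := mfderiv_extendedChart_bijective hpχ
  let C' : E ≃L[ℝ] E := (LinearEquiv.ofBijective (C : E →ₗ[ℝ] E) hC).toContinuousLinearEquiv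
  -- `P` is a map on the tangent space at `p`; undoing the derivative of `χ` makes `P' ∘ χ` have
  -- derivative `P` there.
  let P' : E →L[ℝ] EuclideanSpace ℝ (Fin k) := P.comp (C'.symm : E →L[ℝ] E)
  let Φ : M → E' × EuclideanSpace ℝ (Fin k) := fun x => (ψ (f x), P' (χ x))
  have hΦ : ∀ᶠ x in 𝓝 p, ContMDiffAt I 𝓘(ℝ, E' × EuclideanSpace ℝ (Fin k)) ∞ Φ x := by
    filter_upwards [hf, χ.open_source.mem_nhds hpχ,
      hfp.continuousAt (ψ.open_source.mem_nhds hpψ)] with x h1 h2 h3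
    exact ((contMDiffAt_extendedChart h3).comp x h1).prodMk_space
      (P'.contMDiff.contMDiffAt.comp x (contMDiffAt_extendedChart h2))
  have hdΦ : Function.Bijective (mfderiv I 𝓘(ℝ, E' × EuclideanSpace ℝ (Fin k)) Φ p) := by
    have h1 : HasMFDerivAt I 𝓘(ℝ, E') (ψ ∘ f) p B :=
      (hψf.mdifferentiableAt (by simp)).hasMFDerivAt
    have h2 : HasMFDerivAt I 𝓘(ℝ, E) χ p C :=
      ((contMDiffAt_extendedChart hpχ).mdifferentiableAt (by simp)).hasMFDerivAt
    have h3 : HasMFDerivAt I 𝓘(ℝ, EuclideanSpace ℝ (Fin k)) (P' ∘ χ) p (P'.comp C) :=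
      P'.hasFDerivAt.hasMFDerivAt.comp p h2
    have h4 : HasMFDerivAt I 𝓘(ℝ, E' × EuclideanSpace ℝ (Fin k)) Φ p (B.prod (P'.comp C)) :=
      ⟨hΦ.self_of_nhds.continuousAt, HasFDerivWithinAt.prodMk h1.2 h3.2⟩
    rw [h4.mfderiv]
    have h5 : P'.comp C = P := by
      ext1 v
      change P (C'.symm (C' v)) = P v
      rw [C'.symm_apply_apply]
    rw [h5]
    exact hP
  obtain ⟨φ, hpφ, hφ, hs, ht⟩ := exists_openPartialHomeomorph_of_mfderiv_bijective hΦ hdΦ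
  let L : E ≃L[ℝ] E' × EuclideanSpace ℝ (Fin k) := ContinuousLinearEquiv.ofFinrankEq (by simp [hk])
  obtain ⟨e, he, hes, -, het⟩ := exists_chart_of_openPartialHomeomorph φ L hs ht
  refine Manifold.IsSubmersionAtOfComplement.mk_of_continuousAt hfp.continuousAt L e
    (chartAt H' (f p)) (by rwa [hes]) (mem_chart_source H' (f p)) he
    (IsManifold.chart_mem_maximalAtlas _) ?_
  intro v hv
  obtain ⟨h1, h2⟩ := het v hv
  rw [hφ _ h1] at h2
  exact congrArg Prod.fst h2

/-- A map with injective differential at a point is an immersion there. -/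
theorem isImmersionAtOfComplement_of_injective {f : M → N} {p : M}
    (hf : ∀ᶠ x in 𝓝 p, ContMDiffAt I J ∞ f x) (hp : Function.Injective (mfderiv I J f p)) {k : ℕ}
    (hk : Module.finrank ℝ E' = Module.finrank ℝ E + k) :
    Manifold.IsImmersionAtOfComplement (EuclideanSpace ℝ (Fin k)) I J ∞ f p := by
  set χ := extendedChart I p
  set ψ := extendedChart J (f p)
  have hpχ : p ∈ χ.source := mem_extendedChart_source p
  have hpψ : f p ∈ ψ.source := mem_extendedChart_source (f p)
  have hχp : χ.symm (χ p) = p := χ.left_inv hpχ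
  have hfp := hf.self_of_nhds
  have hct : ContinuousAt χ.symm (χ p) := χ.continuousAt_symm (χ.map_source hpχ)
  let c : E → E' := fun a => ψ (f (χ.symm a))
  have hc : ∀ᶠ a in 𝓝 (χ p), ContDiffAt ℝ ∞ c a := by
    have h1 : ∀ᶠ x in 𝓝 p, ContMDiffAt I J ∞ f x ∧ f x ∈ ψ.source :=
      hf.and (hfp.continuousAt (ψ.open_source.mem_nhds hpψ))
    rw [← hχp] at h1
    filter_upwards [hct.eventually h1, χ.open_target.mem_nhds (χ.map_source hpχ)] with a ha hat
    exact ((contMDiffAt_extendedChart ha.2).comp a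
      (ha.1.comp a (contMDiffAt_extendedChart_symm hat))).contDiffAt
  have hdc : Function.Injective (fderiv ℝ c (χ p)) := by
    have h0 := contMDiffAt_extendedChart_symm (χ.map_source hpχ)
    have h1 : HasMFDerivAt 𝓘(ℝ, E) I χ.symm (χ p) (mfderiv 𝓘(ℝ, E) I χ.symm (χ p)) :=
      (h0.mdifferentiableAt (by simp)).hasMFDerivAt
    have h2 : HasMFDerivAt I J f (χ.symm (χ p)) (mfderiv I J f (χ.symm (χ p))) := by
      rw [hχp]; exact (hfp.mdifferentiableAt (by simp)).hasMFDerivAt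
    have hsrc : f (χ.symm (χ p)) ∈ ψ.source := by rw [hχp]; exact hpψ
    have h3 := ((contMDiffAt_extendedChart hsrc).mdifferentiableAt (by simp)).hasMFDerivAt
    have h4 := h3.comp (χ p) (h2.comp (χ p) h1)
    rw [← mfderiv_eq_fderiv]
    change Function.Injective (mfderiv 𝓘(ℝ, E) 𝓘(ℝ, E') (ψ ∘ f ∘ χ.symm) (χ p))
    rw [h4.mfderiv]
    have h6 : Function.Injective (mfderiv I J f (χ.symm (χ p))) := by rw [hχp]; exact hp
    exact (mfderiv_extendedChart_bijective hsrc).1.comp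
      (h6.comp (mfderiv_extendedChart_symm_bijective (χ.map_source hpχ)).1)
  obtain ⟨Q, hQ⟩ := exists_coprod_bijective_of_injective (fderiv ℝ c (χ p)) hdc hk
  -- Thicken the parametrized image of `c` along the complement given by `Q`. In the chart inverse
  -- to `Θ` the map becomes `v ↦ (v, 0)`.
  let Θ : E × EuclideanSpace ℝ (Fin k) → E' := fun w => c w.1 + Q w.2
  have hfst : Tendsto (Prod.fst : E × EuclideanSpace ℝ (Fin k) → E) (𝓝 (χ p, 0)) (𝓝 (χ p)) :=
    continuous_fst.tendsto _
  have hΘ : ∀ᶠ w in 𝓝 (χ p, (0 : EuclideanSpace ℝ (Fin k))), ContDiffAt ℝ ∞ Θ w := by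
    filter_upwards [hfst.eventually hc] with w hw
    exact (hw.comp w contDiff_fst.contDiffAt).add (Q.contDiff.comp contDiff_snd).contDiffAt
  have hdΘ : Function.Bijective (fderiv ℝ Θ (χ p, 0)) := by
    have h1 := (hc.self_of_nhds.differentiableAt (by simp)).hasFDerivAt
    have h2 : HasFDerivAt Θ ((fderiv ℝ c (χ p)).comp (ContinuousLinearMap.fst ℝ _ _) +
        Q.comp (ContinuousLinearMap.snd ℝ _ _)) (χ p, 0) :=
      (HasFDerivAt.comp (g := c) (χ p, (0 : EuclideanSpace ℝ (Fin k))) h1 hasFDerivAt_fst).add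
        (Q.hasFDerivAt.comp (χ p, (0 : EuclideanSpace ℝ (Fin k))) hasFDerivAt_snd)
    rw [h2.fderiv]
    exact hQ
  obtain ⟨θ, hpθ, hθ, hs, ht⟩ := exists_openPartialHomeomorph_of_fderiv_bijective hΘ hdΘ
  let L : E' ≃L[ℝ] E × EuclideanSpace ℝ (Fin k) := ContinuousLinearEquiv.ofFinrankEq (by simp [hk])
  have hθp : θ (χ p, 0) = ψ (f p) := by
    rw [hθ]
    change ψ (f (χ.symm (χ p))) + Q 0 = ψ (f p)
    rw [hχp, map_zero, add_zero]
  obtain ⟨e', he', hes', hef', -⟩ := exists_chart_of_openPartialHomeomorph (I := J)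
    (ψ.trans θ.symm) L
    (fun y hy => (ht _ hy.2).contMDiffAt.comp y (contMDiffAt_extendedChart hy.1))
    (fun w hw => (contMDiffAt_extendedChart_symm hw.2).comp w (by
      have h1 := (hs w hw.1).1.contMDiffAt
      rw [← hθ] at h1
      exact h1))
  let U : Set M := χ.source ∩ χ ⁻¹' {a | (a, (0 : EuclideanSpace ℝ (Fin k))) ∈ θ.source}
  have hU : IsOpen U := χ.isOpen_inter_preimage (θ.open_source.preimage (by fun_prop))
  obtain ⟨e, he, hes, -, het⟩ := exists_chart_of_openPartialHomeomorph (χ.restrOpen U hU)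
    (ContinuousLinearEquiv.refl ℝ E) (fun x hx => contMDiffAt_extendedChart hx.1)
    (fun y hy => contMDiffAt_extendedChart_symm hy.1)
  refine Manifold.IsImmersionAtOfComplement.mk_of_continuousAt hfp.continuousAt L.symm e e'
    (by rw [hes]; exact ⟨hpχ, hpχ, hpθ⟩) ?_ he he' ?_
  · rw [hes']
    refine ⟨hpψ, ?_⟩
    change ψ (f p) ∈ θ.target
    rw [← hθp]
    exact θ.map_source hpθ
  · intro v hv
    obtain ⟨h1, h2⟩ := het v hv
    set x := (e.extend I).symm v
    have h2 : χ x = v := h2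
    have h3 : (v, (0 : EuclideanSpace ℝ (Fin k))) ∈ θ.source := h2 ▸ h1.2.2
    change e'.extend J (f x) = L.symm (v, 0)
    rw [hef']
    congr 1
    change θ.symm (ψ (f x)) = (v, 0)
    have h4 : ψ (f x) = θ (v, 0) := by
      rw [hθ]
      change _ = ψ (f (χ.symm v)) + Q 0
      rw [← h2, χ.left_inv h1.1, map_zero, add_zero]
    rw [h4, θ.left_inv h3]

end LocalNormalForms

/-! ### Local sections, local retractions and slices -/

section LocalSections

variable {E E' : Type*} [NormedAddCommGroup E] [NormedSpace ℝ E] [FiniteDimensional ℝ E]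
  [NormedAddCommGroup E'] [NormedSpace ℝ E'] [FiniteDimensional ℝ E']
  {H H' : Type*} [TopologicalSpace H] [TopologicalSpace H']
  {I : ModelWithCorners ℝ E H} [I.Boundaryless] {J : ModelWithCorners ℝ E' H'} [J.Boundaryless]
  {M N : Type*} [TopologicalSpace M] [ChartedSpace H M] [IsManifold I ∞ M]
  [TopologicalSpace N] [ChartedSpace H' N] [IsManifold J ∞ N]

/-- `f` has a smooth local section through the point `p`. -/
def HasLocalSection (I : ModelWithCorners ℝ E H) (J : ModelWithCorners ℝ E' H') (f : M → N)
    (p : M) : Prop :=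
  ∃ σ : N → M, σ (f p) = p ∧ ∀ᶠ y in 𝓝 (f p), ContMDiffAt J I ∞ σ y ∧ f (σ y) = y

/-- `f` has a smooth local retraction near the point `f p`; this includes that `f` is locally an
embedding. -/
def HasLocalRetraction (I : ModelWithCorners ℝ E H) (J : ModelWithCorners ℝ E' H') (f : M → N)
    (p : M) : Prop :=
  ∃ ρ : N → M, ∀ᶠ y in 𝓝 (f p), ContMDiffAt J I ∞ ρ y ∧ ∀ q, f q = y → ρ y = q

/-- A local slice of `f` at `p`: near `p` the values of `f` are parametrized by `ℝᵈ`. -/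
def HasSlice (I : ModelWithCorners ℝ E H) (J : ModelWithCorners ℝ E' H') (d : ℕ) (f : M → N)
    (p : M) : Prop :=
  ∃ (ρ : N → EuclideanSpace ℝ (Fin d)) (s : EuclideanSpace ℝ (Fin d) → M),
    s (ρ (f p)) = p ∧ (∀ᶠ y in 𝓝 (f p), ContMDiffAt J (𝓡 d) ∞ ρ y) ∧
    (∀ᶠ b in 𝓝 (ρ (f p)), ContMDiffAt (𝓡 d) I ∞ s b ∧ ρ (f (s b)) = b) ∧
    ∀ᶠ x in 𝓝 p, f (s (ρ (f x))) = f x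

theorem HasLocalSection.surjective_mfderiv {f : M → N} {p : M} (hf : ContMDiffAt I J ∞ f p)
    (h : HasLocalSection I J f p) : Function.Surjective (mfderiv I J f p) := by
  obtain ⟨σ, hσ, h⟩ := h
  exact mfderiv_surjective_of_rightInverse (hf.mdifferentiableAt (by simp))
    (h.self_of_nhds.1.mdifferentiableAt (by simp)) hσ (h.mono fun _ hy => hy.2)

theorem HasLocalRetraction.injective_mfderiv {f : M → N} {p : M} (hf : ContMDiffAt I J ∞ f p)
    (h : HasLocalRetraction I J f p) : Function.Injective (mfderiv I J f p) := by
  obtain ⟨ρ, h⟩ := h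
  exact mfderiv_injective_of_leftInverse (hf.mdifferentiableAt (by simp))
    (h.self_of_nhds.1.mdifferentiableAt (by simp))
    ((hf.continuousAt.eventually h).mono fun x hx => hx.2 x rfl)

/-- A retraction recovers every preimage of a nearby value, not only those close to `p`; the
injectivity is therefore global. -/
theorem injective_of_hasLocalRetraction {f : M → N} (h : ∀ p, HasLocalRetraction I J f p) :
    Function.Injective f := by
  intro p p' hpp
  obtain ⟨ρ, h⟩ := h p
  exact (h.self_of_nhds.2 p rfl).symm.trans (h.self_of_nhds.2 p' hpp.symm)

theorem isSubmersion_of_surjective_mfderiv {f : M → N} (hf : ContMDiff I J ∞ f)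
    (h : ∀ p, Function.Surjective (mfderiv I J f p)) : Manifold.IsSubmersion I J ∞ f := by
  refine Manifold.IsSubmersionOfComplement.isSubmersion
    (F := EuclideanSpace ℝ (Fin (Module.finrank ℝ E - Module.finrank ℝ E'))) fun p => ?_
  refine isSubmersionAtOfComplement_of_surjective (Eventually.of_forall fun x => hf x) (h p) ?_
  have : FiniteDimensional ℝ (TangentSpace I p) := inferInstanceAs (FiniteDimensional ℝ E)
  -- The complement must be one space for all points. Its dimension is a truncated difference, which
  -- is the true one as soon as a point `p` exists.
  have h1 : Module.finrank ℝ E' ≤ Module.finrank ℝ E := LinearMap.finrank_le_finrank_of_surjective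
    (f := (mfderiv I J f p : TangentSpace I p →ₗ[ℝ] TangentSpace J (f p))) (h p)
  omega

theorem isImmersion_of_injective_mfderiv {f : M → N} (hf : ContMDiff I J ∞ f)
    (h : ∀ p, Function.Injective (mfderiv I J f p)) : Manifold.IsImmersion I J ∞ f := by
  refine Manifold.IsImmersionOfComplement.isImmersion
    (F := EuclideanSpace ℝ (Fin (Module.finrank ℝ E' - Module.finrank ℝ E))) fun p => ?_
  refine isImmersionAtOfComplement_of_injective (Eventually.of_forall fun x => hf x) (h p) ?_
  have : FiniteDimensional ℝ (TangentSpace J (f p)) := inferInstanceAs (FiniteDimensional ℝ E')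
  have h1 : Module.finrank ℝ E ≤ Module.finrank ℝ E' := LinearMap.finrank_le_finrank_of_injective
    (f := (mfderiv I J f p : TangentSpace I p →ₗ[ℝ] TangentSpace J (f p))) (h p)
  omega

theorem isSubmersion_of_hasLocalSection {f : M → N} (hf : ContMDiff I J ∞ f)
    (h : ∀ p, HasLocalSection I J f p) : Manifold.IsSubmersion I J ∞ f :=
  isSubmersion_of_surjective_mfderiv hf fun p => (h p).surjective_mfderiv (hf p)

theorem contMDiffAt_extend_symm {e : OpenPartialHomeomorph M H}
    (he : e ∈ IsManifold.maximalAtlas I ∞ M) {v : E} (hv : v ∈ (e.extend I).target) :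
    ContMDiffAt 𝓘(ℝ, E) I ∞ (e.extend I).symm v := by
  refine (contMDiffOn_extend_symm he).contMDiffAt
    (mem_of_superset (e.isOpen_extend_target.mem_nhds hv) fun w hw => ?_)
  rw [OpenPartialHomeomorph.extend_target] at hw
  exact ⟨I.symm w, hw.1, I.right_inv hw.2⟩

/-- In the charts of the normal form `f` is a linear projection; the section freezes the
complementary coordinates at their value `v₀` at `p`. -/
theorem Manifold.IsSubmersion.hasLocalSection {f : M → N} (hf : Manifold.IsSubmersion I J ∞ f)
    (p : M) : HasLocalSection I J f p := by
  have h := hf.isSubmersionAt p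
  set χ := h.domChart.extend I
  set ψ := h.codChart.extend J
  have hχs : χ.source = h.domChart.source := h.domChart.extend_source
  have hψs : ψ.source = h.codChart.source := h.codChart.extend_source
  have hpχ : p ∈ χ.source := hχs ▸ h.mem_domChart_source
  have hpψ : f p ∈ ψ.source := hψs ▸ h.mem_codChart_source
  have hw : ∀ v ∈ χ.target, ψ (f (χ.symm v)) = (h.equiv v).1 := h.writtenInCharts
  have hto : IsOpen χ.target := h.domChart.isOpen_extend_target
  let v₀ := (h.equiv (χ p)).2
  have hψp : ψ (f p) = (h.equiv (χ p)).1 := by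
    have := hw _ (χ.map_source hpχ)
    rwa [χ.left_inv hpχ] at this
  let τ : N → E := fun y => h.equiv.symm (ψ y, v₀)
  have hτp : τ (f p) = χ p := by
    change h.equiv.symm (ψ (f p), v₀) = _
    rw [hψp]; exact h.equiv.symm_apply_apply _
  have hτ : ∀ y ∈ h.codChart.source, ContMDiffAt J 𝓘(ℝ, E) ∞ τ y := fun y hy =>
    h.equiv.symm.contDiff.contMDiff.contMDiffAt.comp y
      ((h.codChart.contMDiffAt_extend h.codChart_mem_maximalAtlas hy).prodMk_space
        contMDiffAt_const)
  refine ⟨fun y => χ.symm (τ y), ?_, ?_⟩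
  · change χ.symm (τ (f p)) = p
    rw [hτp, χ.left_inv hpχ]
  · have h1 := (hτ _ h.mem_codChart_source).continuousAt
    have h2 : ∀ᶠ y in 𝓝 (f p), τ y ∈ χ.target :=
      h1 (hto.mem_nhds (by rw [hτp]; exact χ.map_source hpχ))
    filter_upwards [h2, h.codChart.open_source.mem_nhds h.mem_codChart_source] with y hy hys
    have hsm := contMDiffAt_extend_symm h.domChart_mem_maximalAtlas hy
    refine ⟨hsm.comp y (hτ y hys), ?_⟩
    have h3 := hw _ hy
    have h4 : f (χ.symm (τ y)) ∈ ψ.source := by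
      rw [hψs]
      exact h.source_subset_preimage_source (hχs ▸ χ.map_target hy)
    refine ψ.injOn h4 (hψs ▸ hys) ?_
    rw [h3]
    change (h.equiv (h.equiv.symm (ψ y, v₀))).1 = ψ y
    rw [h.equiv.apply_symm_apply]

/-- A smooth embedding has local retractions. -/
theorem Manifold.IsSmoothEmbedding.hasLocalRetraction {f : M → N}
    (hf : Manifold.IsSmoothEmbedding I J ∞ f) (p : M) : HasLocalRetraction I J f p := by
  have h := hf.isImmersion.isImmersionAt p
  set χ := h.domChart.extend I
  set ψ := h.codChart.extend J
  have hχs : χ.source = h.domChart.source := h.domChart.extend_source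
  have hpχ : p ∈ χ.source := hχs ▸ h.mem_domChart_source
  have hw : ∀ v ∈ χ.target, ψ (f (χ.symm v)) = h.equiv (v, 0) := h.writtenInCharts
  have hto : IsOpen χ.target := h.domChart.isOpen_extend_target
  let τ : N → E := fun y => (h.equiv.symm (ψ y)).1
  have hτf : ∀ q ∈ χ.source, τ (f q) = χ q := by
    intro q hq
    have h1 := hw _ (χ.map_source hq)
    rw [χ.left_inv hq] at h1
    change (h.equiv.symm (ψ (f q))).1 = _
    rw [h1, h.equiv.symm_apply_apply]
  have hτ : ∀ y ∈ h.codChart.source, ContMDiffAt J 𝓘(ℝ, E) ∞ τ y := fun y hy =>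
    (contDiff_fst.comp h.equiv.symm.contDiff).contMDiff.contMDiffAt.comp y
      (h.codChart.contMDiffAt_extend h.codChart_mem_maximalAtlas hy)
  refine ⟨fun y => χ.symm (τ y), ?_⟩
  have h2 : ∀ᶠ y in 𝓝 (f p), τ y ∈ χ.target :=
    (hτ _ h.mem_codChart_source).continuousAt
      (hto.mem_nhds (by rw [hτf p hpχ]; exact χ.map_source hpχ))
  -- The topology of `M` is induced by `f`, so no point far from `p` has a value near `f p`. An
  -- immersion alone would only recover the preimages inside the chart.
  have h3 : ∀ᶠ y in 𝓝 (f p), ∀ q, f q = y → q ∈ χ.source := by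
    have h4 : χ.source ∈ 𝓝 p := hχs ▸ h.domChart.open_source.mem_nhds h.mem_domChart_source
    rw [hf.isEmbedding.nhds_eq_comap] at h4
    obtain ⟨V, hV, hVs⟩ := h4
    filter_upwards [hV] with y hy q hq
    exact hVs (show f q ∈ V from hq ▸ hy)
  filter_upwards [h2, h3, h.codChart.open_source.mem_nhds h.mem_codChart_source] with y hy hq hys
  have hsm := contMDiffAt_extend_symm h.domChart_mem_maximalAtlas hy
  refine ⟨hsm.comp y (hτ y hys), ?_⟩
  rintro q rfl
  rw [hτf q (hq q rfl), χ.left_inv (hq q rfl)]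

theorem finrank_range_comp_of_injective_of_surjective {V₁ V₂ V₃ V₄ : Type*} [AddCommGroup V₁]
    [Module ℝ V₁] [AddCommGroup V₂] [Module ℝ V₂] [AddCommGroup V₃] [Module ℝ V₃]
    [AddCommGroup V₄] [Module ℝ V₄] (C : V₃ →ₗ[ℝ] V₄) (B : V₂ →ₗ[ℝ] V₃) (A : V₁ →ₗ[ℝ] V₂)
    (hC : Function.Injective C) (hA : Function.Surjective A) :
    Module.finrank ℝ (C ∘ₗ B ∘ₗ A).range = Module.finrank ℝ B.range := by
  rw [LinearMap.range_comp, LinearMap.range_comp, LinearMap.range_eq_top.2 hA, Submodule.map_top]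
  exact (Submodule.equivMapOfInjective C hC _).finrank_eq.symm

/-- The constant rank theorem on manifolds. -/
theorem hasSlice_of_constant_rank {f : M → N} (hf : ContMDiff I J ∞ f) {d : ℕ}
    (hd : ∀ p, mrank I J f p = d) (p : M) : HasSlice I J d f p := by
  set χ := extendedChart I p
  set ψ := extendedChart J (f p)
  have hpχ : p ∈ χ.source := mem_extendedChart_source p
  have hpψ : f p ∈ ψ.source := mem_extendedChart_source (f p)
  have hχp : χ.symm (χ p) = p := χ.left_inv hpχ
  have hct : ContinuousAt χ.symm (χ p) := χ.continuousAt_symm (χ.map_source hpχ)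
  let F : E → E' := ψ ∘ f ∘ χ.symm
  have hFx : ∀ x ∈ χ.source, F (χ x) = ψ (f x) := fun x hx => by
    change ψ (f (χ.symm (χ x))) = _
    rw [χ.left_inv hx]
  have hgood : ∀ᶠ a in 𝓝 (χ p), a ∈ χ.target ∧ f (χ.symm a) ∈ ψ.source := by
    refine Filter.Eventually.and (χ.open_target.mem_nhds (χ.map_source hpχ)) ?_
    have h1 : ∀ᶠ x in 𝓝 (χ.symm (χ p)), f x ∈ ψ.source := by
      rw [hχp]; exact (hf p).continuousAt (ψ.open_source.mem_nhds hpψ)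
    exact hct.eventually h1
  obtain ⟨ρ, s, h1, h2, h3⟩ := exists_slice_of_constant_rank (d := d) (F := F) (a := χ p)
    (hgood.mono fun a ha => ((contMDiffAt_extendedChart ha.2).comp a
      ((hf _).comp a (contMDiffAt_extendedChart_symm ha.1))).contDiffAt)
    (hgood.mono fun a ha => by
      have d1 := ((contMDiffAt_extendedChart_symm ha.1).mdifferentiableAt (by simp)).hasMFDerivAt
      have d2 := ((hf (χ.symm a)).mdifferentiableAt (by simp)).hasMFDerivAt
      have d3 := ((contMDiffAt_extendedChart ha.2).mdifferentiableAt (by simp)).hasMFDerivAt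
      have d4 := (d3.comp a (d2.comp a d1)).mfderiv
      rw [← mfderiv_eq_fderiv, d4, ← hd (χ.symm a)]
      exact finrank_range_comp_of_injective_of_surjective _ _ _
        (mfderiv_extendedChart_bijective ha.2).1 (mfderiv_extendedChart_symm_bijective ha.1).2)
  have hFp := hFx p hpχ
  rw [hFp] at h1 h2
  have hscont : ContinuousAt s (ρ (ψ (f p))) := h2.self_of_nhds.1.continuousAt
  have hsm : ∀ᶠ b in 𝓝 (ρ (ψ (f p))), ContMDiffAt (𝓡 d) I ∞ (χ.symm ∘ s) b ∧
      ρ (ψ (f (χ.symm (s b)))) = b := by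
    have h4 : ∀ᶠ b in 𝓝 (ρ (ψ (f p))), s b ∈ χ.target :=
      hscont (χ.open_target.mem_nhds (by rw [h1]; exact χ.map_source hpχ))
    filter_upwards [h2, h4] with b hb hbt
    exact ⟨(contMDiffAt_extendedChart_symm hbt).comp b hb.1.contMDiffAt, hb.2⟩
  have hρm : ∀ y ∈ ψ.source, ContMDiffAt J (𝓡 d) ∞ (ρ ∘ ψ) y := fun y hy =>
    ρ.contDiff.contMDiff.contMDiffAt.comp y (contMDiffAt_extendedChart hy)
  have hsp : χ.symm (s (ρ (ψ (f p)))) = p := by rw [h1, hχp]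
  refine ⟨ρ ∘ ψ, χ.symm ∘ s, hsp, ?_, hsm, ?_⟩
  · exact eventually_of_mem (ψ.open_source.mem_nhds hpψ) hρm
  · have hc1 : ContinuousAt (fun x => ρ (ψ (f x))) p :=
      ContinuousAt.comp (g := ρ ∘ ψ) (hρm _ hpψ).continuousAt (hf p).continuousAt
    have hc2 : ContinuousAt (fun x => χ.symm (s (ρ (ψ (f x))))) p :=
      ContinuousAt.comp (g := χ.symm ∘ s) hsm.self_of_nhds.1.continuousAt hc1
    have hc3 : ContinuousAt (fun x => f (χ.symm (s (ρ (ψ (f x)))))) p :=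
      ContinuousAt.comp (g := f) hf.continuous.continuousAt hc2
    -- The identity is known after applying `ψ`; cancelling `ψ` requires both sides to lie in its
    -- source, whence the continuity of the left one.
    have h5 := hc3 (ψ.open_source.mem_nhds (by dsimp only; rw [hsp]; exact hpψ))
    have h6 := (χ.continuousAt hpχ).eventually h3
    filter_upwards [h5, h6, χ.open_source.mem_nhds hpχ,
      (hf p).continuousAt (ψ.open_source.mem_nhds hpψ)] with x hx5 hx6 hx7 hx8
    rw [hFx x hx7] at hx6
    exact ψ.injOn hx5 hx8 hx6

end LocalSections

/-! ### Manifold structures obtained from slices -/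

section Atlas

variable {E E' : Type*} [NormedAddCommGroup E] [NormedSpace ℝ E] [FiniteDimensional ℝ E]
  [NormedAddCommGroup E'] [NormedSpace ℝ E'] [FiniteDimensional ℝ E']
  {H H' : Type*} [TopologicalSpace H] [TopologicalSpace H']
  {I : ModelWithCorners ℝ E H} [I.Boundaryless] {J : ModelWithCorners ℝ E' H'} [J.Boundaryless]
  {M N : Type*} [TopologicalSpace M] [ChartedSpace H M] [IsManifold I ∞ M]
  [TopologicalSpace N] [ChartedSpace H' N] [IsManifold J ∞ N]
  {Z : Type*} [TopologicalSpace Z] {q : M → Z} {j : Z → N} {d : ℕ}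

/-- A local homeomorphism to `ℝᵈ` obtained from a slice. -/
theorem exists_openPartialHomeomorph_of_hasSlice (hq : Continuous q) (hqo : IsOpenMap q)
    (hj : Continuous j) (hji : Function.Injective j) {p : M} (h : HasSlice I J d (j ∘ q) p) :
    ∃ (e : OpenPartialHomeomorph Z (EuclideanSpace ℝ (Fin d)))
      (ρ : N → EuclideanSpace ℝ (Fin d)) (s : EuclideanSpace ℝ (Fin d) → M),
      q p ∈ e.source ∧ (∀ z, e z = ρ (j z)) ∧ (∀ b, e.symm b = q (s b)) ∧
      (∀ z ∈ e.source, ContMDiffAt J (𝓡 d) ∞ ρ (j z)) ∧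
      ∀ b ∈ e.target, ContMDiffAt (𝓡 d) I ∞ s b := by
  obtain ⟨ρ, s, -, h2, h3, h4⟩ := h
  obtain ⟨V, hV, hVo, hpV⟩ := eventually_nhds_iff.1 h2
  obtain ⟨B, hB, hBo, hpB⟩ := eventually_nhds_iff.1 h3
  obtain ⟨W₀, hW₀, hW₀o, hpW₀⟩ := eventually_nhds_iff.1 h4
  have hVc : ContinuousOn (fun x => ρ (j (q x))) ((j ∘ q) ⁻¹' V) := fun x hx =>
    ((hV _ hx).continuousAt.comp (f := j ∘ q) (hj.comp hq).continuousAt).continuousWithinAt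
  set W : Set M := W₀ ∩ ((j ∘ q) ⁻¹' V ∩ (fun x => ρ (j (q x))) ⁻¹' B)
  have hWo : IsOpen W := hW₀o.inter (hVc.isOpen_inter_preimage (hVo.preimage (hj.comp hq)) hBo)
  have hsc : ContinuousOn (fun b => q (s b)) B := fun b hb =>
    (hq.continuousAt.comp (hB b hb).1.continuousAt).continuousWithinAt
  have hqW : ∀ x ∈ W, q (s (ρ (j (q x)))) = q x := fun x hx => hji (hW₀ x hx.1)
  refine ⟨{ toFun := fun z => ρ (j z)
            invFun := fun b => q (s b)
            source := q '' W
            target := B ∩ (fun b => q (s b)) ⁻¹' (q '' W)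
            map_source' := ?_
            map_target' := fun b hb => hb.2
            left_inv' := ?_
            right_inv' := fun b hb => (hB b hb.1).2
            open_source := hqo _ hWo
            open_target := hsc.isOpen_inter_preimage hBo (hqo _ hWo)
            continuousOn_toFun := ?_
            continuousOn_invFun := hsc.mono inter_subset_left }, ρ, s,
    ⟨p, ⟨hpW₀, hpV, hpB⟩, rfl⟩, fun _ => rfl, fun _ => rfl, ?_, fun b hb => (hB b hb.1).1⟩
  · rintro _ ⟨x, hx, rfl⟩
    exact ⟨hx.2.2, x, hx, (hqW x hx).symm⟩
  · rintro _ ⟨x, hx, rfl⟩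
    exact hqW x hx
  · rintro _ ⟨x, hx, rfl⟩
    exact (ContinuousAt.comp (f := j) (x := q x) (hV _ hx.2.1).continuousAt
      hj.continuousAt).continuousWithinAt
  · rintro _ ⟨x, hx, rfl⟩
    exact hV _ hx.2.1

/-- If `f = j ∘ q : M → Z → N` has slices, with `q` open and surjective and `j` injective, then `Z`
is a manifold for which `q` is a submersion and `j` is an immersion. -/
theorem exists_isManifold_of_hasSlice (hf : ContMDiff I J ∞ (j ∘ q)) (hq : Continuous q)
    (hqo : IsOpenMap q) (hqs : Function.Surjective q) (hj : Continuous j)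
    (hji : Function.Injective j) (hsl : ∀ p, HasSlice I J d (j ∘ q) p) :
    ∃ _ : ChartedSpace (EuclideanSpace ℝ (Fin d)) Z, IsManifold (𝓡 d) ∞ Z ∧
      Manifold.IsSubmersion I (𝓡 d) ∞ q ∧ Manifold.IsImmersion (𝓡 d) J ∞ j := by
  have hloc : ∀ z : Z, ∃ (e : OpenPartialHomeomorph Z (EuclideanSpace ℝ (Fin d)))
      (ρ : N → EuclideanSpace ℝ (Fin d)) (s : EuclideanSpace ℝ (Fin d) → M),
      z ∈ e.source ∧ (∀ z, e z = ρ (j z)) ∧ (∀ b, e.symm b = q (s b)) ∧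
      (∀ z ∈ e.source, ContMDiffAt J (𝓡 d) ∞ ρ (j z)) ∧
      ∀ b ∈ e.target, ContMDiffAt (𝓡 d) I ∞ s b := by
    intro z
    obtain ⟨p, rfl⟩ := hqs z
    exact exists_openPartialHomeomorph_of_hasSlice hq hqo hj hji (hsl p)
  choose e ρ s hze he hes hρ hs using hloc
  let cs : ChartedSpace (EuclideanSpace ℝ (Fin d)) Z :=
    { atlas := range e
      chartAt := e
      mem_chart_source := hze
      chart_mem_atlas := fun z => ⟨z, rfl⟩ }
  have hmf : IsManifold (𝓡 d) ∞ Z := by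
    refine isManifold_of_contDiffOn _ _ _ ?_
    rintro _ _ ⟨z, rfl⟩ ⟨z', rfl⟩
    intro b hb
    have hb1 : b ∈ (e z).target := hb.1.1
    have hb2 : (e z).symm b ∈ (e z').source := hb.1.2
    -- A transition map factors through `M` and `N`, where smoothness already makes sense.
    have h1 : ContMDiffAt (𝓡 d) (𝓡 d) ∞ (ρ z' ∘ (j ∘ q) ∘ s z) b := by
      refine ContMDiffAt.comp b ?_ ((hf _).comp b (hs z b hb1))
      have := hρ z' _ hb2
      rwa [hes] at this
    refine (h1.contDiffAt.congr_of_eventuallyEq (Eventually.of_forall fun b' => ?_)).contDiffWithinAt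
    change e z' ((e z).symm b') = _
    rw [he, hes]
    rfl
  have hmax : ∀ z, e z ∈ IsManifold.maximalAtlas (𝓡 d) ∞ Z := fun z =>
    IsManifold.chart_mem_maximalAtlas (I := 𝓡 d) (n := ∞) z
  have hqsm : ContMDiff I (𝓡 d) ∞ q := by
    intro p
    rw [contMDiffAt_iff_target]
    refine ⟨hq.continuousAt, ?_⟩
    have h1 : ContMDiffAt I (𝓡 d) ∞ (ρ (q p) ∘ (j ∘ q)) p := (hρ _ _ (hze (q p))).comp p (hf p)
    refine h1.congr_of_eventuallyEq (Eventually.of_forall fun x => ?_)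
    exact he (q p) (q x)
  have hjsm : ContMDiff (𝓡 d) J ∞ j := by
    intro z
    have h1 : ContMDiffAt (𝓡 d) (𝓡 d) ∞ (e z) z := contMDiffAt_of_mem_maximalAtlas (hmax z) (hze z)
    have h2 := (hf _).comp z ((hs z _ ((e z).map_source (hze z))).comp z h1)
    refine h2.congr_of_eventuallyEq
      (eventually_of_mem ((e z).open_source.mem_nhds (hze z)) fun z' hz' => ?_)
    change j z' = j (q (s z (e z z')))
    rw [← hes, (e z).left_inv hz']
  refine ⟨cs, hmf, isSubmersion_of_hasLocalSection hqsm fun p => ?_,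
    isImmersion_of_injective_mfderiv hjsm fun z => ?_⟩
  -- The chart at `q p` comes from a chosen preimage, possibly other than `p`; a section through `p`
  -- needs the slice at `p` itself.
  · obtain ⟨ρ', s', h1, h2, h3, h4⟩ := hsl p
    refine ⟨fun z => s' (ρ' (j z)), h1, ?_⟩
    have hc : Tendsto (fun z => j z) (𝓝 (q p)) (𝓝 (j (q p))) := hj.tendsto _
    have hc' : Tendsto (fun z => ρ' (j z)) (𝓝 (q p)) (𝓝 (ρ' (j (q p)))) :=
      (h2.self_of_nhds.continuousAt.tendsto).comp hc
    have h5 : ∀ᶠ z in 𝓝 (q p), q (s' (ρ' (j z))) = z := by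
      refine mem_of_superset (hqo.image_mem_nhds h4) ?_
      rintro _ ⟨x, hx, rfl⟩
      exact hji hx
    filter_upwards [hc.eventually h2, hc'.eventually h3, h5] with z hz2 hz3 hz5
    exact ⟨hz3.1.comp z (hz2.comp z (hjsm z)), hz5⟩
  · have h1 : ContMDiffAt (𝓡 d) (𝓡 d) ∞ (e z) z := contMDiffAt_of_mem_maximalAtlas (hmax z) (hze z)
    have h2 := ((hs z _ ((e z).map_source (hze z))).mdifferentiableAt (by simp))
    have h3 : ContMDiffAt (𝓡 d) (𝓡 d) ∞ (e z).symm (e z z) :=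
      contMDiffAt_symm_of_mem_maximalAtlas (hmax z) ((e z).map_source (hze z))
    have h4 : ContMDiffAt J (𝓡 d) ∞ ((e z).symm ∘ ρ z) (j z) := by
      refine ContMDiffAt.comp (j z) ?_ (hρ z z (hze z))
      rwa [← he]
    refine mfderiv_injective_of_leftInverse ((hjsm z).mdifferentiableAt (by simp))
      (h4.mdifferentiableAt (by simp))
      (eventually_of_mem ((e z).open_source.mem_nhds (hze z)) fun z' hz' => ?_)
    change (e z).symm (ρ z (j z')) = z'
    rw [← he, (e z).left_inv hz']

theorem mrank_of_injective {f : M → N} {p : M} (h : Function.Injective (mfderiv I J f p)) :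
    mrank I J f p = Module.finrank ℝ E :=
  LinearMap.finrank_range_of_inj
    (f := (mfderiv I J f p : TangentSpace I p →ₗ[ℝ] TangentSpace J (f p))) h

theorem mrank_of_surjective {f : M → N} {p : M} (h : Function.Surjective (mfderiv I J f p)) :
    mrank I J f p = Module.finrank ℝ E' := by
  have h1 : (mfderiv I J f p : TangentSpace I p →ₗ[ℝ] TangentSpace J (f p)).range = ⊤ :=
    LinearMap.range_eq_top.2 h
  have h2 := congrArg (fun S : Submodule ℝ (TangentSpace J (f p)) => Module.finrank ℝ S) h1
  exact h2.trans (finrank_top ℝ E')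

theorem HasLocalSection.isOpenMap {f : M → N} (h : ∀ p, HasLocalSection I J f p) :
    IsOpenMap f := by
  refine IsOpenMap.of_nhds_le fun p => ?_
  obtain ⟨σ, hσ, h⟩ := h p
  intro U hU
  have hc : Tendsto σ (𝓝 (f p)) (𝓝 p) := by
    have := h.self_of_nhds.1.continuousAt.tendsto
    rwa [hσ] at this
  filter_upwards [h, hc hU] with y hy hyU
  have : f (σ y) ∈ U := hyU
  rwa [hy.2] at this

/-- A map out of the target of a surjective submersion is smooth if its composition with the
submersion is. -/
theorem ContMDiff.of_comp_hasLocalSection {E'' : Type*} [NormedAddCommGroup E'']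
    [NormedSpace ℝ E''] {H'' : Type*} [TopologicalSpace H''] {I'' : ModelWithCorners ℝ E'' H''}
    {L : Type*} [TopologicalSpace L] [ChartedSpace H'' L] {f : M → N} {g : N → L}
    (hf : ∀ p, HasLocalSection I J f p) (hs : Function.Surjective f)
    (hg : ContMDiff I I'' ∞ (g ∘ f)) : ContMDiff J I'' ∞ g := by
  intro y
  obtain ⟨p, rfl⟩ := hs y
  obtain ⟨σ, hσ, h⟩ := hf p
  refine ((hg _).comp (f p) h.self_of_nhds.1).congr_of_eventuallyEq ?_
  exact h.mono fun y hy => (congrArg g hy.2).symm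

end Atlas

/-! ### Images as submanifolds, targets of submersions as quotients -/

namespace Mfd

theorem Submersion.smooth {M N : Mfd.{u}} {f : M → N} (hf : Submersion f) : Smooth f :=
  Manifold.IsSubmersion.contMDiff hf

theorem Submersion.hasLocalSection {M N : Mfd.{u}} {f : M → N} (hf : Submersion f) (p : M) :
    HasLocalSection M.I N.I f p :=
  Manifold.IsSubmersion.hasLocalSection hf p

theorem Submersion.isOpenMap {M N : Mfd.{u}} {f : M → N} (hf : Submersion f) : IsOpenMap f :=
  HasLocalSection.isOpenMap hf.hasLocalSection

theorem submersion_of_hasLocalSection {M N : Mfd.{u}} {f : M → N} (hf : Smooth f)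
    (h : ∀ p, HasLocalSection M.I N.I f p) : Submersion f :=
  isSubmersion_of_hasLocalSection hf h

theorem SurjSubmersion.smooth_of_comp {M N L : Mfd.{u}} {f : M → N} (hf : SurjSubmersion f)
    {g : N → L} (hg : Smooth (M := M) (N := L) fun x => g (f x)) : Smooth g :=
  ContMDiff.of_comp_hasLocalSection (fun p => hf.1.hasLocalSection p) hf.2 hg

namespace SubmfdStr

variable {M N : Mfd.{u}} {S : Set N} (P : SubmfdStr N S)

/-- The inclusion of an embedded submanifold. -/
def val : P.toMfd → N := Subtype.val

theorem val_smooth : Smooth P.val := P.isEmbedding.isImmersion.contMDiff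

theorem isEmbedding_val : IsEmbedding P.val := P.isEmbedding.isEmbedding

theorem val_hasLocalRetraction (x : P.toMfd) : HasLocalRetraction P.toMfd.I N.I P.val x :=
  P.isEmbedding.hasLocalRetraction x

theorem smooth_iff {f : M → P.toMfd} : Smooth f ↔ Smooth (M := M) (N := N) fun x => P.val (f x) :=
  ⟨fun h => ContMDiff.comp (I' := P.toMfd.I) (g := P.val) P.val_smooth h, fun h =>
    (ContMDiff.iff_comp_isImmersion P.isEmbedding.isImmersion).2
      ⟨P.isEmbedding_val.continuous_iff.2 (ContMDiff.continuous (I := M.I) (I' := N.I) h), h⟩⟩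

end SubmfdStr

/-- The range of a map of constant rank that is open onto its range is a submanifold. -/
theorem exists_submfdStr_range {M N : Mfd.{u}} {f : M → N} (hf : Smooth f) {d : ℕ}
    (hd : ∀ p, mrank M.I N.I f p = d) {S : Set N} (q : M → S) (hq : ∀ x, (q x : N) = f x)
    (hqs : Function.Surjective q) (hqo : IsOpenMap q) :
    ∃ P : SubmfdStr N S, SurjSubmersion (M := M) (N := P.toMfd) q := by
  have hf' : ContMDiff M.I N.I ∞ f := hf
  have hfq : (Subtype.val : S → N) ∘ q = f := funext hq
  have hqc : Continuous q := by
    rw [IsEmbedding.subtypeVal.continuous_iff, hfq]; exact hf'.continuous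
  have hsl := hasSlice_of_constant_rank hf hd
  obtain ⟨cs, hmf, hsub, himm⟩ := exists_isManifold_of_hasSlice (j := (Subtype.val : S → N))
    (q := q) (d := d) (hfq.symm ▸ hf') hqc hqo hqs continuous_subtype_val Subtype.val_injective
    (hfq.symm ▸ hsl)
  exact ⟨{ dim := d, isEmbedding := ⟨himm, IsEmbedding.subtypeVal⟩ }, hsub, hqs⟩

/-- A map with smooth local retractions is a diffeomorphism onto its range, for any structure of
submanifold on it. -/
theorem SubmfdStr.exists_diffeomorph {M N : Mfd.{u}} {f : M → N} (hf : Smooth f)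
    (hr : ∀ p, HasLocalRetraction M.I N.I f p) {S : Set N} (P : SubmfdStr N S) (q : M → S)
    (hq : ∀ x, (q x : N) = f x) (hqs : Function.Surjective q) :
    ∃ e : Diffeomorph M.I P.toMfd.I M P.toMfd ∞, ∀ x, e x = q x := by
  have hqi : Function.Injective q := fun x y hxy => injective_of_hasLocalRetraction hr
    (by rw [← hq, ← hq, hxy])
  let e := Equiv.ofBijective q ⟨hqi, hqs⟩
  have hfe : ∀ z : S, f (e.symm z) = z := fun z => by
    rw [← hq]; exact congrArg Subtype.val (e.apply_symm_apply z)
  refine ⟨{ toEquiv := e, contMDiff_toFun := ?_, contMDiff_invFun := ?_ }, fun _ => rfl⟩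
  · exact P.smooth_iff.2 ((funext hq : (fun x => (q x : N)) = f) ▸ hf)
  · intro z
    obtain ⟨ρ, hρ⟩ := hr (e.symm z)
    rw [hfe z] at hρ
    have hval : ContMDiff P.toMfd.I N.I ∞ P.val := P.val_smooth
    refine (ContMDiffAt.comp (I' := N.I) (f := P.val) z hρ.self_of_nhds.1
      (hval z)).congr_of_eventuallyEq ?_
    have hc : Tendsto P.val (𝓝 z) (𝓝 (P.val z)) := hval.continuous.tendsto z
    exact (hc.eventually hρ).mono fun z' hz' => (hz'.2 _ (hfe z')).symm

/-- A local retraction makes the differential injective, so the rank is constant, and its continuity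
makes `f` open onto its image; the theorem on images of constant rank applies. -/
theorem exists_submfdStr_of_hasLocalRetraction {M N : Mfd.{u}} {f : M → N} (hf : Smooth f)
    (hr : ∀ p, HasLocalRetraction M.I N.I f p) {S : Set N} (q : M → S) (hq : ∀ x, (q x : N) = f x)
    (hqs : Function.Surjective q) : Nonempty (SubmfdStr N S) := by
  have hf' : ContMDiff M.I N.I ∞ f := hf
  have hqo : IsOpenMap q := by
    intro U hU
    rw [isOpen_iff_mem_nhds]
    rintro _ ⟨x, hx, rfl⟩
    obtain ⟨ρ, hρ⟩ := hr x
    have hρx : ρ (f x) = x := hρ.self_of_nhds.2 x rfl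
    have h1 : ∀ᶠ y in 𝓝 (f x), ρ y ∈ U :=
      hρ.self_of_nhds.1.continuousAt (hU.mem_nhds (by rwa [hρx]))
    have h2 : Tendsto (Subtype.val : S → N) (𝓝 (q x)) (𝓝 (f x)) := by
      rw [← hq]; exact continuous_subtype_val.tendsto _
    filter_upwards [h2.eventually hρ, h2.eventually h1] with z hz1 hz2
    obtain ⟨w, rfl⟩ := hqs z
    rw [hz1.2 w (hq w).symm] at hz2
    exact ⟨w, hz2, rfl⟩
  obtain ⟨P, -⟩ := exists_submfdStr_range hf
    (fun p => mrank_of_injective ((hr p).injective_mfderiv (hf' p))) q hq hqs hqo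
  exact ⟨P⟩

/-- A diffeomorphism onto a submanifold has local retractions. -/
theorem SubmfdStr.hasLocalRetraction_of_diffeomorph {M N : Mfd.{u}} {f : M → N} {S : Set N}
    (P : SubmfdStr N S) (e : Diffeomorph M.I P.toMfd.I M P.toMfd ∞)
    (he : ∀ x, P.val (e x) = f x) (p : M) : HasLocalRetraction M.I N.I f p := by
  obtain ⟨ρ, hρ⟩ := P.val_hasLocalRetraction (e p)
  rw [he] at hρ
  refine ⟨fun y => e.symm (ρ y), hρ.mono fun y hy => ⟨e.symm.contMDiff.contMDiffAt.comp y hy.1, ?_⟩⟩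
  rintro x rfl
  dsimp only
  rw [hy.2 (e x) (he x), e.symm_apply_apply]

/-- The quotient by the fibres of a surjective submersion is a quotient manifold, diffeomorphic to
the target. -/
theorem SurjSubmersion.exists_quotientStr {M N : Mfd.{u}} {f : M → N} (hf : SurjSubmersion f)
    (r : Setoid M) (hr : ∀ x y, r x y ↔ f x = f y) :
    ∃ (Q : QuotientStr M r) (e : Diffeomorph Q.toMfd.I N.I Q.toMfd N ∞),
      ∀ x, e (Q.proj x) = f x := by
  have hfs : ContMDiff M.I N.I ∞ f := hf.1.smooth
  let j : Quotient r → N := Quotient.lift f fun x y h => (hr x y).1 h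
  have hjq : j ∘ Quotient.mk r = f := rfl
  have hji : Function.Injective j := by
    rintro ⟨x⟩ ⟨y⟩ h
    exact Quotient.sound ((hr x y).2 h)
  have hjc : Continuous j := continuous_quot_lift _ hfs.continuous
  have hqo : IsOpenMap (Quotient.mk r) := by
    intro U hU
    have h1 : Quotient.mk r '' U = j ⁻¹' (f '' U) := by
      ext z
      constructor
      · rintro ⟨x, hx, rfl⟩
        exact ⟨x, hx, rfl⟩
      · rintro ⟨x, hx, h⟩
        exact ⟨x, hx, hji h⟩
    rw [h1]
    exact (hf.1.isOpenMap U hU).preimage hjc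
  obtain ⟨cs, hmf, hsub, himm⟩ := exists_isManifold_of_hasSlice (j := j) (q := Quotient.mk r)
    (d := Module.finrank ℝ N.E) hfs continuous_quotient_mk' hqo Quotient.mk_surjective hjc hji
    (hasSlice_of_constant_rank hfs fun p =>
      mrank_of_surjective ((hf.1.hasLocalSection p).surjective_mfderiv (hfs p)))
  have : T2Space (Quotient r) := T2Space.of_injective_continuous hji hjc
  have : SecondCountableTopology (Quotient r) :=
    TopologicalSpace.Quotient.secondCountableTopology hqo
  let Q : QuotientStr M r := { dim := Module.finrank ℝ N.E, isSubmersion_mk := hsub }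
  have hj : Function.Bijective j := ⟨hji, fun y => (hf.2 y).imp' (Quotient.mk r) fun _ h => h⟩
  let e := Equiv.ofBijective j hj
  refine ⟨Q, { toEquiv := e, contMDiff_toFun := himm.contMDiff, contMDiff_invFun := ?_ },
    fun _ => rfl⟩
  refine hf.smooth_of_comp (L := Q.toMfd) ?_
  have h1 : (fun x => e.symm (f x)) = Quotient.mk r := funext fun x => e.symm_apply_eq.2 rfl
  exact (congrArg (Smooth (M := M) (N := Q.toMfd)) h1).mpr Q.proj_smooth

end Mfd

open Mfd

/-! ### Calculus of smooth maps between bundled manifolds -/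

namespace Mfd

variable {L M N P : Mfd.{u}}

/-- Smoothness at a point. -/
def SmoothAt (f : M → N) (x : M) : Prop := ContMDiffAt M.I N.I ∞ f x

/-- Existence of a smooth local retraction near the value of `f` at a point. -/
def LocallyRetractable (f : M → N) (p : M) : Prop :=
  ∃ ρ : N → M, ∀ᶠ y in 𝓝 (f p), SmoothAt ρ y ∧ ∀ q, f q = y → ρ y = q

theorem Submersion.exists_section {f : M → N} (hf : Submersion f) (p : M) :
    ∃ σ : N → M, σ (f p) = p ∧ ∀ᶠ y in 𝓝 (f p), SmoothAt σ y ∧ f (σ y) = y :=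
  hf.hasLocalSection p

theorem submersion_of_sections {f : M → N} (hf : Smooth f) (h : ∀ p, ∃ σ : N → M, σ (f p) = p ∧
    ∀ᶠ y in 𝓝 (f p), SmoothAt σ y ∧ f (σ y) = y) : Submersion f :=
  submersion_of_hasLocalSection hf h

theorem SmoothAt.continuousAt {f : M → N} {x : M} (hf : SmoothAt f x) : ContinuousAt f x :=
  ContMDiffAt.continuousAt (I := M.I) (I' := N.I) hf

theorem SmoothAt.comp {f : M → N} {g : N → P} {x : M} (hg : SmoothAt g (f x))
    (hf : SmoothAt f x) : SmoothAt (M := M) (N := P) (fun x => g (f x)) x :=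
  ContMDiffAt.comp (I' := N.I) (g := g) x hg hf

theorem SmoothAt.prodMk {f : M → N} {g : M → P} {x : M} (hf : SmoothAt f x)
    (hg : SmoothAt g x) : SmoothAt (M := M) (N := N.prod P) (fun x => (f x, g x)) x :=
  ContMDiffAt.prodMk hf hg

theorem smooth_fst : Smooth (M := N.prod P) (N := N) fun p => p.1 := contMDiff_fst

theorem smooth_snd : Smooth (M := N.prod P) (N := P) fun p => p.2 := contMDiff_snd

theorem smooth_id : Smooth (M := M) (N := M) fun x => x := contMDiff_id

theorem smooth_const (c : N) : Smooth (M := M) (N := N) fun _ => c := contMDiff_const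

theorem Smooth.smoothAt {f : M → N} (hf : Smooth f) (x : M) : SmoothAt f x := hf x

theorem SmoothAt.fst {f : M → N.prod P} {x : M} (hf : SmoothAt f x) :
    SmoothAt (M := M) (N := N) (fun x => (f x).1) x :=
  (smooth_fst.smoothAt (f x)).comp hf

theorem SmoothAt.snd {f : M → N.prod P} {x : M} (hf : SmoothAt f x) :
    SmoothAt (M := M) (N := P) (fun x => (f x).2) x :=
  (smooth_snd.smoothAt (f x)).comp hf

theorem smoothAt_id (x : M) : SmoothAt (M := M) (N := M) (fun x => x) x := smooth_id x

theorem smoothAt_const (c : N) (x : M) : SmoothAt (M := M) (N := N) (fun _ => c) x :=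
  smooth_const c x

theorem Smooth.comp {f : M → N} {g : N → P} (hg : Smooth g) (hf : Smooth f) :
    Smooth (M := M) (N := P) fun x => g (f x) :=
  fun x => (hg.smoothAt _).comp (hf.smoothAt x)

theorem Smooth.prodMk {f : M → N} {g : M → P} (hf : Smooth f) (hg : Smooth g) :
    Smooth (M := M) (N := N.prod P) fun x => (f x, g x) :=
  fun x => (hf.smoothAt x).prodMk (hg.smoothAt x)

theorem Smooth.continuous {f : M → N} (hf : Smooth f) : Continuous f :=
  ContMDiff.continuous (I := M.I) (I' := N.I) hf

end Mfd

namespace LieGrp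

variable {G : LieGrp.{u}} {M : Mfd.{u}}

theorem smoothAt_mul {f g : M → G} {x : M} (hf : SmoothAt (N := G.toMfd) f x)
    (hg : SmoothAt (N := G.toMfd) g x) : SmoothAt (N := G.toMfd) (fun x => f x * g x) x :=
  ContMDiffAt.mul hf hg

theorem smoothAt_inv {f : M → G} {x : M} (hf : SmoothAt (N := G.toMfd) f x) :
    SmoothAt (N := G.toMfd) (fun x => (f x)⁻¹) x :=
  ContMDiffAt.inv hf

end LieGrp

/-! ### Weak equivalences expressed by sections and retractions -/

namespace LieAction

variable {G : LieGrp.{u}} {X M : Mfd.{u}} (a : LieAction G X)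

theorem smoothAt_act {f : M → G} {g : M → X} {x : M} (hf : SmoothAt (N := G.toMfd) f x)
    (hg : SmoothAt g x) : SmoothAt (M := M) (N := X) (fun x => a.act (f x) (g x)) x :=
  SmoothAt.comp (N := G.toMfd.prod X) (g := fun p : G.toMfd.prod X => a.act p.1 p.2)
    (a.act_smooth _) (hf.prodMk hg)

theorem inv_act_act (g : G) (x : X) : a.act g⁻¹ (a.act g x) = x := by
  rw [← a.mul_act, inv_mul_cancel, a.one_act]

theorem act_inv_act (g : G) (x : X) : a.act g (a.act g⁻¹ x) = x := by
  rw [← a.mul_act, mul_inv_cancel, a.one_act]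

/-- For a map `f : M → X`, the map `(m, g) ↦ g⁻¹ f(m)`. -/
def translate (f : M → X) (p : M.prod G.toMfd) : X := a.act (p.2 : G)⁻¹ (f p.1)

theorem translate_smooth {f : M → X} (hf : Smooth f) : Smooth (a.translate f) := fun p =>
  a.smoothAt_act (LieGrp.smoothAt_inv (smooth_snd.smoothAt p))
    ((hf.smoothAt _).comp (smooth_fst.smoothAt p))

/-- The fibred product of `f : M → X` with the target map of the action groupoid. -/
def targetFibre (f : M → X) : Set (M.prod (G.toMfd.prod X)) := {p | f p.1 = a.act p.2.1 p.2.2}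

/-- The fibred product consists of the triples `(m, g, g⁻¹ f(m))`. It is a graph over `M × G`, hence
a submanifold diffeomorphic to `M × G`, and the source map becomes `translate`. Essential
surjectivity is thereby a condition on a map between given manifolds. -/
theorem exists_surjSubmersion_targetFibre_iff {f : M → X} (hf : Smooth f) :
    (∃ P : SubmfdStr (M.prod (G.toMfd.prod X)) (a.targetFibre f),
      SurjSubmersion (M := P.toMfd) (N := X) fun p => (P.val p).2.2) ↔
      SurjSubmersion (a.translate f) := by
  let k : M.prod G.toMfd → M.prod (G.toMfd.prod X) := fun p => (p.1, (p.2, a.translate f p))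
  have hk : Smooth k := smooth_fst.prodMk (smooth_snd.prodMk (a.translate_smooth hf))
  have hr : ∀ p, HasLocalRetraction (M.prod G.toMfd).I (M.prod (G.toMfd.prod X)).I k p := by
    intro p
    refine ⟨fun z => (z.1, z.2.1), Eventually.of_forall fun z => ⟨?_, ?_⟩⟩
    · exact (smoothAt_id z).fst.prodMk (smoothAt_id z).snd.fst
    · rintro q rfl
      rfl
  let q : M.prod G.toMfd → a.targetFibre f := fun p => ⟨k p, (a.act_inv_act p.2 (f p.1)).symm⟩
  have hqs : Function.Surjective q := by
    rintro ⟨⟨x, g, y⟩, hxy⟩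
    have hxy : f x = a.act g y := hxy
    refine ⟨(x, g), Subtype.ext ?_⟩
    change (x, (g, a.act g⁻¹ (f x))) = (x, (g, y))
    rw [hxy, a.inv_act_act]
  have key : ∀ P : SubmfdStr (M.prod (G.toMfd.prod X)) (a.targetFibre f),
      SurjSubmersion (M := P.toMfd) (N := X) (fun p => (P.val p).2.2) ↔
        SurjSubmersion (a.translate f) := by
    intro P
    obtain ⟨e, he⟩ := P.exists_diffeomorph hk hr q (fun _ => rfl) hqs
    have hcomp : ∀ p, (P.val (e p)).2.2 = a.translate f p := fun p => by rw [he]; rfl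
    have hcomp' : ∀ z, a.translate f (e.symm z) = (P.val z).2.2 := fun z => by
      rw [← hcomp, e.apply_symm_apply]
    constructor
    · rintro ⟨h1, h2⟩
      refine ⟨submersion_of_sections (a.translate_smooth hf) fun p => ?_, fun y => ?_⟩
      · obtain ⟨σ, hσ, h⟩ := h1.exists_section (e p)
        rw [hcomp] at hσ h
        refine ⟨fun y => e.symm (σ y), ?_, h.mono fun y hy => ⟨?_, ?_⟩⟩
        · dsimp only
          rw [hσ, e.symm_apply_apply]
        · exact e.symm.contMDiff.contMDiffAt.comp y hy.1
        · dsimp only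
          rw [hcomp']
          exact hy.2
      · obtain ⟨z, hz⟩ := h2 y
        exact ⟨e.symm z, (hcomp' z).trans hz⟩
    · rintro ⟨h1, h2⟩
      have hsm : Smooth (M := P.toMfd) (N := X) fun p => (P.val p).2.2 := fun z =>
        (P.val_smooth.smoothAt z).snd.snd
      refine ⟨submersion_of_sections hsm fun z => ?_, fun y => ?_⟩
      · obtain ⟨σ, hσ, h⟩ := h1.exists_section (e.symm z)
        rw [hcomp'] at hσ h
        refine ⟨fun y => e (σ y), ?_, h.mono fun y hy => ⟨?_, ?_⟩⟩
        · dsimp only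
          rw [hσ, e.apply_symm_apply]
        · exact e.contMDiff.contMDiffAt.comp y hy.1
        · dsimp only
          rw [hcomp]
          exact hy.2
      · obtain ⟨p, hp⟩ := h2 y
        exact ⟨e p, (hcomp p).trans hp⟩
  constructor
  · rintro ⟨P, hP⟩
    exact (key P).1 hP
  · intro h
    obtain ⟨P⟩ := exists_submfdStr_of_hasLocalRetraction hk hr q (fun _ => rfl) hqs
    exact ⟨P, (key P).2 h⟩

end LieAction

namespace LieFunctor

variable {𝒢 ℋ 𝒦 : LieGroupoid.{u}}

/-- The composition `ψ ∘ φ` of smooth functors. -/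
def comp (ψ : LieFunctor ℋ 𝒦) (φ : LieFunctor 𝒢 ℋ) : LieFunctor 𝒢 𝒦 where
  obj x := ψ.obj (φ.obj x)
  arr g := ψ.arr (φ.arr g)
  obj_smooth := ψ.obj_smooth.comp φ.obj_smooth
  arr_smooth := ψ.arr_smooth.comp φ.arr_smooth
  src_arr g := by rw [ψ.src_arr, φ.src_arr]
  tgt_arr g := by rw [ψ.tgt_arr, φ.tgt_arr]
  arr_unit x := by rw [φ.arr_unit, ψ.arr_unit]
  arr_comp g h hgh := by
    rw [φ.arr_comp g h hgh, ψ.arr_comp _ _ (by rw [φ.src_arr, φ.tgt_arr, hgh])]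

/-- The map `g ↦ ((s(g), t(g)), φ(g))` to the ambient manifold. -/
def graph (φ : LieFunctor 𝒢 ℋ) (g : 𝒢.Arr) : (𝒢.Obj.prod 𝒢.Obj).prod ℋ.Arr :=
  ((𝒢.src g, 𝒢.tgt g), φ.arr g)

theorem graph_smooth (φ : LieFunctor 𝒢 ℋ) : Smooth φ.graph :=
  (𝒢.src_submersion.smooth.prodMk 𝒢.tgt_submersion.smooth).prodMk φ.arr_smooth

/-- A map is a diffeomorphism onto a submanifold exactly when it has local retractions, so the
existential over submanifold structures disappears. -/
theorem smoothFullyFaithful_iff (φ : LieFunctor 𝒢 ℋ) : φ.SmoothFullyFaithful ↔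
    Function.Surjective φ.fullMap ∧ ∀ g, LocallyRetractable φ.graph g := by
  constructor
  · rintro ⟨P, e, he⟩
    exact ⟨fun z => ⟨e.symm z, by rw [← he]; exact e.apply_symm_apply z⟩,
      P.hasLocalRetraction_of_diffeomorph e fun g => congrArg Subtype.val (he g)⟩
  · rintro ⟨h1, h2⟩
    obtain ⟨P⟩ := exists_submfdStr_of_hasLocalRetraction φ.graph_smooth h2 φ.fullMap
      (fun _ => rfl) h1
    exact ⟨P, P.exists_diffeomorph φ.graph_smooth h2 φ.fullMap (fun _ => rfl) h1⟩

/-- Retractions are chained: from the `φ`-images of the endpoints and the final image, `ψ` recovers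
the intermediate arrow; from it and the endpoints, `φ` recovers the arrow. -/
theorem SmoothFullyFaithful.comp {ψ : LieFunctor ℋ 𝒦} {φ : LieFunctor 𝒢 ℋ}
    (hψ : ψ.SmoothFullyFaithful) (hφ : φ.SmoothFullyFaithful) :
    (ψ.comp φ).SmoothFullyFaithful := by
  obtain ⟨h1, h2⟩ := ψ.smoothFullyFaithful_iff.1 hψ
  obtain ⟨h3, h4⟩ := φ.smoothFullyFaithful_iff.1 hφ
  refine (ψ.comp φ).smoothFullyFaithful_iff.2 ⟨?_, ?_⟩
  · rintro ⟨⟨⟨x₁, x₂⟩, k⟩, hk⟩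
    obtain ⟨h, hh⟩ := h1 ⟨((φ.obj x₁, φ.obj x₂), k), hk⟩
    have hh' : ((ℋ.src h, ℋ.tgt h), ψ.arr h) = ((φ.obj x₁, φ.obj x₂), k) :=
      congrArg Subtype.val hh
    simp only [Prod.mk.injEq] at hh'
    obtain ⟨⟨e1, e2⟩, e3⟩ := hh'
    obtain ⟨g, hg⟩ := h3 ⟨((x₁, x₂), h), Prod.ext e1.symm e2.symm⟩
    have hg' : ((𝒢.src g, 𝒢.tgt g), φ.arr g) = ((x₁, x₂), h) := congrArg Subtype.val hg
    simp only [Prod.mk.injEq] at hg'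
    obtain ⟨⟨e4, e5⟩, e6⟩ := hg'
    refine ⟨g, Subtype.ext ?_⟩
    change ((𝒢.src g, 𝒢.tgt g), ψ.arr (φ.arr g)) = ((x₁, x₂), k)
    rw [e4, e5, e6, e3]
  · intro g
    obtain ⟨ρ, hρ⟩ := h2 (φ.arr g)
    obtain ⟨τ, hτ⟩ := h4 g
    let m : (𝒢.Obj.prod 𝒢.Obj).prod 𝒦.Arr → (ℋ.Obj.prod ℋ.Obj).prod 𝒦.Arr :=
      fun z => ((φ.obj z.1.1, φ.obj z.1.2), z.2)
    have hm : Smooth m := fun z =>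
      (((φ.obj_smooth.smoothAt _).comp (smoothAt_id z).fst.fst).prodMk
        ((φ.obj_smooth.smoothAt _).comp (smoothAt_id z).fst.snd)).prodMk (smoothAt_id z).snd
    have hmg : ∀ g, m ((ψ.comp φ).graph g) = ψ.graph (φ.arr g) := fun g => by
      change ((φ.obj (𝒢.src g), φ.obj (𝒢.tgt g)), ψ.arr (φ.arr g)) =
        ((ℋ.src (φ.arr g), ℋ.tgt (φ.arr g)), ψ.arr (φ.arr g))
      rw [φ.src_arr, φ.tgt_arr]
    set z₀ := (ψ.comp φ).graph g with hz₀
    have hmc : Tendsto m (𝓝 z₀) (𝓝 (ψ.graph (φ.arr g))) := by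
      rw [← hmg]; exact hm.continuous.tendsto z₀
    let n : (𝒢.Obj.prod 𝒢.Obj).prod 𝒦.Arr → (𝒢.Obj.prod 𝒢.Obj).prod ℋ.Arr :=
      fun z => (z.1, ρ (m z))
    have hn : ∀ᶠ z in 𝓝 z₀, SmoothAt n z := by
      filter_upwards [hmc.eventually hρ] with z hz
      exact (smoothAt_id z).fst.prodMk (SmoothAt.comp (f := m) hz.1 (hm.smoothAt z))
    have hng : n z₀ = φ.graph g := by
      change (z₀.1, ρ (m z₀)) = φ.graph g
      rw [hz₀, hmg, hρ.self_of_nhds.2 (φ.arr g) rfl]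
      rfl
    have hnc : Tendsto n (𝓝 z₀) (𝓝 (φ.graph g)) := by
      rw [← hng]; exact hn.self_of_nhds.continuousAt
    refine ⟨fun z => τ (n z), ?_⟩
    filter_upwards [hn, hnc.eventually hτ, hmc.eventually hρ] with z hz1 hz2 hz3
    refine ⟨SmoothAt.comp (f := n) hz2.1 hz1, ?_⟩
    rintro g' rfl
    refine hz2.2 g' ?_
    change φ.graph g' = (((ψ.comp φ).graph g').1, ρ (m _))
    rw [hz3.2 (φ.arr g') (hmg g').symm]
    rfl

theorem smoothEssSurj_iff {H : LieGrp.{u}} {Y : Mfd.{u}} {b : LieAction H Y}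
    (φ : LieFunctor 𝒢 b.groupoid) :
    φ.SmoothEssSurj ↔ SurjSubmersion (b.translate (M := 𝒢.Obj) φ.obj) :=
  b.exists_surjSubmersion_targetFibre_iff (M := 𝒢.Obj) (f := φ.obj) φ.obj_smooth

end LieFunctor

namespace EquivariantFunctor

variable {G H K : LieGrp.{u}} {X Y Z : Mfd.{u}} {a : LieAction G X} {b : LieAction H Y}
  {c : LieAction K Z}

/-- The map sending an arrow to its source, its target and its image. -/
def graph (φ : EquivariantFunctor a b) (p : G.toMfd.prod X) :
    (X.prod X).prod (H.toMfd.prod Y) :=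
  ((p.2, a.act p.1 p.2), (φ.hom p.1, φ.obj p.2))

/-- The working form of the definition: essential surjectivity, fullness on arrows, and smooth
recovery of an arrow from its endpoints and its image. The last condition contains faithfulness. -/
theorem isWeakEquivalence_iff (φ : EquivariantFunctor a b) : φ.toFunctor.IsWeakEquivalence ↔
    SurjSubmersion (b.translate φ.obj) ∧
    (∀ x₁ x₂ h, b.act h (φ.obj x₁) = φ.obj x₂ → ∃ g, φ.hom g = h ∧ a.act g x₁ = x₂) ∧
    ∀ p, LocallyRetractable φ.graph p := by
  have hsurj : Function.Surjective φ.toFunctor.fullMap ↔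
      ∀ x₁ x₂ h, b.act h (φ.obj x₁) = φ.obj x₂ → ∃ g, φ.hom g = h ∧ a.act g x₁ = x₂ := by
    constructor
    · intro hs x₁ x₂ h hx
      obtain ⟨⟨g, x⟩, hg⟩ := hs ⟨((x₁, x₂), (h, φ.obj x₁)), Prod.ext rfl hx.symm⟩
      have h0 : (((x, a.act g x), (φ.hom g, φ.obj x)) : (X × X) × (H × Y)) =
          ((x₁, x₂), (h, φ.obj x₁)) := congrArg Subtype.val hg
      simp only [Prod.mk.injEq] at h0
      obtain ⟨⟨rfl, h2⟩, h3, -⟩ := h0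
      exact ⟨g, h3, h2⟩
    · rintro hs ⟨⟨⟨x₁, x₂⟩, h, y⟩, hxy⟩
      have h1 : φ.obj x₁ = y := congrArg Prod.fst hxy
      have h2 : φ.obj x₂ = b.act h y := congrArg Prod.snd hxy
      subst h1
      obtain ⟨g, rfl, rfl⟩ := hs x₁ x₂ h h2.symm
      exact ⟨(g, x₁), rfl⟩
  rw [← hsurj]
  constructor
  · rintro ⟨h1, h2⟩
    exact ⟨φ.toFunctor.smoothEssSurj_iff.1 h1, φ.toFunctor.smoothFullyFaithful_iff.1 h2⟩
  · rintro ⟨h1, h2⟩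
    exact ⟨φ.toFunctor.smoothEssSurj_iff.2 h1, φ.toFunctor.smoothFullyFaithful_iff.2 h2⟩

/-- The identity `(ψ(h) k)⁻¹ ψ(y) = k⁻¹ ψ(h⁻¹ y)` lets preimages and sections of the two translation
maps be composed. -/
theorem surjSubmersion_translate_comp {M : Mfd.{u}} {f : M → Y} (hfs : Smooth f)
    (hf : SurjSubmersion (b.translate f)) (ψ : EquivariantFunctor b c)
    (hψ : SurjSubmersion (c.translate ψ.obj)) :
    SurjSubmersion (c.translate fun x => ψ.obj (f x)) := by
  have hact : ∀ (h : H) (k : K) (y : Y),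
      c.act (ψ.hom h * k)⁻¹ (ψ.obj y) = c.act k⁻¹ (ψ.obj (b.act h⁻¹ y)) := fun h k y => by
    rw [ψ.map_act, ← c.mul_act, map_inv, mul_inv_rev]
  refine ⟨submersion_of_sections (c.translate_smooth (ψ.obj_smooth.comp hfs)) ?_, ?_⟩
  · rintro ⟨x, k⟩
    obtain ⟨σ, hσ, hσ'⟩ := hψ.1.exists_section (f x, k)
    -- Basing `τ` at the unit makes the composed section pass through `(x, ψ(1) k) = (x, k)`.
    obtain ⟨τ, hτ, hτ'⟩ := hf.1.exists_section (x, (1 : H))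
    have h1 : b.translate f (x, (1 : H)) = f x := by
      change b.act (1 : H)⁻¹ (f x) = f x
      rw [inv_one, b.one_act]
    rw [h1] at hτ hτ'
    change ∃ σ' : Z → M.prod K.toMfd, σ' (c.translate ψ.obj (f x, k)) = (x, k) ∧
      ∀ᶠ z in 𝓝 (c.translate ψ.obj (f x, k)), _
    set z₀ := c.translate ψ.obj (f x, k)
    refine ⟨fun z => ((τ (σ z).1).1, (ψ.hom (τ (σ z).1).2 * (σ z).2 : K)), ?_, ?_⟩
    · dsimp only
      rw [hσ]
      dsimp only
      rw [hτ]
      dsimp only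
      rw [map_one, one_mul]
    · have hc' : Tendsto (fun z => (σ z).1) (𝓝 z₀) (𝓝 (f x)) := by
        have : ContinuousAt (fun z => (σ z).1) z₀ := hσ'.self_of_nhds.1.fst.continuousAt
        have := this.tendsto
        rwa [hσ] at this
      filter_upwards [hσ', hc'.eventually hτ'] with z hz1 hz2
      have s3 : SmoothAt (M := Z) (N := M.prod H.toMfd) (fun z => τ (σ z).1) z :=
        SmoothAt.comp (g := τ) hz2.1 hz1.1.fst
      refine ⟨s3.fst.prodMk (P := K.toMfd) (LieGrp.smoothAt_mul
        ((ψ.hom_smooth.smoothAt _).comp s3.snd) hz1.1.snd), ?_⟩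
      have e1 : c.act (σ z).2⁻¹ (ψ.obj (σ z).1) = z := hz1.2
      have e2 : b.act (τ (σ z).1).2⁻¹ (f (τ (σ z).1).1) = (σ z).1 := hz2.2
      change c.act (ψ.hom (τ (σ z).1).2 * (σ z).2)⁻¹ (ψ.obj (f (τ (σ z).1).1)) = z
      rw [hact, e2, e1]
  · intro z
    obtain ⟨⟨y, k⟩, rfl⟩ := hψ.2 z
    obtain ⟨⟨x, h⟩, rfl⟩ := hf.2 y
    exact ⟨(x, (ψ.hom h * k : K)), hact h k (f x)⟩

end EquivariantFunctor

/-- The composition of a weak equivalence to an action groupoid with an equivariant weak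
equivalence. -/
theorem LieFunctor.IsWeakEquivalence.comp {𝒢 : LieGroupoid.{u}} {H K : LieGrp.{u}}
    {Y Z : Mfd.{u}} {b : LieAction H Y} {c : LieAction K Z} {ψ : EquivariantFunctor b c}
    (hψ : ψ.toFunctor.IsWeakEquivalence) {φ : LieFunctor 𝒢 b.groupoid} (hφ : φ.IsWeakEquivalence) :
    (ψ.toFunctor.comp φ).IsWeakEquivalence :=
  ⟨(ψ.toFunctor.comp φ).smoothEssSurj_iff.2 (ψ.surjSubmersion_translate_comp (M := 𝒢.Obj)
    φ.obj_smooth (φ.smoothEssSurj_iff.1 hφ.essSurj) (ψ.toFunctor.smoothEssSurj_iff.1 hψ.essSurj)),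
    hψ.fullyFaithful.comp hφ.fullyFaithful⟩

namespace EquivariantFunctor

variable {G H K : LieGrp.{u}} {X Y Z : Mfd.{u}} {a : LieAction G X} {b : LieAction H Y}
  {c : LieAction K Z}

theorem IsIso.isWeakEquivalence {χ : EquivariantFunctor a b} (hχ : χ.IsIso) :
    χ.toFunctor.IsWeakEquivalence := by
  obtain ⟨θ, h1, h2⟩ := hχ
  have e1 : ∀ x, θ.obj (χ.obj x) = x := fun x => congrFun (congrArg EquivariantFunctor.obj h1) x
  have e2 : ∀ y, χ.obj (θ.obj y) = y := fun y => congrFun (congrArg EquivariantFunctor.obj h2) y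
  have e3 : ∀ h, χ.hom (θ.hom h) = h := fun h =>
    DFunLike.congr_fun (congrArg EquivariantFunctor.hom h2) h
  have e4 : ∀ g, θ.hom (χ.hom g) = g := fun g =>
    DFunLike.congr_fun (congrArg EquivariantFunctor.hom h1) g
  refine χ.isWeakEquivalence_iff.2 ⟨⟨submersion_of_sections
    (b.translate_smooth χ.obj_smooth) ?_, ?_⟩, ?_, ?_⟩
  · rintro ⟨x, h⟩
    refine ⟨fun y => (θ.obj (b.act h y), h), ?_, Eventually.of_forall fun y => ⟨?_, ?_⟩⟩
    · change (θ.obj (b.act h (b.act h⁻¹ (χ.obj x))), h) = (x, h)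
      rw [b.act_inv_act, e1]
    · exact ((θ.obj_smooth.smoothAt _).comp
        (b.smoothAt_act (smoothAt_const h y) (smoothAt_id y))).prodMk (smoothAt_const h y)
    · change b.act h⁻¹ (χ.obj (θ.obj (b.act h y))) = y
      rw [e2, b.inv_act_act]
  · intro y
    refine ⟨(θ.obj y, (1 : H)), ?_⟩
    change b.act (1 : H)⁻¹ (χ.obj (θ.obj y)) = y
    rw [e2, inv_one, b.one_act]
  · intro x₁ x₂ h hx
    refine ⟨θ.hom h, e3 h, ?_⟩
    have := congrArg θ.obj hx
    rwa [θ.map_act, e1, e1] at this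
  · intro p
    refine ⟨fun z => (θ.hom z.2.1, z.1.1), Eventually.of_forall fun z => ⟨?_, ?_⟩⟩
    · exact ((θ.hom_smooth.smoothAt _).comp (smoothAt_id z).snd.fst).prodMk
        (smoothAt_id z).fst.fst
    · rintro q rfl
      exact Prod.ext (e4 _) rfl

end EquivariantFunctor

/-! ### Constant rank and openness onto the image -/

namespace Mfd

variable {M N : Mfd.{u}}

theorem SmoothAt.hasMFDerivAt {f : M → N} {x : M} (hf : SmoothAt f x) :
    HasMFDerivAt M.I N.I f x (mfderiv M.I N.I f x) :=
  (ContMDiffAt.mdifferentiableAt (I := M.I) (I' := N.I) (n := ∞) hf (by simp)).hasMFDerivAt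

/-- The rank is invariant under diffeomorphisms intertwining the map with itself. -/
theorem mrank_eq_of_intertwines {f : M → N} (hf : Smooth f) {α α' : M → M} {β β' : N → N}
    (hα : Smooth α) (hα' : Smooth α') (hβ : Smooth β) (hβ' : Smooth β')
    (h₁ : Function.LeftInverse α' α) (h₂ : Function.RightInverse α' α)
    (h₃ : Function.LeftInverse β' β) (h : ∀ x, f (α x) = β (f x)) (p : M) :
    mrank M.I N.I f (α p) = mrank M.I N.I f p := by
  have dα := (hα.smoothAt p).hasMFDerivAt
  have dβ := (hβ.smoothAt (f p)).hasMFDerivAt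
  have e1 := (hf.smoothAt (α p)).hasMFDerivAt.comp p dα
  have e2 := (dβ.comp p (hf.smoothAt p).hasMFDerivAt).congr_of_eventuallyEq
    (f₁ := f ∘ α) (Eventually.of_forall h)
  have e3 := hasMFDerivAt_unique e1 e2
  have sα : Function.Surjective (mfderiv M.I M.I α p) :=
    mfderiv_surjective_of_rightInverse dα.mdifferentiableAt
      (hα'.smoothAt (α p)).hasMFDerivAt.mdifferentiableAt (h₁ p) (Eventually.of_forall h₂)
  have iβ : Function.Injective (mfderiv N.I N.I β (f p)) :=
    mfderiv_injective_of_leftInverse dβ.mdifferentiableAt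
      (hβ'.smoothAt (β (f p))).hasMFDerivAt.mdifferentiableAt (Eventually.of_forall h₃)
  let A : M.E →L[ℝ] M.E := mfderiv M.I M.I α p
  let B : N.E →L[ℝ] N.E := mfderiv N.I N.I β (f p)
  let F₁ : M.E →L[ℝ] N.E := mfderiv M.I N.I f (α p)
  let F₂ : M.E →L[ℝ] N.E := mfderiv M.I N.I f p
  have e4 : (LinearMap.id ∘ₗ (F₁ : M.E →ₗ[ℝ] N.E) ∘ₗ (A : M.E →ₗ[ℝ] M.E)) =
      (B : N.E →ₗ[ℝ] N.E) ∘ₗ (F₂ : M.E →ₗ[ℝ] N.E) ∘ₗ LinearMap.id :=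
    congrArg (fun T : M.E →L[ℝ] N.E => (T : M.E →ₗ[ℝ] N.E)) e3
  have r1 := finrank_range_comp_of_injective_of_surjective (LinearMap.id : N.E →ₗ[ℝ] N.E)
    (F₁ : M.E →ₗ[ℝ] N.E) (A : M.E →ₗ[ℝ] M.E) Function.injective_id sα
  have r2 := finrank_range_comp_of_injective_of_surjective (B : N.E →ₗ[ℝ] N.E)
    (F₂ : M.E →ₗ[ℝ] N.E) (LinearMap.id : M.E →ₗ[ℝ] M.E) iβ Function.surjective_id
  rw [e4] at r1
  exact r1.symm.trans r2

end Mfd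

namespace LieGrp

variable {G H : LieGrp.{u}}

theorem isTopologicalGroup (G : LieGrp.{u}) : IsTopologicalGroup G :=
  topologicalGroup_of_lieGroup G.I ∞

theorem mul_left_smooth (g : G) : Smooth (M := G.toMfd) (N := G.toMfd) fun x => g * x := fun x =>
  smoothAt_mul (smoothAt_const g x) (smoothAt_id x)

/-- Homomorphisms of Lie groups have constant rank. -/
theorem mrank_hom {f : G →* H} (hf : Smooth (M := G.toMfd) (N := H.toMfd) f) (g : G) :
    mrank G.I H.I f g = mrank G.I H.I f 1 := by
  -- Left translation by `g` carries `1` to `g` and covers left translation by `f g`.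
  have h := mrank_eq_of_intertwines hf (mul_left_smooth g) (mul_left_smooth g⁻¹)
    (mul_left_smooth (f g)) (mul_left_smooth (f g)⁻¹) (fun x => inv_mul_cancel_left g x)
    (fun x => mul_inv_cancel_left g x) (fun x => inv_mul_cancel_left (f g) x)
    (fun x => map_mul f g x) (1 : G)
  simpa only [mul_one] using h

/-- A proper homomorphism is open onto its range. -/
theorem isOpenMap_rangeRestrict {f : G →* H} (hf : IsProperMap f) :
    IsOpenMap f.rangeRestrict := by
  have := G.isTopologicalGroup
  have := H.isTopologicalGroup
  have hc : Continuous f.rangeRestrict := hf.continuous.subtype_mk _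
  have hcl : IsClosedMap f.rangeRestrict := by
    intro C hC
    have h1 : f.rangeRestrict '' C = Subtype.val ⁻¹' (f '' C) := by
      ext z
      constructor
      · rintro ⟨x, hx, rfl⟩
        exact ⟨x, hx, rfl⟩
      · rintro ⟨x, hx, h⟩
        exact ⟨x, hx, Subtype.ext h⟩
    rw [h1]
    exact (hf.isClosedMap C hC).preimage continuous_subtype_val
  -- A closed continuous surjection is a quotient map, and a quotient homomorphism of topological
  -- groups is open.
  exact (MonoidHom.isOpenQuotientMap_of_isQuotientMap
    (hcl.isQuotientMap hc f.rangeRestrict_surjective)).isOpenMap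

end LieGrp

namespace EquivariantFunctor

variable {G H : LieGrp.{u}} {X Y : Mfd.{u}} {a : LieAction G X} {b : LieAction H Y}

/-- Near a point `x`, every point `x'` is of the form `g r`, where `r` and the image of `g` are
smooth functions of the image of `x'`. -/
theorem exists_local_factorization {φ : EquivariantFunctor a b}
    (hφ : φ.toFunctor.IsWeakEquivalence) (x : X) :
    ∃ (k : X → G) (r : Y → X) (h : Y → H), k x = 1 ∧ r (φ.obj x) = x ∧
      SmoothAt (N := G.toMfd) k x ∧ SmoothAt r (φ.obj x) ∧
      SmoothAt (N := H.toMfd) h (φ.obj x) ∧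
      (∀ᶠ x' in 𝓝 x, φ.hom (k x') = h (φ.obj x') ∧ a.act (k x') (r (φ.obj x')) = x') := by
  obtain ⟨h1, h2, h3⟩ := φ.isWeakEquivalence_iff.1 hφ
  obtain ⟨σ, hσ, hσ'⟩ := h1.1.exists_section (x, (1 : H))
  have hx1 : b.translate φ.obj (x, (1 : H)) = φ.obj x := by
    change b.act (1 : H)⁻¹ (φ.obj x) = φ.obj x
    rw [inv_one, b.one_act]
  rw [hx1] at hσ hσ'
  obtain ⟨ρ, hρ⟩ := h3 ((1 : G), x)
  -- The section gives a point `r` and an element `h`, smooth in `φ(x')`, with `h φ(r) = φ(x')`. By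
  -- fullness `m x'` is the graph of an arrow from `r` to `x'` over `h`; the retraction extracts
  -- that arrow smoothly.
  let m : X → (X.prod X).prod (H.toMfd.prod Y) := fun x' =>
    (((σ (φ.obj x')).1, x'), (((σ (φ.obj x')).2 : H)⁻¹, φ.obj (σ (φ.obj x')).1))
  have hmx : m x = φ.graph ((1 : G), x) := by
    change (((σ (φ.obj x)).1, x), (((σ (φ.obj x)).2 : H)⁻¹, φ.obj (σ (φ.obj x)).1)) =
      ((x, a.act 1 x), (φ.hom 1, φ.obj x))
    rw [hσ, a.one_act, map_one]
    dsimp only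
    rw [inv_one]
  have hσφ : SmoothAt (M := X) (N := X.prod H.toMfd) (fun x' => σ (φ.obj x')) x :=
    SmoothAt.comp (g := σ) hσ'.self_of_nhds.1 (φ.obj_smooth.smoothAt x)
  have hm : SmoothAt m x :=
    (hσφ.fst.prodMk (smoothAt_id x)).prodMk (P := H.toMfd.prod Y)
      ((LieGrp.smoothAt_inv hσφ.snd).prodMk (N := H.toMfd)
        ((φ.obj_smooth.smoothAt _).comp hσφ.fst))
  have hρ' := hρ
  rw [← hmx] at hρ
  have hmc : Tendsto m (𝓝 x) (𝓝 (m x)) := hm.continuousAt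
  refine ⟨fun x' => (ρ (m x')).1, fun y => (σ y).1, fun y => ((σ y).2 : H)⁻¹, ?_, ?_,
    (SmoothAt.comp (f := m) (g := ρ) hρ.self_of_nhds.1 hm).fst, hσ'.self_of_nhds.1.fst,
    LieGrp.smoothAt_inv hσ'.self_of_nhds.1.snd, ?_⟩
  · dsimp only
    rw [hρ.self_of_nhds.2 ((1 : G), x) hmx.symm]
  · dsimp only
    rw [hσ]
  · have hφc : Tendsto φ.obj (𝓝 x) (𝓝 (φ.obj x)) := φ.obj_smooth.continuous.tendsto x
    filter_upwards [hmc.eventually hρ, hφc.eventually hσ'] with x' hx1 hx2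
    have e1 : b.act ((σ (φ.obj x')).2 : H)⁻¹ (φ.obj (σ (φ.obj x')).1) = φ.obj x' := hx2.2
    obtain ⟨g, hg1, hg2⟩ := h2 _ _ _ e1
    have e2 : φ.graph (g, (σ (φ.obj x')).1) = m x' := by
      change (((σ (φ.obj x')).1, a.act g (σ (φ.obj x')).1),
        (φ.hom g, φ.obj (σ (φ.obj x')).1)) = m x'
      rw [hg1, hg2]
    rw [hx1.2 _ e2]
    exact ⟨hg1, hg2⟩

/-- The map of spaces underlying a weak equivalence has constant rank. -/
theorem mrank_obj_add {φ : EquivariantFunctor a b} (hφ : φ.toFunctor.IsWeakEquivalence) (x : X) :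
    mrank X.I Y.I φ.obj x + Module.finrank ℝ G.E
      = Module.finrank ℝ X.E + mrank G.I H.I φ.hom 1 := by
  -- `A` is the infinitesimal action at `x`. The three claims `key1`, `key2` and `key3` say that `A`
  -- restricts to a bijection from the kernel of `D` to that of `F`; rank-nullity for both maps then
  -- gives the formula.
  let F : X.E →L[ℝ] Y.E := mfderiv X.I Y.I φ.obj x
  let D : G.E →L[ℝ] H.E := mfderiv G.I H.I φ.hom 1
  let Λ : G.E × X.E →L[ℝ] X.E := mfderiv (G.I.prod X.I) X.I (fun p : G × X => a.act p.1 p.2) (1, x)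
  let A : G.E →L[ℝ] X.E := Λ.comp (ContinuousLinearMap.inl ℝ G.E X.E)
  have hF : HasMFDerivAt X.I Y.I φ.obj x F := (φ.obj_smooth.smoothAt x).hasMFDerivAt
  have hD : HasMFDerivAt G.I H.I φ.hom (1 : G) D := (φ.hom_smooth.smoothAt 1).hasMFDerivAt
  have hΛ : HasMFDerivAt (G.I.prod X.I) X.I (fun p : G × X => a.act p.1 p.2) ((1 : G), x) Λ :=
    SmoothAt.hasMFDerivAt (M := G.toMfd.prod X) (N := X) (a.act_smooth ((1 : G), x))
  have hA : HasMFDerivAt G.I X.I (fun g : G => a.act g x) (1 : G) A := by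
    have h1 : HasMFDerivAt G.I (G.I.prod X.I) (fun g : G => (g, x)) (1 : G)
        (ContinuousLinearMap.inl ℝ G.E X.E) :=
      (hasMFDerivAt_id (1 : G)).prodMk (hasMFDerivAt_const x (1 : G))
    exact HasMFDerivAt.comp (g := fun p : G × X => a.act p.1 p.2) (1 : G) hΛ h1
  have hF' : HasMFDerivAt X.I Y.I φ.obj (a.act 1 x) F := by rw [a.one_act]; exact hF
  obtain ⟨-, -, h3⟩ := φ.isWeakEquivalence_iff.1 hφ
  -- Differentiate `φ(g x) = φ(g) φ(x)` at `g = 1`.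
  have key1 : ∀ γ, D γ = 0 → F (A γ) = 0 := by
    intro γ hγ
    have e1 : HasMFDerivAt G.I Y.I (φ.obj ∘ fun g : G => a.act g x) (1 : G) (F.comp A) :=
      hF'.comp (1 : G) hA
    have hb : SmoothAt (M := H.toMfd) (N := Y) (fun h : H => b.act h (φ.obj x)) (φ.hom 1) :=
      b.smoothAt_act (smoothAt_id (M := H.toMfd) _) (smoothAt_const _ _)
    have e2 := (hb.hasMFDerivAt.comp (1 : G) hD).congr_of_eventuallyEq
      (f₁ := φ.obj ∘ fun g : G => a.act g x) (Eventually.of_forall fun g => φ.map_act g x)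
    have e3 := DFunLike.congr_fun (hasMFDerivAt_unique e1 e2) γ
    refine e3.trans ?_
    change mfderiv H.I Y.I _ _ (D γ) = 0
    rw [hγ]
    exact map_zero _
  -- The curve of graphs `g ↦ graph (g, x)` has a smooth left inverse near `1`, and its derivative
  -- has only `A` and `D` as nonzero components.
  have key2 : ∀ γ, D γ = 0 → A γ = 0 → γ = 0 := by
    intro γ h1 h2
    obtain ⟨ρ, hρ⟩ := h3 ((1 : G), x)
    let m : G.toMfd → (X.prod X).prod (H.toMfd.prod Y) := fun g => φ.graph (g, x)
    have hm : HasMFDerivAt G.I ((X.I.prod X.I).prod (H.I.prod Y.I)) m (1 : G)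
        (((0 : G.E →L[ℝ] X.E).prod A).prod (D.prod (0 : G.E →L[ℝ] Y.E))) :=
      ((hasMFDerivAt_const x (1 : G)).prodMk hA).prodMk
        (hD.prodMk (hasMFDerivAt_const (φ.obj x) (1 : G)))
    have hmc : Tendsto m (𝓝 1) (𝓝 (m 1)) := hm.1
    have hinj : Function.Injective (mfderiv G.I ((X.I.prod X.I).prod (H.I.prod Y.I)) m (1 : G)) :=
      mfderiv_injective_of_leftInverse (g := fun z => (ρ z).1) hm.mdifferentiableAt
        (SmoothAt.fst (N := G.toMfd) hρ.self_of_nhds.1).hasMFDerivAt.mdifferentiableAt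
        ((hmc.eventually hρ).mono fun g hg => congrArg Prod.fst (hg.2 (g, x) rfl))
    rw [hm.mfderiv] at hinj
    refine hinj (a₁ := γ) (a₂ := 0) ?_
    change (((0 : X.E), A γ), (D γ, (0 : Y.E))) = (((0 : X.E), A 0), (D 0, (0 : Y.E)))
    rw [h1, h2, map_zero, map_zero]
  -- Differentiate the local factorization `x' = k(x') r(φ(x'))` along `v`: the factor `r` does not
  -- vary since `F v = 0`, so `v` is the action of `γ = dk(v)`. The relation `φ(k(x')) = h(φ(x'))`
  -- gives `D γ = 0`.
  have key3 : ∀ v, F v = 0 → ∃ γ, D γ = 0 ∧ A γ = v := by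
    intro v hv
    obtain ⟨k, r, h, hk, hr, dk, dr, dh, hev⟩ := exists_local_factorization hφ x
    let K : X.E →L[ℝ] G.E := mfderiv X.I G.I k x
    have hK : HasMFDerivAt X.I G.I k x K := dk.hasMFDerivAt
    let R : Y.E →L[ℝ] X.E := mfderiv Y.I X.I r (φ.obj x)
    have hR : HasMFDerivAt Y.I X.I r (φ.obj x) R := dr.hasMFDerivAt
    refine ⟨K v, ?_, ?_⟩
    · have hD' : HasMFDerivAt G.I H.I φ.hom (k x) D := by rw [hk]; exact hD
      have e1 : HasMFDerivAt X.I H.I (φ.hom ∘ k) x (D.comp K) := hD'.comp x hK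
      have e2 := (dh.hasMFDerivAt.comp x hF).congr_of_eventuallyEq
        (f₁ := φ.hom ∘ k) (hev.mono fun x' hx' => hx'.1)
      have e3 := DFunLike.congr_fun (hasMFDerivAt_unique e1 e2) v
      refine e3.trans ?_
      change mfderiv Y.I H.I h (φ.obj x) (F v) = 0
      rw [hv]
      exact map_zero _
    · have hΛ' : HasMFDerivAt (G.I.prod X.I) X.I (fun p : G × X => a.act p.1 p.2)
          (k x, r (φ.obj x)) Λ := by rw [hk, hr]; exact hΛ
      have e1 : HasMFDerivAt X.I (G.I.prod X.I) (fun x' => (k x', r (φ.obj x'))) x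
          (K.prod (R.comp F)) := hK.prodMk (hR.comp x hF)
      have e2 : HasMFDerivAt X.I X.I ((fun p : G × X => a.act p.1 p.2) ∘
          fun x' => (k x', r (φ.obj x'))) x (Λ.comp (K.prod (R.comp F))) := hΛ'.comp x e1
      have e3 : HasMFDerivAt X.I X.I ((fun p : G × X => a.act p.1 p.2) ∘
          fun x' => (k x', r (φ.obj x'))) x (ContinuousLinearMap.id ℝ X.E) :=
        (hasMFDerivAt_id x).congr_of_eventuallyEq (hev.mono fun x' hx' => hx'.2)
      have e4 : Λ (K v, R (F v)) = v := DFunLike.congr_fun (hasMFDerivAt_unique e2 e3) v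
      rw [hv, map_zero] at e4
      exact e4
  have hker : Module.finrank ℝ (D : G.E →ₗ[ℝ] H.E).ker = Module.finrank ℝ (F : X.E →ₗ[ℝ] Y.E).ker := by
    let T : (D : G.E →ₗ[ℝ] H.E).ker →ₗ[ℝ] (F : X.E →ₗ[ℝ] Y.E).ker :=
      (A : G.E →ₗ[ℝ] X.E).restrict fun γ hγ => key1 γ hγ
    refine (LinearEquiv.ofBijective T ⟨?_, ?_⟩).finrank_eq
    · rw [injective_iff_map_eq_zero]
      rintro ⟨γ, hγ⟩ h
      exact Subtype.ext (key2 γ hγ (congrArg Subtype.val h))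
    · rintro ⟨v, hv⟩
      obtain ⟨γ, hγ, hγv⟩ := key3 v hv
      exact ⟨⟨γ, hγ⟩, Subtype.ext hγv⟩
  have r1 : mrank X.I Y.I φ.obj x + Module.finrank ℝ (F : X.E →ₗ[ℝ] Y.E).ker
      = Module.finrank ℝ X.E := mrank_add_finrank_ker φ.obj x
  have r2 : mrank G.I H.I φ.hom 1 + Module.finrank ℝ (D : G.E →ₗ[ℝ] H.E).ker
      = Module.finrank ℝ G.E := mrank_add_finrank_ker (I := G.I) (J := H.I) (φ.hom : G → H) (1 : G)
  omega

/-- If the homomorphism of groups is open onto its range, so is the map of spaces. -/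
theorem isOpenMap_rangeFactorization_obj {φ : EquivariantFunctor a b}
    (hφ : φ.toFunctor.IsWeakEquivalence) (ho : IsOpenMap φ.hom.rangeRestrict) :
    IsOpenMap (Set.rangeFactorization φ.obj) := by
  obtain ⟨h1, h2, -⟩ := φ.isWeakEquivalence_iff.1 hφ
  intro U hU
  rw [isOpen_iff_mem_nhds]
  rintro _ ⟨x, hx, rfl⟩
  obtain ⟨σ, hσ, hσ'⟩ := h1.1.exists_section (x, (1 : H))
  have hx1 : b.translate φ.obj (x, (1 : H)) = φ.obj x := by
    change b.act (1 : H)⁻¹ (φ.obj x) = φ.obj x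
    rw [inv_one, b.one_act]
  rw [hx1] at hσ hσ'
  have hact : ContinuousAt (fun p : G × X => a.act p.1 p.2) ((1 : G), x) :=
    a.act_smooth.continuous.continuousAt
  have hUn : U ∈ 𝓝 (a.act 1 x) := by rw [a.one_act]; exact hU.mem_nhds hx
  have hWU := hact hUn
  rw [Filter.mem_map, nhds_prod_eq, Filter.mem_prod_iff] at hWU
  obtain ⟨W, hW, U', hU', hWU⟩ := hWU
  have hO := ho.image_mem_nhds hW
  rw [map_one, nhds_subtype_eq_comap] at hO
  obtain ⟨O, hO, hOW⟩ := hO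
  have hsc : ContinuousAt σ (φ.obj x) := hσ'.self_of_nhds.1.continuousAt
  have hc1 : Tendsto (fun y => (σ y).1) (𝓝 (φ.obj x)) (𝓝 x) := by
    have : Tendsto (fun y => (σ y).1) (𝓝 (φ.obj x)) (𝓝 (σ (φ.obj x)).1) :=
      hσ'.self_of_nhds.1.fst.continuousAt
    rwa [hσ] at this
  have hc2 : Tendsto (fun y => ((σ y).2 : H)⁻¹) (𝓝 (φ.obj x)) (𝓝 1) := by
    have : Tendsto (fun y => ((σ y).2 : H)⁻¹) (𝓝 (φ.obj x)) (𝓝 ((σ (φ.obj x)).2 : H)⁻¹) :=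
      (LieGrp.smoothAt_inv hσ'.self_of_nhds.1.snd).continuousAt
    rw [hσ] at this
    simpa only [inv_one] using this
  have hval : Tendsto (Subtype.val : Set.range φ.obj → Y) (𝓝 (Set.rangeFactorization φ.obj x))
      (𝓝 (φ.obj x)) := continuous_subtype_val.tendsto _
  filter_upwards [hval.eventually hσ', hval.eventually (hc1 hU'), hval.eventually (hc2 hO)]
    with z hz1 hz2 hz3
  obtain ⟨_, x', rfl⟩ := z
  have e1 : b.act ((σ (φ.obj x')).2 : H)⁻¹ (φ.obj (σ (φ.obj x')).1) = φ.obj x' := hz1.2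
  obtain ⟨g, hg1, hg2⟩ := h2 _ _ _ e1
  -- Fullness provides some `g` over an element near `1`, but `g` itself may be far from `1`.
  -- Openness onto the range replaces it by `w` in `W` with the same image.
  obtain ⟨w, hw, hwg⟩ := hOW (a := φ.hom.rangeRestrict g) (by
    change φ.hom g ∈ O
    rw [hg1]
    exact hz3)
  have hwg : φ.hom w = φ.hom g := congrArg Subtype.val hwg
  have hmem : a.act w (σ (φ.obj x')).1 ∈ U := @hWU (w, (σ (φ.obj x')).1) ⟨hw, hz2⟩
  refine ⟨a.act w (σ (φ.obj x')).1, hmem, Subtype.ext ?_⟩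
  change φ.obj (a.act w (σ (φ.obj x')).1) = φ.obj x'
  rw [φ.map_act, hwg, hg1, e1]

end EquivariantFunctor

/-- A smooth action from its action map. -/
def LieAction.ofAct {G : LieGrp.{u}} {X : Mfd.{u}} (f : G → X → X) (h1 : ∀ x, f 1 x = x)
    (hm : ∀ g h x, f (g * h) x = f g (f h x))
    (hs : Smooth (M := G.toMfd.prod X) (N := X) fun p => f p.1 p.2) : LieAction G X :=
  letI : MulAction G X := { smul := f, one_smul := h1, mul_smul := hm }
  { smooth := ⟨hs⟩ }

/-- Transport of an action along a diffeomorphism. -/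
def LieAction.transport {G : LieGrp.{u}} {X Y : Mfd.{u}} (b : LieAction G Y)
    (e : Diffeomorph X.I Y.I X Y ∞) : LieAction G X :=
  LieAction.ofAct (fun g x => e.symm (b.act g (e x)))
    (fun x => by rw [b.one_act, e.symm_apply_apply])
    (fun g h x => by rw [e.apply_symm_apply, b.mul_act])
    (fun p => SmoothAt.comp (N := Y) (g := e.symm) (e.symm.contMDiff _)
      (b.smoothAt_act (M := G.toMfd.prod X) (smoothAt_id p).fst
        (SmoothAt.comp (N := X) (g := e) (e.contMDiff _) (smoothAt_id p).snd)))

theorem LieAction.transport_act {G : LieGrp.{u}} {X Y : Mfd.{u}} (b : LieAction G Y)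
    (e : Diffeomorph X.I Y.I X Y ∞) (g : G) (x : X) :
    (b.transport e).act g x = e.symm (b.act g (e x)) := rfl

/-! ### Cancellation of weak equivalences, induced actions and normal quotients -/

namespace EquivariantFunctor

variable {G H K : LieGrp.{u}} {X Y Z : Mfd.{u}} {a : LieAction G X} {b : LieAction H Y}
  {c : LieAction K Z}

theorem isIso_of_inverse (χ : EquivariantFunctor a b) (u : H → G) (v : Y → X)
    (hu : Smooth (M := H.toMfd) (N := G.toMfd) u) (hv : Smooth v)
    (hu1 : ∀ g, u (χ.hom g) = g) (hu2 : ∀ h, χ.hom (u h) = h) (hv1 : ∀ x, v (χ.obj x) = x)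
    (hv2 : ∀ y, χ.obj (v y) = y) : χ.IsIso := by
  have hi : Function.Injective χ.hom := Function.LeftInverse.injective hu1
  let θ : EquivariantFunctor b a :=
    { hom := MonoidHom.mk' u fun x y => hi (by rw [hu2, map_mul, hu2, hu2])
      obj := v
      hom_smooth := hu
      obj_smooth := hv
      map_act := fun h y => Function.LeftInverse.injective hv1 (by
        rw [hv2, χ.map_act, hv2]
        exact congrArg (fun g => b.act g y) (hu2 h).symm) }
  exact ⟨θ, EquivariantFunctor.ext (MonoidHom.ext hu1) (funext hv1),
    EquivariantFunctor.ext (MonoidHom.ext hu2) (funext hv2)⟩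

section Factorization

variable {π : EquivariantFunctor a c} {j : EquivariantFunctor c b}

/-- The first factor of a weak equivalence is a weak equivalence if it is a surjective submersion
on objects and the second factor is injective on arrows. -/
theorem isWeakEquivalence_of_comp_left (h : (j.comp π).toFunctor.IsWeakEquivalence)
    (hπ : SurjSubmersion π.obj) (hj : Function.Injective j.hom) :
    π.toFunctor.IsWeakEquivalence := by
  obtain ⟨-, h2, h3⟩ := (j.comp π).isWeakEquivalence_iff.1 h
  refine π.isWeakEquivalence_iff.2 ⟨⟨submersion_of_sections
    (c.translate_smooth π.obj_smooth) ?_, fun z => ?_⟩, fun x₁ x₂ k hk => ?_, fun p => ?_⟩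
  · rintro ⟨x, k⟩
    obtain ⟨σ, hσ, hσ'⟩ := hπ.1.exists_section x
    have e1 : c.act k (c.translate π.obj (x, k)) = π.obj x := c.act_inv_act k _
    have hs : Smooth (M := Z) (N := Z) (c.act k) := fun z =>
      c.smoothAt_act (smoothAt_const k z) (smoothAt_id z)
    refine ⟨fun z => (σ (c.act k z), k), ?_, ?_⟩
    · dsimp only
      rw [e1, hσ]
    · have hc : Tendsto (c.act k) (𝓝 (c.translate π.obj (x, k))) (𝓝 (π.obj x)) := by
        rw [← e1]
        exact hs.continuous.tendsto _
      filter_upwards [hc.eventually hσ'] with z hz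
      refine ⟨(SmoothAt.comp (g := σ) hz.1 (hs.smoothAt z)).prodMk (smoothAt_const k z), ?_⟩
      change c.act k⁻¹ (π.obj (σ (c.act k z))) = z
      rw [hz.2, c.inv_act_act]
  · obtain ⟨x, rfl⟩ := hπ.2 z
    refine ⟨(x, (1 : K)), ?_⟩
    change c.act (1 : K)⁻¹ (π.obj x) = π.obj x
    rw [inv_one, c.one_act]
  · obtain ⟨g, hg1, hg2⟩ := h2 x₁ x₂ (j.hom k) (by
      change b.act (j.hom k) (j.obj (π.obj x₁)) = j.obj (π.obj x₂)
      rw [← j.map_act, hk])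
    exact ⟨g, hj hg1, hg2⟩
  · obtain ⟨ρ, hρ⟩ := h3 p
    -- Applying `j` to the arrow component turns the graph of `π` into that of `j ∘ π`, whose
    -- retraction can be pulled back.
    let m : (X.prod X).prod (K.toMfd.prod Z) → (X.prod X).prod (H.toMfd.prod Y) :=
      fun z => (z.1, (j.hom z.2.1, j.obj z.2.2))
    have hm : Smooth m := fun z => (smoothAt_id z).fst.prodMk
      (((j.hom_smooth.smoothAt _).comp (smoothAt_id z).snd.fst).prodMk
        ((j.obj_smooth.smoothAt _).comp (smoothAt_id z).snd.snd))
    have hmc : Tendsto m (𝓝 (π.graph p)) (𝓝 ((j.comp π).graph p)) := hm.continuous.tendsto _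
    refine ⟨fun z => ρ (m z), ?_⟩
    filter_upwards [hmc.eventually hρ] with z hz
    refine ⟨SmoothAt.comp (f := m) hz.1 (hm.smoothAt z), ?_⟩
    rintro q rfl
    exact hz.2 q rfl

/-- The second factor of a weak equivalence is a weak equivalence if the first one is surjective
on objects and the second one is a smooth embedding of groups. -/
theorem isWeakEquivalence_of_comp_right (h : (j.comp π).toFunctor.IsWeakEquivalence)
    (hπ : Function.Surjective π.obj)
    (hj : ∀ k : K, LocallyRetractable (M := K.toMfd) (N := H.toMfd) j.hom k) :
    j.toFunctor.IsWeakEquivalence := by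
  obtain ⟨h1, h2, -⟩ := (j.comp π).isWeakEquivalence_iff.1 h
  refine j.isWeakEquivalence_iff.2 ⟨⟨submersion_of_sections
    (b.translate_smooth j.obj_smooth) ?_, fun y => ?_⟩, fun z₁ z₂ h hh => ?_, fun p => ?_⟩
  · rintro ⟨z, h⟩
    obtain ⟨x, rfl⟩ := hπ z
    obtain ⟨σ, hσ, hσ'⟩ := h1.1.exists_section (x, h)
    refine ⟨fun y => (π.obj (σ y).1, (σ y).2), ?_, ?_⟩
    · change (π.obj (σ (b.translate (j.comp π).obj (x, h))).1,
        (σ (b.translate (j.comp π).obj (x, h))).2) = _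
      rw [hσ]
    · refine hσ'.mono fun y hy => ⟨?_, hy.2⟩
      exact ((π.obj_smooth.smoothAt _).comp hy.1.fst).prodMk (P := H.toMfd) hy.1.snd
  · obtain ⟨⟨x, h⟩, rfl⟩ := h1.2 y
    exact ⟨(π.obj x, h), rfl⟩
  · obtain ⟨x₁, rfl⟩ := hπ z₁
    obtain ⟨x₂, rfl⟩ := hπ z₂
    obtain ⟨g, hg1, rfl⟩ := h2 x₁ x₂ h hh
    exact ⟨π.hom g, hg1, (π.map_act g x₁).symm⟩
  -- An arrow `(k, z)` is recovered from its source `z` and from `j(k)`, so a retraction on groups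
  -- suffices.
  · obtain ⟨ρ, hρ⟩ := hj p.1
    have hc : Tendsto (fun z : (Z.prod Z).prod (H.toMfd.prod Y) => z.2.1) (𝓝 (j.graph p))
        (𝓝 (j.hom p.1)) :=
      (Smooth.continuous (M := (Z.prod Z).prod (H.toMfd.prod Y)) (N := H.toMfd)
        (f := fun z => z.2.1) fun z => (smoothAt_id z).snd.fst).tendsto _
    refine ⟨fun z => (ρ z.2.1, z.1.1), ?_⟩
    filter_upwards [hc.eventually hρ] with z hz
    have s1 : SmoothAt (M := (Z.prod Z).prod (H.toMfd.prod Y)) (N := Z) (fun z => z.1.1) z :=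
      (smooth_fst.smoothAt (M := (Z.prod Z).prod (H.toMfd.prod Y)) (N := Z.prod Z) z).fst
    have s2 : SmoothAt (M := (Z.prod Z).prod (H.toMfd.prod Y)) (N := H.toMfd)
      (fun z => z.2.1) z :=
      (smooth_snd.smoothAt (M := (Z.prod Z).prod (H.toMfd.prod Y)) (N := H.toMfd.prod Y) z).fst
    refine ⟨(SmoothAt.comp (g := ρ) hz.1 s2).prodMk s1, ?_⟩
    rintro q rfl
    exact Prod.ext (hz.2 _ rfl) rfl

end Factorization

/-- An equivariant weak equivalence along the inclusion of a closed subgroup exhibits its target as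
an induced action. -/
theorem exists_inducedAction {K : ClosedLieSubgroup H} {c : LieAction K.toLieGrp Z}
    {j : EquivariantFunctor c b} (hj : j.toFunctor.IsWeakEquivalence) (hK : j.hom = K.incl) :
    ∃ (ind : InducedAction K c) (χ : EquivariantFunctor ind.action b),
      χ.hom = MonoidHom.id H ∧ χ.IsIso ∧ j = χ.comp ind.inclusion := by
  obtain ⟨h1, h2, -⟩ := j.isWeakEquivalence_iff.1 hj
  let m : H.toMfd.prod Z → Y := fun p => b.act p.1 (j.obj p.2)
  have hm : Smooth m := fun p =>
    b.smoothAt_act (smoothAt_id p).fst ((j.obj_smooth.smoothAt _).comp (smoothAt_id p).snd)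
  -- Up to inverting the group element, `m` is the translation map of essential surjectivity; hence
  -- it is a surjective submersion.
  have hmt : ∀ (z : Z) (h : H), b.translate j.obj (z, h⁻¹) = m (h, z) := fun z h => by
    change b.act (h⁻¹)⁻¹ (j.obj z) = b.act h (j.obj z)
    rw [inv_inv]
  have hms : SurjSubmersion m := by
    refine ⟨submersion_of_sections hm ?_, fun y => ?_⟩
    · rintro ⟨h, z⟩
      obtain ⟨σ, hσ, hσ'⟩ := h1.1.exists_section (z, (h⁻¹ : H))
      rw [hmt] at hσ hσ'
      refine ⟨fun y => ((σ y).2⁻¹, (σ y).1), ?_, hσ'.mono fun y hy => ⟨?_, hy.2⟩⟩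
      · dsimp only
        rw [hσ]
        dsimp only
        rw [inv_inv]
      · exact SmoothAt.prodMk (N := H.toMfd) (LieGrp.smoothAt_inv hy.1.snd) hy.1.fst
    · obtain ⟨⟨z, h⟩, rfl⟩ := h1.2 y
      exact ⟨((h : H)⁻¹, z), rfl⟩
  have hr : ∀ p q, antidiagonal K c p q ↔ m p = m q := by
    rintro ⟨h, z⟩ ⟨h', z'⟩
    constructor
    · rintro ⟨k, hk⟩
      obtain ⟨rfl, rfl⟩ := Prod.mk.inj hk
      change b.act h (j.obj z) = b.act (h * (K.incl k)⁻¹) (j.obj (c.act k z))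
      rw [j.map_act, b.mul_act, hK, b.inv_act_act]
    -- If `h z = h' z'`, then `h'⁻¹ h` carries `z` to `z'`, and fullness puts it in `K`.
    · intro hmm
      have hmm : b.act h (j.obj z) = b.act h' (j.obj z') := hmm
      obtain ⟨k, hk, rfl⟩ := h2 z z' (h'⁻¹ * h : H) (by rw [b.mul_act, hmm, b.inv_act_act])
      refine ⟨k, Prod.ext ?_ rfl⟩
      change h' = h * (K.incl k)⁻¹
      rw [← hK, hk]
      group
  obtain ⟨Q, e, he⟩ := hms.exists_quotientStr (antidiagonal K c) hr
  let ind : InducedAction K c :=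
    { quot := Q
      action := b.transport e
      act_proj := fun g g' x => by
        rw [LieAction.transport_act, he]
        refine e.injective ((e.apply_symm_apply _).trans ?_)
        refine Eq.trans ?_ (he _).symm
        exact (b.mul_act g g' (j.obj x)).symm }
  let χ : EquivariantFunctor ind.action b :=
    { hom := MonoidHom.id H
      obj := e
      hom_smooth := smooth_id
      obj_smooth := e.contMDiff
      map_act := fun g x => e.apply_symm_apply _ }
  refine ⟨ind, χ, rfl, χ.isIso_of_inverse (fun h => h) e.symm smooth_id e.symm.contMDiff
    (fun _ => rfl) (fun _ => rfl) e.symm_apply_apply e.apply_symm_apply,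
    EquivariantFunctor.ext hK (funext fun z => ?_)⟩
  change j.obj z = e (Q.proj ((1 : H), z))
  rw [he]
  exact (b.one_act _).symm

/-- A weak equivalence that is a surjective submersion on groups and on spaces and has a compact
kernel is a quotient by a normal subgroup. -/
theorem isNormalQuotient {π : EquivariantFunctor a c} (hπ : π.toFunctor.IsWeakEquivalence)
    (hG : SurjSubmersion (M := G.toMfd) (N := K.toMfd) π.hom) (hX : SurjSubmersion π.obj)
    (hN : IsCompact (π.hom.ker : Set G)) : π.IsNormalQuotient := by
  obtain ⟨-, h2, h3⟩ := π.isWeakEquivalence_iff.1 hπ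
  have hrG : ∀ g h : G, QuotientGroup.leftRel π.hom.ker g h ↔ π.hom g = π.hom h := fun g h => by
    rw [QuotientGroup.leftRel_apply, MonoidHom.mem_ker, map_mul, map_inv, inv_mul_eq_one]
  have hrX : ∀ x y : X, a.orbitSetoid π.hom.ker x y ↔ π.obj x = π.obj y := by
    intro x y
    constructor
    · rintro ⟨⟨n, hn⟩, hx⟩
      have hx : a.act n y = x := hx
      rw [← hx, π.map_act, MonoidHom.mem_ker.1 hn, c.one_act]
    -- Points with the same image are joined by an arrow over the unit element, by fullness; its
    -- group element lies in the kernel.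
    · intro hxy
      obtain ⟨n, hn, hx⟩ := h2 y x 1 (by rw [c.one_act, hxy])
      exact ⟨⟨n, MonoidHom.mem_ker.2 hn⟩, hx⟩
  obtain ⟨QX, eX, heX⟩ := hX.exists_quotientStr (a.orbitSetoid π.hom.ker) hrX
  obtain ⟨QM, eG, heG⟩ := hG.exists_quotientStr (QuotientGroup.leftRel π.hom.ker) hrG
  have hmul : ∀ s t : G ⧸ π.hom.ker, eG (s * t : G ⧸ π.hom.ker) = eG s * eG t := by
    rintro ⟨g⟩ ⟨h⟩
    have e1 : eG (QM.proj (g * h)) = eG (QM.proj g) * eG (QM.proj h) := by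
      rw [heG, heG, heG, map_mul]
    exact e1
  have hinv : ∀ s : G ⧸ π.hom.ker, eG (s⁻¹ : G ⧸ π.hom.ker) = (eG s)⁻¹ := by
    rintro ⟨g⟩
    have e1 : eG (QM.proj g⁻¹) = (eG (QM.proj g))⁻¹ := by
      rw [heG, heG, map_inv]
    exact e1
  have hone : eG (1 : G ⧸ π.hom.ker) = 1 := by
    have e1 : eG (QM.proj 1) = 1 := by rw [heG, map_one]
    exact e1
  -- Under the diffeomorphism `eG` the operations of the quotient group are those of `K`, hence
  -- smooth.
  have hgrp : letI : ChartedSpace (EuclideanSpace ℝ (Fin QM.dim)) (G ⧸ π.hom.ker) := QM.charted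
      LieGroup (𝓡 QM.dim) ∞ (G ⧸ π.hom.ker) := by
    let _ : ChartedSpace (EuclideanSpace ℝ (Fin QM.dim)) (G ⧸ π.hom.ker) := QM.charted
    have hs : ∀ y : K, SmoothAt (M := K.toMfd) (N := QM.toMfd) eG.symm y := eG.symm.contMDiff
    have he : ∀ s, SmoothAt (M := QM.toMfd) (N := K.toMfd) eG s := eG.contMDiff
    have e1 : Smooth (M := QM.toMfd.prod QM.toMfd) (N := QM.toMfd)
        fun p => eG.symm (eG p.1 * eG p.2) := fun p =>
      SmoothAt.comp (N := K.toMfd) (g := eG.symm) (hs _) (LieGrp.smoothAt_mul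
        ((he _).comp (smoothAt_id p).fst) ((he _).comp (smoothAt_id p).snd))
    have e2 : Smooth (M := QM.toMfd) (N := QM.toMfd) fun s => eG.symm (eG s)⁻¹ := fun s =>
      SmoothAt.comp (N := K.toMfd) (g := eG.symm) (hs _) (LieGrp.smoothAt_inv (he s))
    have e3 : ∀ p : (G ⧸ π.hom.ker) × (G ⧸ π.hom.ker), p.1 * p.2 = eG.symm (eG p.1 * eG p.2) :=
      fun p => by rw [← hmul]; exact (eG.symm_apply_apply _).symm
    have e4 : ∀ s : G ⧸ π.hom.ker, s⁻¹ = eG.symm (eG s)⁻¹ :=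
      fun s => by rw [← hinv]; exact (eG.symm_apply_apply _).symm
    exact
      { QM.isManifold with
        contMDiff_mul := e1.congr e3
        contMDiff_inv := e2.congr e4 }
  let QG : QuotientLieGroup G π.hom.ker := ⟨QM, hgrp⟩
  have hone' : ∀ z, c.act (eG (1 : QG.toLieGrp)) z = z := fun z =>
    (congrArg (fun k => c.act k z) hone).trans (c.one_act z)
  have hmul' : ∀ (s t : QG.toLieGrp) z, c.act (eG (s * t : QG.toLieGrp)) z =
      c.act (eG s) (c.act (eG t) z) := fun s t z =>
    (congrArg (fun k => c.act k z) (hmul s t)).trans (c.mul_act _ _ z)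
  let d : LieAction QG.toLieGrp QX.toMfd := LieAction.ofAct
    (fun s x => eX.symm (c.act (eG s) (eX x)))
    (fun x => by rw [hone', eX.symm_apply_apply])
    (fun s t x => by rw [hmul', eX.apply_symm_apply]) fun p =>
      SmoothAt.comp (N := Z) (g := eX.symm) (eX.symm.contMDiff _)
        (c.smoothAt_act (M := QG.toLieGrp.toMfd.prod QX.toMfd)
          (SmoothAt.comp (N := QG.toLieGrp.toMfd) (g := eG) (eG.contMDiff _) (smoothAt_id p).fst)
          (SmoothAt.comp (N := QX.toMfd) (g := eX) (eX.contMDiff _) (smoothAt_id p).snd))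
  let q : EquivariantFunctor a d :=
    { hom := MonoidHom.mk' (M := G) (G := QG.toLieGrp) QM.proj fun g h => rfl
      obj := QX.proj
      hom_smooth := QM.proj_smooth
      obj_smooth := QX.proj_smooth
      map_act := fun g x => by
        change QX.proj (a.act g x) = eX.symm (c.act (eG (QM.proj g)) (eX (QX.proj x)))
        rw [heG, heX, ← π.map_act, ← heX, eX.symm_apply_apply] }
  let ψ : EquivariantFunctor d c :=
    { hom := MonoidHom.mk' (M := QG.toLieGrp) (G := K) eG hmul
      obj := eX
      hom_smooth := eG.contMDiff
      obj_smooth := eX.contMDiff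
      map_act := fun s x => eX.apply_symm_apply _ }
  refine ⟨π.hom.ker, inferInstance, hN.isClosed, ?_, ?_, QG, QX, d, q, ψ, fun _ => rfl,
    fun _ => rfl, ψ.isIso_of_inverse eG.symm eX.symm eG.symm.contMDiff eX.symm.contMDiff
    eG.symm_apply_apply eG.apply_symm_apply eX.symm_apply_apply eX.apply_symm_apply,
    EquivariantFunctor.ext (MonoidHom.ext fun g => (heG g).symm)
      (funext fun x => (heX x).symm)⟩
  -- The arrows `(n, x)` and `(1, x)` have the same source, target and image.
  · intro n hn x hx
    have h4 : π.graph (n, x) = π.graph ((1 : G), x) := by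
      change ((x, a.act n x), (π.hom n, π.obj x)) = ((x, a.act 1 x), (π.hom 1, π.obj x))
      rw [hx, a.one_act, MonoidHom.mem_ker.1 hn, map_one]
    exact congrArg Prod.fst (injective_of_hasLocalRetraction h3 h4)
  -- The first component of the map is the projection off a compact factor, already proper; this
  -- forces the pair to be proper.
  · have : CompactSpace π.hom.ker := isCompact_iff_compactSpace.1 hN
    have hact : Continuous fun p : π.hom.ker × X => a.act p.1 p.2 :=
      a.act_smooth.continuous.comp (continuous_subtype_val.prodMap continuous_id)
    exact isProperMap_of_comp_of_t2 (continuous_snd.prodMk hact) continuous_fst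
      (isProperMap_snd_of_compactSpace (X := π.hom.ker) (Y := X))

end EquivariantFunctor

/-! ### Inheritance of the properties and the image factorization -/

namespace EquivariantFunctor

variable {G H K : LieGrp.{u}} {X Y Z : Mfd.{u}} {a : LieAction G X} {b : LieAction H Y}
  {c : LieAction K Z}

/-- If the endpoints of arrows converge in `Z`, properness of the large groupoid yields a limit
arrow between points of `Z`, and fullness lifts it. The embeddings transfer the convergence back;
`Z` need not be closed in `Y`. -/
theorem isProper_of_isEmbedding {j : EquivariantFunctor c b}
    (hj : j.toFunctor.IsWeakEquivalence) (hjG : IsEmbedding j.hom) (hjX : IsEmbedding j.obj)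
    (hb : b.groupoid.IsProper) : c.groupoid.IsProper := by
  obtain ⟨-, h2, -⟩ := j.isWeakEquivalence_iff.1 hj
  have hb : IsProperMap fun p : H × Y => (p.2, b.act p.1 p.2) := hb
  change IsProperMap fun p : K × Z => (p.2, c.act p.1 p.2)
  rw [isProperMap_iff_ultrafilter] at hb ⊢
  have hjj : IsEmbedding (Prod.map j.hom j.obj) := hjG.prodMap hjX
  refine ⟨continuous_snd.prodMk c.act_smooth.continuous, fun 𝒰 w hw => ?_⟩
  have hw' : Tendsto (fun p : H × Y => (p.2, b.act p.1 p.2)) (𝒰.map (Prod.map j.hom j.obj))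
      (𝓝 (j.obj w.1, j.obj w.2)) := by
    rw [Ultrafilter.coe_map, tendsto_map'_iff]
    have e : (fun p : H × Y => (p.2, b.act p.1 p.2)) ∘ Prod.map j.hom j.obj =
        Prod.map j.obj j.obj ∘ fun p : K × Z => (p.2, c.act p.1 p.2) :=
      funext fun p => Prod.ext rfl (j.map_act p.1 p.2).symm
    rw [e]
    exact ((hjX.continuous.prodMap hjX.continuous).tendsto w).comp hw
  obtain ⟨⟨h, y⟩, hhy, hle⟩ := hb.2 hw'
  obtain ⟨rfl, hy⟩ := Prod.mk.inj hhy
  obtain ⟨k, rfl, hk⟩ := h2 _ _ _ hy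
  refine ⟨(k, w.1), Prod.ext rfl hk, ?_⟩
  rw [hjj.isInducing.nhds_eq_comap, ← map_le_iff_le_comap]
  exact hle

/-- The properties of action groupoids other than effectivity pass from the two ends to the middle
of a factorization into a surjection and an embedding. -/
theorem satisfies_of_factorization {π : EquivariantFunctor a c} {j : EquivariantFunctor c b}
    (hπ : π.toFunctor.IsWeakEquivalence) (hπG : Function.Surjective π.hom)
    (hπX : Function.Surjective π.obj) (hj : j.toFunctor.IsWeakEquivalence)
    (hjG : IsEmbedding j.hom) (hjX : IsEmbedding j.obj) {P : Set ActionProperty}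
    (hP : ActionProperty.effective ∉ P) (ha : a.Satisfies P) (hb : b.Satisfies P) :
    c.Satisfies P := by
  have hfix : ∀ k z, c.act k z = z → b.act (j.hom k) (j.obj z) = j.obj z := fun k z h => by
    rw [← j.map_act, h]
  have hone : ∀ k, j.hom k = 1 → k = 1 := fun k h => hjG.injective (h.trans (map_one j.hom).symm)
  intro p hp
  -- Freeness, local freeness, discreteness and properness restrict along the embedding `j`;
  -- transitivity, compactness and the orbifold property pass along `π`.
  cases p with
  | free =>
    have hf : b.IsFree := hb _ hp
    exact fun k z h => hone k (hf _ _ (hfix k z h))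
  | locallyFree =>
    obtain ⟨U, hU, hf⟩ : b.IsLocallyFree := hb _ hp
    refine ⟨j.hom ⁻¹' U, hjG.continuous.continuousAt.preimage_mem_nhds (by rwa [map_one]), ?_⟩
    exact fun k hk z h => hone k (hf _ hk _ (hfix k z h))
  | transitive =>
    have ht : a.IsTransitive := ha _ hp
    intro z₁ z₂
    obtain ⟨x₁, rfl⟩ := hπX z₁
    obtain ⟨x₂, rfl⟩ := hπX z₂
    obtain ⟨g, rfl⟩ := ht x₁ x₂
    exact ⟨π.hom g, (π.map_act g x₁).symm⟩
  -- Effectivity can fail in the middle: let S₃ × ℤ/2 act on S₃ by left and right multiplication and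
  -- map to S₃ acting on three points. The middle groupoid is ℤ/2 acting on a point.
  | effective => exact absurd hp hP
  | compact =>
    have : CompactSpace G := ha _ hp
    exact hπG.compactSpace (Smooth.continuous (M := G.toMfd) (N := K.toMfd) π.hom_smooth)
  | discrete =>
    have : DiscreteTopology H := hb _ hp
    exact hjG.discreteTopology
  | proper => exact isProper_of_isEmbedding hj hjG hjX (hb _ hp)
  | orbifold =>
    -- The span to a proper étale groupoid keeps its apex; its leg to the first groupoid is
    -- prolonged by `π`.
    obtain ⟨𝒪, h1, h2, 𝒦, f, g, hf, hg⟩ : a.groupoid.IsOrbifold := ha _ hp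
    exact ⟨𝒪, h1, h2, 𝒦, π.toFunctor.comp f, g, hπ.comp hf, hg⟩

/-- The properties of action groupoids are invariant under equivariant isomorphisms. -/
theorem IsIso.satisfies {χ : EquivariantFunctor a b} (hχ : χ.IsIso) {P : Set ActionProperty}
    (hP : ActionProperty.effective ∉ P) (hb : b.Satisfies P) : a.Satisfies P := by
  have ⟨θ, h1, h2⟩ := hχ
  have e1 : ∀ x, θ.obj (χ.obj x) = x := fun x => congrFun (congrArg EquivariantFunctor.obj h1) x
  have e2 : ∀ g, θ.hom (χ.hom g) = g := fun g =>
    DFunLike.congr_fun (congrArg EquivariantFunctor.hom h1) g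
  have hθ : θ.IsIso := ⟨χ, h2, h1⟩
  -- Here `a` is the middle term of the factorization of the identity of `b` through the inverse `θ`
  -- and `χ`.
  refine satisfies_of_factorization hθ.isWeakEquivalence (fun g => ⟨_, e2 g⟩)
    (fun x => ⟨_, e1 x⟩) hχ.isWeakEquivalence ?_ ?_ hP hb hb
  · exact Function.LeftInverse.isEmbedding e2
      (Smooth.continuous (M := H.toMfd) (N := G.toMfd) θ.hom_smooth)
      (Smooth.continuous (M := G.toMfd) (N := H.toMfd) χ.hom_smooth)
  · exact Function.LeftInverse.isEmbedding e1 θ.obj_smooth.continuous χ.obj_smooth.continuous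

/-- An equivariant weak equivalence that is proper on groups factors through its image. -/
theorem exists_image_factorization {φ : EquivariantFunctor a b}
    (hφ : φ.toFunctor.IsWeakEquivalence) (hproper : IsProperMap φ.hom) :
    ∃ (K : ClosedLieSubgroup H) (X' : Mfd.{u}) (c : LieAction K.toLieGrp X')
      (π : EquivariantFunctor a c) (j : EquivariantFunctor c b),
      SurjSubmersion (M := G.toMfd) (N := K.toLieGrp.toMfd) π.hom ∧ SurjSubmersion π.obj ∧
      j.hom = K.incl ∧ IsEmbedding j.obj ∧ φ = j.comp π := by
  obtain ⟨-, h2, -⟩ := φ.isWeakEquivalence_iff.1 hφ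
  have hGs : Smooth (M := G.toMfd) (N := H.toMfd) φ.hom := φ.hom_smooth
  have ho : IsOpenMap φ.hom.rangeRestrict := LieGrp.isOpenMap_rangeRestrict hproper
  obtain ⟨PK, hPK⟩ := exists_submfdStr_range (M := G.toMfd) (N := H.toMfd) (f := φ.hom) hGs
    (LieGrp.mrank_hom hGs) (S := (φ.hom.range : Set H)) φ.hom.rangeRestrict (fun _ => rfl)
    φ.hom.rangeRestrict_surjective ho
  obtain ⟨PX, hPX⟩ := exists_submfdStr_range (M := X) (N := Y) (f := φ.obj) φ.obj_smooth
    -- This is the rank given by `mrank_obj_add`, which also shows that the truncated subtraction is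
    -- exact.
    (d := Module.finrank ℝ X.E + mrank G.I H.I φ.hom 1 - Module.finrank ℝ G.E)
    (fun x => Nat.eq_sub_of_add_eq (mrank_obj_add hφ x))
    (Set.rangeFactorization φ.obj) (fun _ => rfl) Set.rangeFactorization_surjective
    (isOpenMap_rangeFactorization_obj hφ ho)
  let K : ClosedLieSubgroup H := ⟨φ.hom.range, hproper.isClosedMap.isClosed_range, PK⟩
  have hmem : ∀ (k : K.toLieGrp) (z : PX.toMfd), b.act (K.incl k) (PX.val z) ∈ Set.range φ.obj := by
    rintro ⟨_, g, rfl⟩ ⟨_, x, rfl⟩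
    exact ⟨a.act g x, φ.map_act g x⟩
  have hincl : Smooth (M := K.toLieGrp.toMfd) (N := H.toMfd) K.incl := PK.val_smooth
  let c : LieAction K.toLieGrp PX.toMfd := LieAction.ofAct
    (fun k z => ⟨b.act (K.incl k) (PX.val z), hmem k z⟩)
    (fun z => Subtype.ext ((congrArg (fun h => b.act h (PX.val z)) (map_one K.incl)).trans
      (b.one_act _)))
    (fun k l z => Subtype.ext
      ((congrArg (fun h => b.act h (PX.val z)) (map_mul K.incl k l)).trans (b.mul_act _ _ _)))
    (PX.smooth_iff.2 fun p => b.smoothAt_act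
      (SmoothAt.comp (N := K.toLieGrp.toMfd) (g := K.incl) (hincl _) (smoothAt_id p).fst)
      (SmoothAt.comp (N := PX.toMfd) (PX.val_smooth _) (smoothAt_id p).snd))
  let π : EquivariantFunctor a c :=
    { hom := MonoidHom.mk' (M := G) (G := K.toLieGrp) φ.hom.rangeRestrict
        fun g h => map_mul φ.hom.rangeRestrict g h
      obj := Set.rangeFactorization φ.obj
      hom_smooth := hPK.1.smooth
      obj_smooth := hPX.1.smooth
      map_act := fun g x => Subtype.ext (φ.map_act g x) }
  let j : EquivariantFunctor c b :=
    { hom := K.incl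
      obj := PX.val
      hom_smooth := hincl
      obj_smooth := PX.val_smooth
      map_act := fun k z => rfl }
  exact ⟨K, PX.toMfd, c, π, j, hPK, hPX, rfl, PX.isEmbedding_val, rfl⟩

end EquivariantFunctor

end

/-- The sets `P \ {effective}` are exactly the sets of properties other than effectivity, which need
not be inherited by the middle groupoid. -/
theorem theoremt {G H : LieGrp.{u}} {X Y : Mfd.{u}} (a : LieAction G X) (b : LieAction H Y)
    (P : Set ActionProperty)
    (ha : a.Satisfies (P \ {ActionProperty.effective}))
    (hb : b.Satisfies (P \ {ActionProperty.effective}))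
    (φ : EquivariantFunctor a b) (hφ : φ.toFunctor.IsWeakEquivalence)
    (hproper : IsProperMap φ.hom) :
    ∃ (K : ClosedLieSubgroup H) (X' : Mfd.{u}) (c : LieAction K.toLieGrp X')
      (ind : InducedAction K c) (π : EquivariantFunctor a c)
      (χ : EquivariantFunctor ind.action b),
      π.MemSW (P \ {ActionProperty.effective}) ∧ π.IsNormalQuotient ∧
      ind.inclusion.MemW (P \ {ActionProperty.effective}) ∧
      χ.hom = MonoidHom.id H ∧ χ.IsIso ∧
      φ = χ.comp (ind.inclusion.comp π) := by
  obtain ⟨K, X', c, π, j, hπG, hπX, hjG, hjX, rfl⟩ :=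
    EquivariantFunctor.exists_image_factorization hφ hproper
  have hemb : Topology.IsEmbedding j.hom := hjG ▸ K.submfd.isEmbedding_val
  have hret : ∀ k : K.toLieGrp, Mfd.LocallyRetractable (M := K.toLieGrp.toMfd) (N := H.toMfd)
      j.hom k := hjG ▸ K.submfd.val_hasLocalRetraction
  have hπ := EquivariantFunctor.isWeakEquivalence_of_comp_left hφ hπX hemb.injective
  have hj := EquivariantFunctor.isWeakEquivalence_of_comp_right hφ hπX.2 hret
  -- Since `j` is injective on groups, the kernel of `π` is the fibre over `1` of the proper
  -- homomorphism.
  have hker : IsCompact (π.hom.ker : Set G) := by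
    have h1 : (π.hom.ker : Set G) = (j.comp π).hom ⁻¹' {1} := by
      ext g
      exact ⟨fun h => (congrArg j.hom h).trans (map_one j.hom), fun h =>
        hemb.injective (h.trans (map_one j.hom).symm)⟩
    rw [h1]
    exact hproper.isCompact_preimage isCompact_singleton
  have hP : ActionProperty.effective ∉ P \ {ActionProperty.effective} := fun h => h.2 rfl
  have hc := EquivariantFunctor.satisfies_of_factorization hπ hπG.2 hπX.2 hj hemb hjX hP ha hb
  obtain ⟨ind, χ, hχ, hiso, hjχ⟩ := EquivariantFunctor.exists_inducedAction hj hjG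
  have hind : ind.inclusion.toFunctor.IsWeakEquivalence := by
    have ⟨θ, h1, h2⟩ := hiso
    have hθ : θ.IsIso := ⟨χ, h2, h1⟩
    -- The inclusion into the induced action is `j` followed by the inverse of `χ`, so it inherits
    -- the weak equivalence.
    have h3 : ind.inclusion = θ.comp j := by
      rw [hjχ]
      exact (congrArg (fun ξ => EquivariantFunctor.comp ξ ind.inclusion) h1).symm
    rw [h3]
    exact hθ.isWeakEquivalence.comp hj
  exact ⟨K, X', c, ind, π, χ, ⟨ha, hc, hπ, hπX⟩,
    EquivariantFunctor.isNormalQuotient hπ hπG hπX hker,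
    ⟨hc, hiso.satisfies hP hb, hind⟩, hχ, hiso, by rw [hjχ]; rfl⟩
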